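/- All lattices are finitely generated free $\mathbb{Z}$-modules with an integral symmetric bilinear form. Let $U$ be the hyperbolic plane, let $E_8$, $A_2$ be the negative definite root lattices, and let $\Lambda := U^{3}\oplus E_8^{2}\oplus A_2$ (the second cohomology lattice, with the Beauville–Bogomolov–Fujiki form, of a hyperkähler manifold of $OG10$ type; its signature is $(3,21)$ and its discriminant group $A_\Lambda=\Lambda^*/\Lambda$ is $\mathbb{Z}/3\mathbb{Z}$). Let $\iota\in O(\Lambda)$ be an involution with invariant lattice $\Lambda_+=\{x:\iota x=x\}$ and coinvariant lattice $\Lambda_-=\{x:\iota x=-x\}$. Assume that $\iota$ acts by $-\mathrm{id}$ on $A_\Lambda$ and that $\Lambda_-$ is negative definite (both hold for the involution of $\Lambda$ induced by a symplectic birational involution, acting by $-\mathrm{id}$ on the discriminant group, of a manifold of $OG10$ type). Put $r:=\operatorname{rank}\Lambda_-$, let $a:=l(A_{\Lambda_+})$ be the minimal number of generators of $A_{\Lambda_+}=\Lambda_+^*/\Lambda_+$, and let $\delta\in\{0,1\}$ be the invariant with $\delta=0$ if and only if the discriminant quadratic form of $\Lambda_+$ takes values in $\mathbb{Z}/2\mathbb{Z}$,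 i.e. $(x,x)\in\mathbb{Z}$ for all $x\in\Lambda_+^*$. Then $\Lambda_+$ is $2$-elementary, $A_{\Lambda_+}\cong(\mathbb{Z}/2\mathbb{Z})^a$, and $\Lambda_+$ splits off a $U$ summand, i.e. $\Lambda_+\cong\Gamma\oplus U$ for some lattice $\Gamma$, if and only if 1. $r\le 20$ and $a\le 22-r$, and 2. if $a=22-r$ and $\delta=0$, then $r\equiv 2 \pmod 8$. Consequently, if $r<12$, then $\Lambda_+\cong\Gamma\oplus U$ for some lattice $\Gamma$. -/

import Mathlib

open LinearMap (BilinForm)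
open scoped TensorProduct

universe u v

noncomputable section

namespace OG10

/-! ### Lattices: free `ℤ`-modules of finite rank with an integral symmetric bilinear form -/

/-- The orthogonal direct sum of two bilinear forms. -/
def orthSum {M : Type u} {N : Type v} [AddCommGroup M] [AddCommGroup N]
    (B : BilinForm ℤ M) (C : BilinForm ℤ N) : BilinForm ℤ (M × N) :=
  LinearMap.mk₂ ℤ (fun x y => B x.1 y.1 + C x.2 y.2)
    (fun x x' y => by simp only [Prod.fst_add, Prod.snd_add, map_add, LinearMap.add_apply]; ring)
    (fun k x y => by
      simp only [Prod.smul_fst, Prod.smul_snd, map_zsmul, LinearMap.smul_apply, smul_add])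
    (fun x y y' => by simp only [Prod.fst_add, Prod.snd_add, map_add]; ring)
    (fun k x y => by simp only [Prod.smul_fst, Prod.smul_snd, map_zsmul, smul_add])

/-- The hyperbolic plane `U`. -/
def U : BilinForm ℤ (Fin 2 → ℤ) := Matrix.toBilin' !![0, 1; 1, 0]

/-- The negative definite root lattice `E₈`. -/
def E8 : BilinForm ℤ (Fin 8 → ℤ) := Matrix.toBilin' (-CartanMatrix.E₈)

/-- The negative definite root lattice `A₂`. -/
def A2 : BilinForm ℤ (Fin 2 → ℤ) := Matrix.toBilin' (-CartanMatrix.A 2)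

/-- The underlying group of `U³ ⊕ E₈² ⊕ A₂`. -/
abbrev Carrier : Type :=
  (Fin 2 → ℤ) × (Fin 2 → ℤ) × (Fin 2 → ℤ) × (Fin 8 → ℤ) × (Fin 8 → ℤ) × (Fin 2 → ℤ)

/-- The lattice `Λ = U³ ⊕ E₈² ⊕ A₂`, of signature `(3, 21)`. -/
def Lam : BilinForm ℤ Carrier :=
  orthSum U (orthSum U (orthSum U (orthSum E8 (orthSum E8 A2))))

/-! ### Dual lattice, discriminant group and its invariants -/

section Discriminant

variable {M : Type u} [AddCommGroup M] (B : BilinForm ℤ M)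

/-- The image of the lattice `L` in `L ⊗ ℚ`. -/
def inRat (M : Type u) [AddCommGroup M] : AddSubgroup (ℚ ⊗[ℤ] M) :=
  (TensorProduct.mk ℤ ℚ M 1).toAddMonoidHom.range

/-- The dual lattice `L* = {x ∈ L ⊗ ℚ | (x, L) ⊆ ℤ}`. -/
def dual : AddSubgroup (ℚ ⊗[ℤ] M) where
  carrier := {x | ∀ m : M, ∃ n : ℤ, B.baseChange ℚ x (1 ⊗ₜ[ℤ] m) = (n : ℚ)}
  zero_mem' m := ⟨0, by simp⟩
  add_mem' {x y} hx hy m := by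
    obtain ⟨k, hk⟩ := hx m
    obtain ⟨l, hl⟩ := hy m
    exact ⟨k + l, by simp [hk, hl]⟩
  neg_mem' {x} hx m := by
    obtain ⟨k, hk⟩ := hx m
    exact ⟨-k, by simp [hk]⟩

/-- The discriminant group `A_L = L* / L`. -/
abbrev DiscGroup : Type u := dual B ⧸ (inRat M).addSubgroupOf (dual B)

/-- `l(A_L)`: the minimal number of generators of the discriminant group. -/
def discLength : ℕ :=
  sInf {n | ∃ s : Finset (DiscGroup B), s.card = n ∧ AddSubgroup.closure (s : Set (DiscGroup B)) = ⊤}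

open Classical in
/-- The invariant `δ_L ∈ {0, 1}`. The discriminant form of an even lattice is
`q_L : A_L → ℚ / 2ℤ`, `[x] ↦ (x, x)`, so that `q_L` takes values in `ℤ / 2ℤ` if and only if
`(x, x) ∈ ℤ` for every `x ∈ L*`; in that case `δ_L = 0`. -/
def delta : ℕ :=
  if ∀ x ∈ dual B, ∃ n : ℤ, B.baseChange ℚ x x = (n : ℚ) then 0 else 1

variable {B}

/-- The rational extension of an isometry. -/
def ratMap (g : B.IsometryEquiv B) : (ℚ ⊗[ℤ] M) →ₗ[ℚ] (ℚ ⊗[ℤ] M) :=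
  (g.toLinearEquiv : M →ₗ[ℤ] M).baseChange ℚ

theorem ratMap_tmul (g : B.IsometryEquiv B) (a : ℚ) (m : M) :
    ratMap g (a ⊗ₜ[ℤ] m) = a ⊗ₜ[ℤ] (g m) := rfl

theorem ratMap_form (g : B.IsometryEquiv B) (x y : ℚ ⊗[ℤ] M) :
    B.baseChange ℚ (ratMap g x) (ratMap g y) = B.baseChange ℚ x y := by
  induction x with
  | zero => simp
  | add x x' hx hx' => simp only [map_add, LinearMap.add_apply, hx, hx']
  | tmul a m =>
    induction y with
    | zero => simp
    | add y y' hy hy' => simp only [map_add, hy, hy']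
    | tmul b n =>
      simp only [ratMap_tmul, LinearMap.BilinForm.baseChange_tmul,
        LinearMap.BilinForm.IsometryEquiv.map_app]

theorem ratMap_mem_inRat (g : B.IsometryEquiv B) {x : ℚ ⊗[ℤ] M} (hx : x ∈ inRat M) :
    ratMap g x ∈ inRat M := by
  obtain ⟨m, rfl⟩ := hx
  exact ⟨g m, rfl⟩

theorem ratMap_mem_dual (g : B.IsometryEquiv B) {x : ℚ ⊗[ℤ] M} (hx : x ∈ dual B) :
    ratMap g x ∈ dual B := by
  intro m
  have h : ratMap g (1 ⊗ₜ[ℤ] (g.toLinearEquiv.symm m)) = 1 ⊗ₜ[ℤ] m := by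
    rw [ratMap_tmul]
    congr 1
    exact g.toLinearEquiv.apply_symm_apply m
  rw [← h, ratMap_form]
  exact hx _

/-- The action of an isometry of `L` on `L*`. -/
def dualMap (g : B.IsometryEquiv B) : dual B →+ dual B :=
  ((ratMap g).toAddMonoidHom.comp (dual B).subtype).codRestrict (dual B)
    fun x => ratMap_mem_dual g x.2

/-- The induced action of an isometry of `L` on the discriminant group `A_L`. -/
def discMap (g : B.IsometryEquiv B) : DiscGroup B →+ DiscGroup B :=
  QuotientAddGroup.map _ _ (dualMap g) fun _ hx => ratMap_mem_inRat g hx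

end Discriminant

/-! ### Invariant and coinvariant lattices, splitting of `U` -/

section Involution

variable {M : Type u} [AddCommGroup M] {B : BilinForm ℤ M}

/-- The underlying group of the invariant lattice `L₊` of an isometry. -/
def invariants (g : B.IsometryEquiv B) : Submodule ℤ M :=
  LinearMap.ker ((g.toLinearEquiv : M →ₗ[ℤ] M) - LinearMap.id)

/-- The underlying group of the coinvariant lattice `L₋` of an involution, on which the
involution acts as `-1`. -/
def coinvariants (g : B.IsometryEquiv B) : Submodule ℤ M :=
  LinearMap.ker ((g.toLinearEquiv : M →ₗ[ℤ] M) + LinearMap.id)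

/-- The invariant lattice `L₊` with the restricted form. -/
def invariantLattice (g : B.IsometryEquiv B) : BilinForm ℤ (invariants g) :=
  B.restrict (invariants g)

/-- The coinvariant lattice `L₋` with the restricted form. -/
def coinvariantLattice (g : B.IsometryEquiv B) : BilinForm ℤ (coinvariants g) :=
  B.restrict (coinvariants g)

/-- The form is negative definite. -/
def NegativeDefinite (B : BilinForm ℤ M) : Prop := ∀ x, x ≠ 0 → B x x < 0

/-- The lattice splits a `U` summand: it is isometric to `Γ ⊕ U` for some lattice `Γ`. -/
def SplitsU (B : BilinForm ℤ M) : Prop :=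
  ∃ (Γ : Type u) (_ : AddCommGroup Γ) (_ : Module.Free ℤ Γ) (_ : Module.Finite ℤ Γ)
    (C : BilinForm ℤ Γ), C.IsSymm ∧ B.Equivalent (orthSum C U)

end Involution

end OG10

end

/-! ### The Witt group of a field -/

/-! Write L = Λ₊, n = 24 - r for its rank, and 2L* for the vectors of L that pair evenly with all of
L.

Since 3Λ* ⊆ Λ and ι acts by -1 on A_Λ, the vector y + ιy lies in Λ₊ for every y in Λ*. Extending a
functional from Λ₊ to Λ and averaging its representative shows that twice the dual of L lies in L
(`exists_average`), so L is 2-elementary. The same averages make A_L a quotient of Λ/Λ₊, whence a ≤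
r. Because Λ₋ is negative definite, L has signature s = r - 18. Comparing 2L ⊆ 2L* ⊆ L gives [L :
2L*] = 2^(n-a).

An even 2-elementary lattice splits U once it has an isotropic vector outside 2L*. Isotropic vectors
come from the rational Witt group. A descent over the primes, with second residues, shows that the
Witt class of a lattice is generated by classes ⟨m⟩ with m bounded in terms of the primes dividing
its discriminant (`cls_mem_filt`). For L the class is therefore k⟨1⟩ or k⟨1⟩ + ⟨2⟩, and k is read
off from s. Such a class is carried by a form of rank at most |s - 1| + 1, which is less than n when
r ≤ 20, so L is isotropic.

If some vector outside 2L* has norm divisible by 4, the isotropic vector can be moved out of 2L*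
(`splitsU_of_isotropic_of_norm`). Otherwise every vector outside 2L* has norm 2 mod 4. If moreover L
≠ 2L*, then L/2L* is a plane (so a = 22 - r) and δ = 0. In that case 2L* + ℤx with half the form is
unimodular, and van der Blij's lemma gives s ≡ 4 mod 8, that is r ≡ 6 mod 8. This is the only
obstruction.

Conversely, a hyperbolic pair e, z in L forces 4 ∣ [L : 2L*], so a ≤ 22 - r. If equality holds and δ
= 0, the lattice 2L* + ℤe with half the form is even unimodular, so 8 ∣ s and r ≡ 2 mod 8. Adjoining
e - z to Λ₋ gives a negative definite lattice of rank r + 1 ≤ 21, so r ≤ 20. For r < 12 the bound a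
≤ r leaves a = 22 - r possible only at r = 11, which is not 6 mod 8. -/

namespace WittGrp

open Module

/-! ### Metabolic forms and their Lagrangians. -/

section Metabolic

variable {k : Type*} [Field k] {V V' V'' : Type*} [AddCommGroup V] [Module k V]
  [AddCommGroup V'] [Module k V'] [AddCommGroup V''] [Module k V'']

/-- The orthogonal sum of two bilinear forms over a field. -/
def prodForm (B : BilinForm k V) (C : BilinForm k V') : BilinForm k (V × V') :=
  B.comp (LinearMap.fst k V V') (LinearMap.fst k V V') +
    C.comp (LinearMap.snd k V V') (LinearMap.snd k V V')

@[simp] theorem prodForm_apply (B : BilinForm k V) (C : BilinForm k V') (x y : V × V') :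
    prodForm B C x y = B x.1 y.1 + C x.2 y.2 := rfl

/-- Symmetric and nondegenerate forms. -/
structure IsInner (B : BilinForm k V) : Prop where
  symm : ∀ x y, B x y = B y x
  nondeg : ∀ x, (∀ y, B x y = 0) → x = 0

namespace IsInner

theorem prod {B : BilinForm k V} {C : BilinForm k V'} (hB : IsInner B) (hC : IsInner C) :
    IsInner (prodForm B C) where
  symm x y := by simp [hB.symm x.1, hC.symm x.2]
  nondeg x h := by
    have h1 : x.1 = 0 := hB.nondeg _ fun y => by simpa using h (y, 0)
    have h2 : x.2 = 0 := hC.nondeg _ fun y => by simpa using h (0, y)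
    exact Prod.ext h1 h2

theorem neg {B : BilinForm k V} (hB : IsInner B) : IsInner (-B) where
  symm x y := by simp [hB.symm x]
  nondeg x h := hB.nondeg x fun y => by simpa using h y

theorem smul {B : BilinForm k V} (hB : IsInner B) {c : k} (hc : c ≠ 0) : IsInner (c • B) where
  symm x y := by simp [hB.symm x]
  nondeg x h := hB.nondeg x fun y => by simpa [hc] using h y

theorem nondegenerate {B : BilinForm k V} (hB : IsInner B) : B.Nondegenerate :=
  ⟨fun x h => hB.nondeg x h, fun x h => hB.nondeg x fun y => by rw [hB.symm]; exact h y⟩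

theorem finrank_orthogonal_add [FiniteDimensional k V] {B : BilinForm k V} (hB : IsInner B)
    (T : Submodule k V) : finrank k (B.orthogonal T) + finrank k T = finrank k V := by
  rw [LinearMap.BilinForm.finrank_orthogonal hB.nondegenerate]
  have := T.finrank_le
  omega

end IsInner

/-- A totally isotropic subspace of at least half the dimension. -/
def IsLagrangian (B : BilinForm k V) (T : Submodule k V) : Prop :=
  (∀ x ∈ T, ∀ y ∈ T, B x y = 0) ∧ finrank k V ≤ 2 * finrank k T

/-- The form has a Lagrangian. -/
def Metabolic (B : BilinForm k V) : Prop := ∃ T, IsLagrangian B T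

/-- By dimension count a Lagrangian equals its own orthogonal complement. -/
theorem IsLagrangian.mem [FiniteDimensional k V] {B : BilinForm k V} (hB : IsInner B)
    {T : Submodule k V} (h : IsLagrangian B T) {x : V} (hx : ∀ t ∈ T, B x t = 0) : x ∈ T := by
  have hle : T ≤ B.orthogonal T := fun t ht s hs => h.1 s hs t ht
  have h2 := hB.finrank_orthogonal_add T
  have h3 := h.2
  rw [Submodule.eq_of_le_of_finrank_le hle (by omega)]
  exact fun s hs => by rw [hB.symm]; exact hx s hs

theorem metabolic_map {B : BilinForm k V} {C : BilinForm k V'} (f : V →ₗ[k] V')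
    (hi : Function.Injective f) (c : k)
    (hf : ∀ x y, C (f x) (f y) = c * B x y) (hd : finrank k V' ≤ finrank k V)
    (h : Metabolic B) : Metabolic C := by
  obtain ⟨T, hT, hTd⟩ := h
  refine ⟨T.map f, ?_, ?_⟩
  · rintro _ ⟨x, hx, rfl⟩ _ ⟨y, hy, rfl⟩
    rw [hf, hT x hx y hy, mul_zero]
  · rw [(T.equivMapOfInjective f hi).finrank_eq.symm]
    omega

theorem finrank_range_add_finrank_ker_submodule [FiniteDimensional k V] (U : Submodule k V) (f : U →ₗ[k] V') :
    finrank k (LinearMap.range f) + finrank k (LinearMap.ker f) = finrank k U :=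
  f.finrank_range_add_finrank_ker

variable [FiniteDimensional k V] [FiniteDimensional k V'] [FiniteDimensional k V'']

/-- The graph of an isometry is a Lagrangian of B ⊥ -C. -/
theorem metabolic_of_map {B : BilinForm k V} {C : BilinForm k V'} (f : V →ₗ[k] V')
    (hf : ∀ x y, C (f x) (f y) = B x y) (hd : finrank k V' ≤ finrank k V) :
    Metabolic (prodForm B (-C)) := by
  refine ⟨f.graph, ?_, ?_⟩
  · rintro ⟨x, x'⟩ hx ⟨y, y'⟩ hy
    rw [LinearMap.mem_graph_iff] at hx hy
    simp only at hx hy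
    subst hx hy
    simp [hf]
  · rw [finrank_prod]
    have : finrank k f.graph = finrank k V := by
      rw [LinearMap.graph_eq_range_prod]
      apply LinearMap.finrank_range_of_inj
      intro x y h
      exact (Prod.ext_iff.1 h).1
    omega

/-- Lagrangians compose like correspondences: pairs in S × T that agree in the middle space are
projected to the outer two spaces. Nondegeneracy of the middle form is what makes the dimension
large enough. -/
theorem metabolic_trans {A : BilinForm k V} {B : BilinForm k V'} {C : BilinForm k V''}
    (hB : IsInner B)
    (h1 : Metabolic (prodForm A (-B))) (h2 : Metabolic (prodForm B (-C))) :
    Metabolic (prodForm A (-C)) := by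
  obtain ⟨S, hS, hSd⟩ := h1
  obtain ⟨T, hT, hTd⟩ := h2
  let g : S × T →ₗ[k] V' :=
    (LinearMap.snd k V V' ∘ₗ S.subtype ∘ₗ LinearMap.fst k S T) -
      (LinearMap.fst k V' V'' ∘ₗ T.subtype ∘ₗ LinearMap.snd k S T)
  let h : LinearMap.ker g →ₗ[k] V × V'' :=
    ((LinearMap.fst k V V' ∘ₗ S.subtype ∘ₗ LinearMap.fst k S T).prod
      (LinearMap.snd k V' V'' ∘ₗ T.subtype ∘ₗ LinearMap.snd k S T)) ∘ₗ (LinearMap.ker g).subtype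
  have hg : ∀ s : LinearMap.ker g, s.1.1.1.2 = s.1.2.1.1 := fun s => sub_eq_zero.1 s.2
  let j : LinearMap.ker h →ₗ[k] V' :=
    LinearMap.snd k V V' ∘ₗ S.subtype ∘ₗ LinearMap.fst k S T ∘ₗ (LinearMap.ker g).subtype ∘ₗ
      (LinearMap.ker h).subtype
  have hh : ∀ s : LinearMap.ker h, s.1.1.1.1.1 = 0 ∧ s.1.1.2.1.2 = 0 := fun s =>
    Prod.ext_iff.1 (LinearMap.mem_ker.1 s.2)
  have hj : Function.Injective j := by
    intro s t hst
    have e1 : s.1.1.1.1.2 = t.1.1.1.1.2 := hst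
    apply Subtype.ext; apply Subtype.ext
    refine Prod.ext (Subtype.ext (Prod.ext ?_ e1)) (Subtype.ext (Prod.ext ?_ ?_))
    · rw [(hh s).1, (hh t).1]
    · rw [← hg s.1, ← hg t.1]; exact e1
    · rw [(hh s).2, (hh t).2]
  -- `range g` measures the failure of the pairs to match, and `range j` is the part of the middle
  -- space lost by the projection. Their orthogonality bounds the sum of their dimensions by dim V',
  -- which is exactly what the count below needs.
  have hort : LinearMap.range g ≤ B.orthogonal (LinearMap.range j) := by
    rintro _ ⟨⟨s, t⟩, rfl⟩ _ ⟨y, rfl⟩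
    have a1 := hS _ y.1.1.1.2 _ s.2
    have a2 := hT _ y.1.1.2.2 _ t.2
    simp only [prodForm_apply, LinearMap.neg_apply, (hh y).1, (hh y).2, map_zero,
      LinearMap.zero_apply, zero_add, add_zero, neg_eq_zero] at a1 a2
    change B y.1.1.1.1.2 (s.1.2 - t.1.1) = 0
    rw [map_sub, a1, hg y.1, a2, sub_zero]
  refine ⟨LinearMap.range h, ?_, ?_⟩
  · rintro _ ⟨s, rfl⟩ _ ⟨t, rfl⟩
    have a1 := hS _ s.1.1.2 _ t.1.1.2
    have a2 := hT _ s.1.2.2 _ t.1.2.2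
    simp only [prodForm_apply, LinearMap.neg_apply, ← hg] at a1 a2 ⊢
    change A s.1.1.1.1 t.1.1.1.1 + -C s.1.2.1.2 t.1.2.1.2 = 0
    linear_combination a1 + a2
  · have r1 := g.finrank_range_add_finrank_ker
    have r2 := finrank_range_add_finrank_ker_submodule (LinearMap.ker g) h
    have r3 := LinearMap.finrank_range_of_inj hj
    have r4 := hB.finrank_orthogonal_add (LinearMap.range j)
    have r5 := Submodule.finrank_mono hort
    rw [finrank_prod] at *
    omega

theorem metabolic_symm {B : BilinForm k V} {C : BilinForm k V'}
    (h : Metabolic (prodForm B (-C))) : Metabolic (prodForm C (-B)) := by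
  refine metabolic_map (LinearEquiv.prodComm k V V').toLinearMap
    (LinearEquiv.injective _) (-1) ?_ ?_ h
  · intro x y
    simp
  · simp [add_comm]

theorem Metabolic.prod {B : BilinForm k V} {C : BilinForm k V'} (h : Metabolic B)
    (h' : Metabolic C) : Metabolic (prodForm B C) := by
  obtain ⟨S, hS, hSd⟩ := h
  obtain ⟨T, hT, hTd⟩ := h'
  refine ⟨LinearMap.range (S.subtype.prodMap T.subtype), ?_, ?_⟩
  · rintro _ ⟨x, rfl⟩ _ ⟨y, rfl⟩
    simp [hS _ x.1.2 _ y.1.2, hT _ x.2.2 _ y.2.2]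
  · rw [LinearMap.finrank_range_of_inj
      (S.injective_subtype.prodMap T.injective_subtype), finrank_prod, finrank_prod]
    omega

/-- A nonzero metabolic form is isotropic. -/
theorem Metabolic.exists_isotropic [Nontrivial V] {B : BilinForm k V} (h : Metabolic B) :
    ∃ x, x ≠ 0 ∧ B x x = 0 := by
  obtain ⟨T, hT, hTd⟩ := h
  have : 0 < finrank k V := finrank_pos
  obtain ⟨x, hx, h0⟩ := T.exists_mem_ne_zero_of_ne_bot (by
    rintro rfl
    simp at hTd
    omega)
  exact ⟨x, h0, hT x hx x hx⟩

end Metabolic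

/-- A nondegenerate symmetric bilinear space of finite dimension. -/
structure InnerSpace (k : Type) [Field k] where
  V : Type
  [grp : AddCommGroup V]
  [mod : Module k V]
  [fin : FiniteDimensional k V]
  B : BilinForm k V
  inner : IsInner B

attribute [instance] InnerSpace.grp InnerSpace.mod InnerSpace.fin

variable {k : Type} [Field k]

/-- Witt equivalence. -/
def wittSetoid (k : Type) [Field k] : Setoid (InnerSpace k) where
  r X Y := Metabolic (prodForm X.B (-Y.B))
  iseqv := {
    refl := fun _ => metabolic_of_map LinearMap.id (fun _ _ => rfl) le_rfl
    symm := metabolic_symm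
    trans := fun {_ Y _} => metabolic_trans Y.inner }

/-- The Witt group. -/
def WittGroup (k : Type) [Field k] : Type 1 := Quotient (wittSetoid k)

/-! ### The group structure on Witt classes. -/

section Class

variable {V V' V'' : Type} [AddCommGroup V] [Module k V]
  [AddCommGroup V'] [Module k V'] [AddCommGroup V''] [Module k V'']
  [FiniteDimensional k V] [FiniteDimensional k V'] [FiniteDimensional k V'']

/-- The Witt class of a form. -/
def cls (B : BilinForm k V) (hB : IsInner B) : WittGroup k :=
  Quotient.mk (wittSetoid k) ⟨V, B, hB⟩

theorem cls_eq_iff {B : BilinForm k V} {C : BilinForm k V'} {hB : IsInner B} {hC : IsInner C} :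
    cls B hB = cls C hC ↔ Metabolic (prodForm B (-C)) :=
  Quotient.eq (r := wittSetoid k)

theorem cls_eq_of_map {B : BilinForm k V} {C : BilinForm k V'} {hB : IsInner B} {hC : IsInner C}
    (f : V →ₗ[k] V') (hf : ∀ x y, C (f x) (f y) = B x y) (hd : finrank k V' ≤ finrank k V) :
    cls B hB = cls C hC :=
  cls_eq_iff.2 (metabolic_of_map f hf hd)

theorem exists_cls_eq (w : WittGroup k) : ∃ X : InnerSpace k, cls X.B X.inner = w :=
  Quotient.exists_rep w

instance : Add (WittGroup k) :=
  ⟨Quotient.map₂ (fun X Y => ⟨X.V × Y.V, prodForm X.B Y.B, X.inner.prod Y.inner⟩)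
    (fun X X' h Y Y' h' => by
      refine metabolic_map (LinearEquiv.prodProdProdComm k X.V X'.V Y.V Y'.V).toLinearMap
        (LinearEquiv.injective _) 1 ?_ ?_ (Metabolic.prod h h')
      · intro x y
        simp
        ring
      · simp only [finrank_prod]; omega)⟩

instance : Neg (WittGroup k) :=
  ⟨Quotient.map (fun X => ⟨X.V, -X.B, X.inner.neg⟩) (fun X X' h => by
      refine metabolic_map LinearMap.id (fun _ _ h => h) (-1) ?_ le_rfl h
      intro x y
      simp
      ring)⟩

theorem isInner_zero : IsInner (0 : BilinForm k PUnit) := ⟨fun _ _ => rfl, fun _ _ => rfl⟩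

instance : Zero (WittGroup k) := ⟨cls (0 : BilinForm k PUnit) isInner_zero⟩

theorem cls_prod {B : BilinForm k V} {C : BilinForm k V'} (hB : IsInner B) (hC : IsInner C) :
    cls (prodForm B C) (hB.prod hC) = cls B hB + cls C hC := rfl

theorem cls_neg {B : BilinForm k V} (hB : IsInner B) : cls (-B) hB.neg = -cls B hB := rfl

theorem cls_eq_zero_iff {B : BilinForm k V} {hB : IsInner B} : cls B hB = 0 ↔ Metabolic B := by
  change cls B hB = cls (0 : BilinForm k PUnit) isInner_zero ↔ _
  rw [cls_eq_iff]
  constructor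
  · refine metabolic_map (LinearMap.fst k V PUnit) ?_ 1 ?_ ?_
    · rintro ⟨x, _⟩ ⟨y, _⟩ h; exact Prod.ext h rfl
    · intro x y; simp
    · simp
  · refine metabolic_map (LinearMap.inl k V PUnit) LinearMap.inl_injective 1 ?_ ?_
    · intro x y; simp
    · simp [finrank_eq_zero_of_subsingleton]

instance : AddCommGroup (WittGroup k) where
  add_assoc a b c := by
    obtain ⟨X, rfl⟩ := exists_cls_eq a
    obtain ⟨Y, rfl⟩ := exists_cls_eq b
    obtain ⟨Z, rfl⟩ := exists_cls_eq c
    simp only [← cls_prod]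
    refine cls_eq_of_map (LinearEquiv.prodAssoc k X.V Y.V Z.V).toLinearMap ?_ ?_
    · intro x y; simp [add_assoc]
    · simp only [finrank_prod]; omega
  zero_add a := by
    obtain ⟨X, rfl⟩ := exists_cls_eq a
    change cls (0 : BilinForm k PUnit) isInner_zero + _ = _
    rw [← cls_prod]
    exact cls_eq_of_map (LinearMap.snd k PUnit X.V) (by simp) (by simp)
  add_zero a := by
    obtain ⟨X, rfl⟩ := exists_cls_eq a
    change _ + cls (0 : BilinForm k PUnit) isInner_zero = _
    rw [← cls_prod]
    exact cls_eq_of_map (LinearMap.fst k X.V PUnit) (by simp) (by simp)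
  neg_add_cancel a := by
    obtain ⟨X, rfl⟩ := exists_cls_eq a
    rw [← cls_neg, ← cls_prod, cls_eq_zero_iff]
    refine metabolic_map (LinearEquiv.prodComm k X.V X.V).toLinearMap
      (LinearEquiv.injective _) 1 ?_ le_rfl
      (metabolic_of_map (B := X.B) (C := X.B) LinearMap.id (fun _ _ => rfl) le_rfl)
    intro x y
    simp
    ring
  add_comm a b := by
    obtain ⟨X, rfl⟩ := exists_cls_eq a
    obtain ⟨Y, rfl⟩ := exists_cls_eq b
    simp only [← cls_prod]
    refine cls_eq_of_map (LinearEquiv.prodComm k X.V Y.V).toLinearMap ?_ ?_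
    · intro x y; simp [add_comm]
    · simp only [finrank_prod]; omega
  nsmul := nsmulRec
  zsmul := zsmulRec

end Class

/-! ### Diagonal forms -/

/-- The one-dimensional form `⟨a⟩`. -/
def lineForm (a : k) : BilinForm k k := a • LinearMap.mul k k

@[simp] theorem lineForm_apply (a x y : k) : lineForm a x y = a * (x * y) := rfl

theorem isInner_lineForm {a : k} (ha : a ≠ 0) : IsInner (lineForm a) where
  symm x y := by simp [mul_comm]
  nondeg x h := by simpa [ha] using h 1

open Classical in
/-- The class of `⟨a⟩` for `a ≠ 0`; by convention it is `0` for `a = 0`. -/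
noncomputable def line (a : k) : WittGroup k :=
  if ha : a ≠ 0 then cls (lineForm a) (isInner_lineForm ha) else 0

theorem line_eq {a : k} (ha : a ≠ 0) : line a = cls (lineForm a) (isInner_lineForm ha) := dif_pos ha

theorem line_mul_sq {a c : k} (ha : a ≠ 0) (hc : c ≠ 0) : line (a * c ^ 2) = line a := by
  rw [line_eq ha, line_eq (mul_ne_zero ha (pow_ne_zero _ hc))]
  refine cls_eq_of_map (LinearMap.lsmul k k c) ?_ le_rfl
  intro x y
  simp
  ring

theorem line_neg {a : k} (ha : a ≠ 0) : line (-a) = -line a := by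
  rw [line_eq ha, line_eq (neg_ne_zero.2 ha), ← cls_neg]
  exact cls_eq_of_map LinearMap.id (fun x y => by simp) le_rfl

/-- The orthogonal vectors (1, 1) and (b, -a) of ⟨a⟩ ⊥ ⟨b⟩ have norms a + b and ab(a + b). -/
theorem line_add {a b : k} (ha : a ≠ 0) (hb : b ≠ 0) (hab : a + b ≠ 0) :
    line a + line b = line (a + b) + line (a * b * (a + b)) := by
  have hc : a * b * (a + b) ≠ 0 := mul_ne_zero (mul_ne_zero ha hb) hab
  rw [line_eq ha, line_eq hb, line_eq hab, line_eq hc, ← cls_prod, ← cls_prod]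
  symm
  refine cls_eq_of_map ((LinearMap.fst k k k + b • LinearMap.snd k k k).prod
    (LinearMap.fst k k k - a • LinearMap.snd k k k)) ?_ le_rfl
  intro x y
  simp
  ring

/-- The diagonal form with weights `w`. -/
def diagForm {ι : Type*} [Fintype ι] (w : ι → k) : BilinForm k (ι → k) :=
  ∑ i, (w i) • (LinearMap.mul k k).compl₁₂ (LinearMap.proj i) (LinearMap.proj i)

@[simp] theorem diagForm_apply {ι : Type*} [Fintype ι] (w : ι → k) (x y : ι → k) :
    diagForm w x y = ∑ i, w i * (x i * y i) := by
  simp [diagForm, LinearMap.sum_apply]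

theorem isInner_diagForm {ι : Type*} [Fintype ι] {w : ι → k} (hw : ∀ i, w i ≠ 0) :
    IsInner (diagForm w) where
  symm x y := by simp [mul_comm]
  nondeg x h := by
    classical
    funext i
    have := h (Pi.single i 1)
    simpa [Pi.single_apply, hw i] using this

theorem cls_diagForm {n : ℕ} (w : Fin n → k) (hw : ∀ i, w i ≠ 0) :
    cls (diagForm w) (isInner_diagForm hw) = ∑ i, line (w i) := by
  induction n with
  | zero =>
    rw [cls_eq_zero_iff.2]
    · simp
    · exact ⟨⊤, by intro x _ y _; simp, by simp⟩
  | succ n ih =>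
    rw [Fin.sum_univ_succ, ← ih (fun i => w i.succ) fun i => hw _, line_eq (hw 0), ← cls_prod]
    refine cls_eq_of_map ((LinearMap.proj 0).prod (LinearMap.funLeft k k Fin.succ)) ?_ ?_
    · intro x y
      simp [Fin.sum_univ_succ, LinearMap.funLeft_apply]
    · simp [add_comm]

end WittGrp

/-! ### Relations between one-dimensional forms -/

namespace WittGrp

open Module

variable {k : Type} [Field k] {A : Type*} [AddCommGroup A]

/-- A function on nonzero scalars satisfying the relations of one-dimensional Witt classes. -/
structure IsWittFun (φ : k → A) : Prop where
  sq : ∀ a c, a ≠ 0 → c ≠ 0 → φ (a * c ^ 2) = φ a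
  neg : ∀ a, a ≠ 0 → φ (-a) = -φ a
  add : ∀ a b, a ≠ 0 → b ≠ 0 → a + b ≠ 0 → φ a + φ b = φ (a + b) + φ (a * b * (a + b))

theorem isWittFun_line : IsWittFun (line (k := k)) :=
  ⟨fun _ _ => line_mul_sq, fun _ => line_neg, fun _ _ => line_add⟩

/-- Pairing `line` with φ lets one shortening of a list preserve both sums at once. -/
theorem IsWittFun.prod {A' : Type*} [AddCommGroup A'] {φ : k → A} {ψ : k → A'}
    (hφ : IsWittFun φ) (hψ : IsWittFun ψ) : IsWittFun fun a => (φ a, ψ a) where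
  sq a c ha hc := by rw [hφ.sq a c ha hc, hψ.sq a c ha hc]
  neg a ha := by rw [hφ.neg a ha, hψ.neg a ha]; rfl
  add a b ha hb hab := Prod.ext (hφ.add a b ha hb hab) (hψ.add a b ha hb hab)

/-- A diagonal form with entries adding up to zero splits a hyperbolic plane. -/
theorem IsWittFun.exists_shorter {φ : k → A} (hφ : IsWittFun φ) :
    ∀ (n : ℕ) (l : List k), l.length = n → l ≠ [] → (∀ a ∈ l, a ≠ 0) → l.sum = 0 →
    ∃ l' : List k, l'.length + 2 = l.length ∧ (∀ a ∈ l', a ≠ 0) ∧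
      (l'.map φ).sum = (l.map φ).sum := by
  intro n
  induction n with
  | zero => intro l hl h; exact absurd (List.length_eq_zero_iff.1 hl) h
  | succ n ih =>
    rintro (_ | ⟨a, _ | ⟨b, t⟩⟩) hl hne h0 hs
    · exact absurd rfl hne
    · simp at hs h0; exact absurd hs h0
    · have ha : a ≠ 0 := h0 a (by simp)
      have hb : b ≠ 0 := h0 b (by simp)
      have ht : ∀ c ∈ t, c ≠ 0 := fun c hc => h0 c (by simp [hc])
      -- Either a and b cancel as a hyperbolic plane, or they are traded for a + b and ab(a + b).
      -- The second entry is set aside and the list headed by a + b still has sum zero.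
      by_cases hab : a + b = 0
      · refine ⟨t, by simp, ht, ?_⟩
        rw [eq_neg_of_add_eq_zero_right hab]
        simp [hφ.neg a ha]
      · obtain ⟨l', h1, h2, h3⟩ := ih ((a + b) :: t) (by simpa using hl) (by simp)
          (by simp only [List.mem_cons, forall_eq_or_imp]; exact ⟨hab, ht⟩)
          (by simpa [add_assoc] using hs)
        refine ⟨a * b * (a + b) :: l', by simpa using h1, ?_, ?_⟩
        · simp only [List.mem_cons, forall_eq_or_imp]
          exact ⟨mul_ne_zero (mul_ne_zero ha hb) hab, h2⟩
        · simp only [List.map_cons, List.sum_cons] at h3 ⊢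
          rw [h3, ← add_assoc, ← add_assoc, hφ.add a b ha hb hab]
          abel

theorem sum_map_eq_sum_get {α β : Type*} [AddCommMonoid β] (l : List α) (ψ : α → β) :
    (l.map ψ).sum = ∑ i : Fin l.length, ψ (l.get i) := by
  rw [← List.sum_ofFn, ← Function.comp_def, ← List.map_ofFn, List.ofFn_get]

theorem sum_map_prodMk {α β γ : Type*} [AddCommMonoid β] [AddCommMonoid γ] (l : List α)
    (φ : α → β) (ψ : α → γ) :
    (l.map fun a => (φ a, ψ a)).sum = ((l.map φ).sum, (l.map ψ).sum) := by
  induction l with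
  | nil => rfl
  | cons a t ih => simp [ih]

/-- The one-dimensional relations imply all relations in the Witt group. -/
theorem IsWittFun.sum_eq_zero {φ : k → A} (hφ : IsWittFun φ) :
    ∀ (n : ℕ) (l : List k), l.length = n → (∀ a ∈ l, a ≠ 0) → (l.map line).sum = 0 →
    (l.map φ).sum = 0 := by
  classical
  intro n
  induction n using Nat.strong_induction_on with
  | _ n ih =>
    intro l hl h0 hs
    rcases eq_or_ne l [] with rfl | hne
    · rfl
    have hpos : 0 < l.length := List.length_pos_iff.2 hne
    have hw : ∀ i, l.get i ≠ 0 := fun i => h0 _ (l.get_mem i)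
    rw [sum_map_eq_sum_get, ← cls_diagForm _ hw, cls_eq_zero_iff] at hs
    have : Nonempty (Fin l.length) := ⟨⟨0, hpos⟩⟩
    obtain ⟨x, hx, hxx⟩ := hs.exists_isotropic
    simp only [diagForm_apply] at hxx
    -- Multiplying the entries in the support of the isotropic vector x by the squares x i ^ 2
    -- leaves their classes unchanged and makes them add up to zero.
    set s : Finset (Fin l.length) := Finset.univ.filter fun i => x i ≠ 0 with hsdef
    set m : List k := s.toList.map fun i => l.get i * x i ^ 2 with hm
    set m' : List k := (sᶜ).toList.map fun i => l.get i with hm'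
    have hm0 : ∀ a ∈ m, a ≠ 0 := by
      intro a ha
      simp only [hm, List.mem_map, Finset.mem_toList] at ha
      obtain ⟨i, hi, rfl⟩ := ha
      exact mul_ne_zero (hw i) (pow_ne_zero _ (Finset.mem_filter.1 hi).2)
    have hm0' : ∀ a ∈ m', a ≠ 0 := by
      intro a ha
      simp only [hm', List.mem_map, Finset.mem_toList] at ha
      obtain ⟨i, hi, rfl⟩ := ha
      exact hw i
    have hmne : m ≠ [] := by
      obtain ⟨i, hi⟩ := Function.ne_iff.1 hx
      have : i ∈ s := Finset.mem_filter.2 ⟨Finset.mem_univ _, hi⟩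
      intro h
      simp only [hm, List.map_eq_nil_iff, Finset.toList_eq_nil] at h
      simp [h] at this
    have hmsum : m.sum = 0 := by
      rw [hm, Finset.sum_map_toList, ← hxx, hsdef, Finset.sum_filter]
      refine Finset.sum_congr rfl fun i _ => ?_
      split_ifs with h
      · ring
      · simp [not_not.1 h]
    have hall : (l.map fun a => (line a, φ a)).sum =
        (m.map fun a => (line a, φ a)).sum + (m'.map fun a => (line a, φ a)).sum := by
      rw [sum_map_eq_sum_get, hm, hm', List.map_map, List.map_map, Finset.sum_map_toList,
        Finset.sum_map_toList, ← Finset.sum_add_sum_compl s]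
      congr 1
      refine Finset.sum_congr rfl fun i hi => ?_
      exact ((isWittFun_line.prod hφ).sq _ _ (hw i) (Finset.mem_filter.1 hi).2).symm
    have hlen : m.length + m'.length = l.length := by
      simp [hm, hm', Finset.card_add_card_compl]
    obtain ⟨l', h1, h2, h3⟩ := (isWittFun_line.prod hφ).exists_shorter _ m rfl hmne hm0 hmsum
    rw [sum_map_prodMk, sum_map_prodMk, Prod.mk.injEq] at h3
    simp only [sum_map_prodMk, Prod.mk_add_mk, Prod.mk.injEq] at hall
    have key := ih (l' ++ m').length (by simp; omega) (l' ++ m') rfl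
      (by
        intro a ha
        rcases List.mem_append.1 ha with h | h
        exacts [h2 a h, hm0' a h])
      (by
        rw [List.map_append, List.sum_append, h3.1, ← hall.1]
        rw [sum_map_eq_sum_get, ← cls_diagForm _ hw, cls_eq_zero_iff]
        exact hs)
    rw [hall.2, ← h3.2, ← List.sum_append, ← List.map_append, key]

end WittGrp

/-! ### Lattices in rational quadratic spaces -/

namespace WittGrp

open Module

section Lattice

variable {V V' : Type*} [AddCommGroup V] [Module ℚ V] [AddCommGroup V'] [Module ℚ V']
  {M M' : Type*} [AddCommGroup M] [AddCommGroup M']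

/-- An integral lattice `M → V` such that `d` annihilates the discriminant group: `d` times any
functional on `M` is represented by a lattice vector. -/
structure IsLattice (B : BilinForm ℚ V) (j : M →ₗ[ℤ] V) (d : ℤ) : Prop where
  integral : ∀ x y, ∃ z : ℤ, B (j x) (j y) = z
  span : ∀ v, ∃ n : ℤ, n ≠ 0 ∧ ∃ x, j x = n • v
  repr : ∀ f : M →ₗ[ℤ] ℤ, ∃ y, ∀ x, B (j y) (j x) = (d * f x : ℤ)

theorem IsLattice.prod {B : BilinForm ℚ V} {C : BilinForm ℚ V'} {j : M →ₗ[ℤ] V}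
    {j' : M' →ₗ[ℤ] V'} {d d' : ℤ} (h : IsLattice B j d) (h' : IsLattice C j' d') :
    IsLattice (prodForm B C) (j.prodMap j') (d * d') where
  integral x y := by
    obtain ⟨a, ha⟩ := h.integral x.1 y.1
    obtain ⟨b, hb⟩ := h'.integral x.2 y.2
    exact ⟨a + b, by simp [ha, hb]⟩
  span v := by
    obtain ⟨a, ha, x, hx⟩ := h.span v.1
    obtain ⟨b, hb, y, hy⟩ := h'.span v.2
    refine ⟨a * b, mul_ne_zero ha hb, (b • x, a • y), ?_⟩
    simp only [LinearMap.prodMap_apply, map_zsmul, hx, hy]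
    refine Prod.ext ?_ ?_
    · simp [smul_smul, mul_comm]
    · simp [smul_smul]
  repr f := by
    obtain ⟨y, hy⟩ := h.repr (f ∘ₗ LinearMap.inl ℤ M M')
    obtain ⟨y', hy'⟩ := h'.repr (f ∘ₗ LinearMap.inr ℤ M M')
    refine ⟨(d' • y, d • y'), fun x => ?_⟩
    have hx : f x = f (x.1, 0) + f (0, x.2) := by rw [← map_add]; simp
    simp only [LinearMap.prodMap_apply, prodForm_apply, map_zsmul, LinearMap.smul_apply, hy, hy', hx,
      LinearMap.comp_apply, LinearMap.inl_apply, LinearMap.inr_apply]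
    push_cast
    simp only [zsmul_eq_mul]
    ring

theorem IsLattice.mul {B : BilinForm ℚ V} {j : M →ₗ[ℤ] V} {d : ℤ} (h : IsLattice B j d) (c : ℤ) :
    IsLattice B j (c * d) where
  integral := h.integral
  span := h.span
  repr f := by
    obtain ⟨y, hy⟩ := h.repr f
    refine ⟨c • y, fun x => ?_⟩
    simp only [map_zsmul, LinearMap.smul_apply, hy, zsmul_eq_mul]
    push_cast
    ring

/-- The lattice points lying over T form a submodule S with torsion-free, hence projective,
quotient. So M projects onto S, and the functional is precomposed with that projection. -/
theorem exists_extension [Module.Finite ℤ M] (j : M →ₗ[ℤ] V) (T : Submodule ℚ V)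
    (f : V →ₗ[ℚ] ℚ) (hf : ∀ x, j x ∈ T → ∃ z : ℤ, f (j x) = z) :
    ∃ g : M →ₗ[ℤ] ℤ, ∀ x, j x ∈ T → f (j x) = g x := by
  let S : Submodule ℤ M := (T.restrictScalars ℤ).comap j
  have hS : ∀ x, x ∈ S ↔ j x ∈ T := fun x => Iff.rfl
  have htf : IsTorsionFree ℤ (M ⧸ S) := by
    rw [Module.isTorsionFree_iff_smul_eq_zero]
    intro n q hq
    obtain ⟨x, rfl⟩ := Submodule.Quotient.mk_surjective S q
    rw [or_iff_not_imp_left]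
    intro hn
    rw [← Submodule.Quotient.mk_smul, Submodule.Quotient.mk_eq_zero, hS, map_zsmul] at hq
    rw [Submodule.Quotient.mk_eq_zero, hS]
    have := T.smul_mem ((n : ℚ)⁻¹) hq
    rwa [← Int.cast_smul_eq_zsmul ℚ, smul_smul, inv_mul_cancel₀ (by exact_mod_cast hn),
      one_smul] at this
  obtain ⟨s, hs⟩ := Module.projective_lifting_property S.mkQ LinearMap.id S.mkQ_surjective
  have hs' : ∀ x, x - s (S.mkQ x) ∈ S := by
    intro x
    refine (Submodule.Quotient.eq S).1 ?_
    exact (LinearMap.congr_fun hs (S.mkQ x)).symm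
  choose z hz using fun x => hf _ (hs' x)
  refine ⟨{ toFun := z, map_add' := ?_, map_smul' := ?_ }, ?_⟩
  · intro x y
    have : (z (x + y) : ℚ) = (z x + z y : ℤ) := by
      push_cast
      rw [← hz, ← hz, ← hz]
      simp only [map_add, map_sub]
      ring
    exact_mod_cast this
  · intro n x
    have : (z (n • x) : ℚ) = (n * z x : ℤ) := by
      push_cast
      rw [← hz, ← hz]
      simp only [map_zsmul, map_sub, zsmul_eq_mul]
      ring
    exact_mod_cast this
  · intro x hx
    have h0 : S.mkQ x = 0 := by rw [← LinearMap.mem_ker, S.ker_mkQ]; exact hx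
    have := hz x
    rw [h0, map_zero, sub_zero] at this
    exact this

/-- Functionals that are integral on the lattice points of a subspace are represented there. -/
theorem IsLattice.exists_repr [Module.Finite ℤ M] {B : BilinForm ℚ V} {j : M →ₗ[ℤ] V} {d : ℤ}
    (h : IsLattice B j d) (T : Submodule ℚ V) (f : V →ₗ[ℚ] ℚ)
    (hf : ∀ x, j x ∈ T → ∃ z : ℤ, f (j x) = z) : ∃ y, ∀ t ∈ T, B (j y) t = d * f t := by
  obtain ⟨g, hg⟩ := exists_extension j T f hf
  obtain ⟨y, hy⟩ := h.repr g
  refine ⟨y, fun t ht => ?_⟩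
  obtain ⟨n, hn, x, hx⟩ := h.span t
  have hxT : j x ∈ T := by rw [hx]; exact T.smul_of_tower_mem n ht
  have h1 := hy x
  push_cast at h1
  rw [← hg x hxT, hx] at h1
  simp only [map_zsmul, zsmul_eq_mul] at h1
  have hn' : (n : ℚ) ≠ 0 := by exact_mod_cast hn
  exact mul_left_cancel₀ hn' (by linear_combination h1)

end Lattice

/-- The standard lattice in `ℚⁿ`. -/
def stdLattice (ι : Type*) : (ι → ℤ) →ₗ[ℤ] (ι → ℚ) :=
  LinearMap.compLeft (Int.castAddHom ℚ).toIntLinearMap ι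

@[simp] theorem stdLattice_apply {ι : Type*} (x : ι → ℤ) (i : ι) :
    stdLattice ι x i = (x i : ℚ) := rfl

theorem isLattice_std {ι : Type*} [Fintype ι] (w : ι → ℤ) :
    IsLattice (diagForm fun i => (w i : ℚ)) (stdLattice ι) (∏ i, w i) where
  integral x y := ⟨∑ i, w i * (x i * y i), by simp⟩
  span v := by
    refine ⟨∏ i, ((v i).den : ℤ), ?_, ?_⟩
    · exact Finset.prod_ne_zero_iff.2 fun i _ => by simp
    · have : ∀ i, ∃ z : ℤ, (z : ℚ) = ((∏ i, ((v i).den : ℤ) : ℤ) : ℚ) * v i := by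
        intro i
        obtain ⟨c, hc⟩ := Finset.dvd_prod_of_mem (fun i => ((v i).den : ℤ)) (Finset.mem_univ i)
        refine ⟨c * (v i).num, ?_⟩
        rw [hc]
        push_cast
        have := Rat.mul_den_eq_num (v i)
        linear_combination -(c : ℚ) * this
      choose z hz using this
      refine ⟨z, funext fun i => ?_⟩
      simp only [stdLattice_apply, Pi.smul_apply, zsmul_eq_mul]
      exact hz i
  repr f := by
    classical
    choose c hc using fun i => Finset.dvd_prod_of_mem w (Finset.mem_univ i)
    refine ⟨fun i => c i * f (Pi.single i 1), fun x => ?_⟩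
    have hx : f x = ∑ i, x i * f (Pi.single i 1) := by
      conv_lhs => rw [← Finset.univ_sum_single x, map_sum]
      refine Finset.sum_congr rfl fun i _ => ?_
      rw [← smul_eq_mul, ← map_smul]
      congr 1
      ext k
      simp [Pi.single_apply]
    rw [hx, Finset.mul_sum]
    simp only [diagForm_apply, stdLattice_apply]
    push_cast
    refine Finset.sum_congr rfl fun i _ => ?_
    have := congrArg (Int.cast : ℤ → ℚ) (hc i)
    push_cast at this
    rw [this]
    ring

/-! ### Second residues at a prime. -/

section Residue

variable {V : Type} [AddCommGroup V] [Module ℚ V] [FiniteDimensional ℚ V]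
  {M : Type*} [AddCommGroup M] [Module.Finite ℤ M] {p : ℕ} [Fact p.Prime]

theorem natCast_prime_ne_zero : (p : ℚ) ≠ 0 := by
  exact_mod_cast (Fact.out : p.Prime).ne_zero

/-- The Lagrangian over `ZMod p` consists of the reductions of the integral second coordinates of
lattice vectors in T. It is isotropic because B is integral on the lattice, so the other summand ∑
rᵢzᵢz'ᵢ/p must be integral too. It contains its orthogonal complement by a duality argument inside
T. -/
theorem residue_lagrangian {B : BilinForm ℚ V} (hB : IsInner B) {j : M →ₗ[ℤ] V} {d : ℤ}
    (h : IsLattice B j d) (hd : (d : ZMod p) ≠ 0) {m : ℕ} (r : Fin m → ℤ)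
    (hr : ∀ i, (r i : ZMod p) ≠ 0)
    (hM : Metabolic (prodForm B (-(diagForm fun i => (r i : ℚ) / p)))) :
    Metabolic (diagForm fun i => (r i : ZMod p)) := by
  obtain ⟨T, hT⟩ := hM
  have hp0 : (p : ℚ) ≠ 0 := natCast_prime_ne_zero
  have hr0 : ∀ i, (r i : ℚ) ≠ 0 := fun i h0 => hr i (by
    rw [Int.cast_eq_zero.1 h0, Int.cast_zero])
  let H : Submodule (ZMod p) (Fin m → ZMod p) :=
    { carrier := {c | ∃ (x : M) (z : Fin m → ℤ), (j x, stdLattice _ z) ∈ T ∧ ∀ i, c i = z i}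
      zero_mem' := ⟨0, 0, by rw [map_zero, map_zero]; exact T.zero_mem, by simp⟩
      add_mem' := by
        rintro c c' ⟨x, z, hT, hc⟩ ⟨x', z', hT', hc'⟩
        refine ⟨x + x', z + z', ?_, fun i => by simp [hc, hc']⟩
        simpa using T.add_mem hT hT'
      smul_mem' := by
        rintro a c ⟨x, z, hT, hc⟩
        obtain ⟨n, rfl⟩ := ZMod.intCast_surjective a
        refine ⟨n • x, n • z, ?_, fun i => by simp [hc]⟩
        rw [map_zsmul, map_zsmul]
        exact T.smul_of_tower_mem n hT }
  have hiso : ∀ c ∈ H, ∀ c' ∈ H, diagForm (fun i => (r i : ZMod p)) c c' = 0 := by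
    rintro c ⟨x, z, hx, hc⟩ c' ⟨x', z', hx', hc'⟩
    have h0 := hT.1 _ hx _ hx'
    obtain ⟨b, hb⟩ := h.integral x x'
    simp only [prodForm_apply, hb, LinearMap.neg_apply, diagForm_apply, stdLattice_apply] at h0
    have h1 : (∑ i, r i * (z i * z' i) : ℤ) = p * b := by
      have h2 : (∑ i, (r i : ℚ) * (z i * z' i)) = p * b := by
        have : ∑ i, (r i : ℚ) / p * (z i * z' i) = (∑ i, (r i : ℚ) * (z i * z' i)) / p := by
          rw [Finset.sum_div]
          exact Finset.sum_congr rfl fun i _ => by ring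
        rw [this, ← sub_eq_add_neg, sub_eq_zero] at h0
        rw [h0]
        field_simp
      exact_mod_cast h2
    have h3 := congrArg (Int.cast : ℤ → ZMod p) h1
    push_cast at h3
    simp only [diagForm_apply, hc, hc', h3, CharP.cast_eq_zero, zero_mul]
  have hI : IsInner (diagForm fun i => (r i : ZMod p)) := isInner_diagForm hr
  have hIQ : IsInner (diagForm fun i => (r i : ℚ) / p) :=
    isInner_diagForm fun i => div_ne_zero (hr0 i) hp0
  have hmax : (diagForm fun i => (r i : ZMod p)).orthogonal H ≤ H := by
    intro c hc
    have hc : ∀ c' ∈ H, diagForm (fun i => (r i : ZMod p)) c' c = 0 := fun c' hc' => hc c' hc'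
    choose e he using fun i => ZMod.intCast_surjective (c i)
    let D : ℤ := d * ∏ i, r i
    have hD : (D : ZMod p) ≠ 0 := by
      simp only [D]
      push_cast
      exact mul_ne_zero hd (Finset.prod_ne_zero_iff.2 fun i _ => hr i)
    have hlat : IsLattice (prodForm B (diagForm fun i => ((-r i : ℤ) : ℚ)))
        (j.prodMap (stdLattice (Fin m))) (D * ∏ i : Fin m, (-1)) := by
      have := h.prod (isLattice_std fun i => -r i)
      rwa [Finset.prod_congr rfl (fun i _ => neg_eq_neg_one_mul (r i)), Finset.prod_mul_distrib,
        mul_comm (∏ i : Fin m, (-1 : ℤ)), ← mul_assoc] at this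
    -- For c orthogonal to H with integral lift e, this functional is integral on the lattice points
    -- of T. Up to the factor D', a unit mod p, it is represented there by a lattice vector (y, z)
    -- of B ⊥ ⟨-rᵢ⟩.
    let f : V × (Fin m → ℚ) →ₗ[ℚ] ℚ :=
      (diagForm (fun i => (r i : ℚ) / p) (stdLattice _ e)) ∘ₗ LinearMap.snd ℚ V (Fin m → ℚ)
    obtain ⟨⟨y, z⟩, hyz⟩ := hlat.exists_repr T f (by
      rintro ⟨x, z'⟩ hx
      have := hc (fun i => z' i) ⟨x, z', hx, fun i => rfl⟩
      simp only [diagForm_apply, ← he] at this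
      have h2 : ((∑ i, r i * (z' i * e i) : ℤ) : ZMod p) = 0 := by push_cast; exact this
      obtain ⟨q, hq⟩ := (ZMod.intCast_zmod_eq_zero_iff_dvd _ _).1 h2
      refine ⟨q, ?_⟩
      simp only [f, LinearMap.comp_apply, LinearMap.prodMap_apply, LinearMap.snd_apply,
        diagForm_apply, stdLattice_apply]
      have h3 : ∑ i, (r i : ℚ) * (z' i * e i) = p * q := by exact_mod_cast hq
      have : ∑ i, (r i : ℚ) / p * (e i * z' i) = (∑ i, (r i : ℚ) * (z' i * e i)) / p := by
        rw [Finset.sum_div]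
        exact Finset.sum_congr rfl fun i _ => by ring
      rw [this, h3]
      field_simp)
    set D' : ℤ := D * ∏ i : Fin m, (-1) with hD'
    have hD'0 : (D' : ZMod p) ≠ 0 := by
      rw [hD']
      push_cast
      exact mul_ne_zero hD (Finset.prod_ne_zero_iff.2 fun i _ => by simp)
    -- Passing from ⟨-rᵢ⟩ to ⟨-rᵢ/p⟩ turns z into pz, so the corrected vector is orthogonal to T and
    -- lies in T. Its reduction mod p is D'c.
    have hmem : (j y, stdLattice _ (fun i => p * z i + D' * e i)) ∈ T := by
      refine hT.mem (hB.prod hIQ.neg) fun t ht => ?_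
      have := hyz t ht
      simp only [f, LinearMap.comp_apply, LinearMap.prodMap_apply, LinearMap.snd_apply,
        diagForm_apply, stdLattice_apply, prodForm_apply, LinearMap.neg_apply] at this ⊢
      have e1 : ∑ i, (r i : ℚ) / p * (((p * z i + D' * e i : ℤ) : ℚ) * t.2 i) =
          (∑ i, (r i : ℚ) * (z i * t.2 i)) + D' * ∑ i, (r i : ℚ) / p * (e i * t.2 i) := by
        rw [Finset.mul_sum, ← Finset.sum_add_distrib]
        refine Finset.sum_congr rfl fun i _ => ?_
        push_cast
        field_simp
      have e2 : ∑ i, ((-r i : ℤ) : ℚ) * (z i * t.2 i) = -∑ i, (r i : ℚ) * (z i * t.2 i) := by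
        rw [← Finset.sum_neg_distrib]
        refine Finset.sum_congr rfl fun i _ => ?_
        push_cast
        ring
      rw [e1]
      rw [e2] at this
      linear_combination this
    have : (fun i => (D' : ZMod p) * c i) ∈ H :=
      ⟨y, _, hmem, fun i => by push_cast; simp [he]⟩
    have := H.smul_mem ((D' : ZMod p)⁻¹) this
    convert this using 1
    funext i
    simp [hD'0]
  refine ⟨H, hiso, ?_⟩
  have h1 := hI.finrank_orthogonal_add H
  have h2 := Submodule.finrank_mono hmax
  omega

/-- The second residue of the Witt class of a lattice without `p`-torsion in its discriminant
group vanishes. -/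
theorem residue_eq_zero {B : BilinForm ℚ V} (hB : IsInner B) {j : M →ₗ[ℤ] V} {d : ℤ}
    (h : IsLattice B j d) (hd : (d : ZMod p) ≠ 0) (l : List ℤ) (hl : ∀ a ∈ l, (a : ZMod p) ≠ 0)
    (hM : cls B hB = (l.map fun a : ℤ => line (p * a : ℚ)).sum) :
    (l.map fun a : ℤ => line (a : ZMod p)).sum = 0 := by
  have hp0 : (p : ℚ) ≠ 0 := natCast_prime_ne_zero
  have hr : ∀ i, ((l.get i : ℤ) : ZMod p) ≠ 0 := fun i => hl _ (l.get_mem i)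
  have hr0 : ∀ i, ((l.get i : ℤ) : ℚ) / p ≠ 0 := fun i => div_ne_zero (fun h0 => hr i (by
    rw [Int.cast_eq_zero.1 h0, Int.cast_zero])) hp0
  rw [sum_map_eq_sum_get] at hM ⊢
  rw [← cls_diagForm _ hr, cls_eq_zero_iff]
  refine residue_lagrangian hB h hd _ hr ?_
  rw [← cls_eq_iff (hB := hB) (hC := isInner_diagForm hr0), cls_diagForm _ hr0, hM]
  refine Finset.sum_congr rfl fun i _ => ?_
  rw [← line_mul_sq (hr0 i) hp0]
  congr 1
  field_simp

end Residue

end WittGrp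

/-! ### The filtration of the rational Witt group by primes -/

namespace WittGrp

open Module

/-- A nonzero integer whose prime divisors are at most `n`. -/
def IsSmooth (n : ℕ) (m : ℤ) : Prop := m ≠ 0 ∧ ∀ q : ℕ, q.Prime → (q : ℤ) ∣ m → q ≤ n

namespace IsSmooth

variable {n : ℕ} {a b : ℤ}

theorem mul (ha : IsSmooth n a) (hb : IsSmooth n b) : IsSmooth n (a * b) :=
  ⟨mul_ne_zero ha.1 hb.1, fun q hq h =>
    ((Nat.prime_iff_prime_int.1 hq).dvd_or_dvd h).elim (ha.2 q hq) (hb.2 q hq)⟩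

theorem neg (ha : IsSmooth n a) : IsSmooth n (-a) :=
  ⟨neg_ne_zero.2 ha.1, fun q hq h => ha.2 q hq (by rwa [dvd_neg] at h)⟩

theorem of_abs_le (ha : a ≠ 0) (h : |a| ≤ n) : IsSmooth n a :=
  ⟨ha, fun q _ hd => by
    have := Int.le_of_dvd (abs_pos.2 ha) ((dvd_abs _ _).2 hd)
    exact_mod_cast this.trans h⟩

theorem mono {n' : ℕ} (h : n ≤ n') (ha : IsSmooth n a) : IsSmooth n' a :=
  ⟨ha.1, fun q hq hd => (ha.2 q hq hd).trans h⟩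

theorem cast_ne_zero (ha : IsSmooth n a) {p : ℕ} [Fact p.Prime] (hp : n < p) :
    (a : ZMod p) ≠ 0 := by
  intro h
  have := ha.2 p Fact.out ((ZMod.intCast_zmod_eq_zero_iff_dvd _ _).1 h)
  omega

end IsSmooth

/-- The subgroup of the rational Witt group generated by the classes of `n`-smooth integers. -/
def filt (n : ℕ) : AddSubgroup (WittGroup ℚ) :=
  AddSubgroup.closure {w | ∃ m : ℤ, IsSmooth n m ∧ w = line (m : ℚ)}

theorem line_mem_filt {n : ℕ} {m : ℤ} (h : IsSmooth n m) : line (m : ℚ) ∈ filt n :=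
  AddSubgroup.subset_closure ⟨m, h, rfl⟩

theorem filt_mono {n n' : ℕ} (h : n ≤ n') : filt n ≤ filt n' :=
  AddSubgroup.closure_mono fun _ ⟨m, hm, hw⟩ => ⟨m, hm.mono h, hw⟩

/-! ### The graded piece of the filtration at a prime. -/

section Prime

variable (p : ℕ) [hp : Fact p.Prime]

/-- The class of `⟨p m⟩` modulo the previous step of the filtration. -/
noncomputable def scaledLine (m : ℤ) : WittGroup ℚ ⧸ filt (p - 1) :=
  QuotientAddGroup.mk' (filt (p - 1)) (line (p * m : ℚ))

/-- The class of `⟨p r⟩`, where `r` is the least nonnegative representative of `u`. -/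
noncomputable def residueLine (u : ZMod p) : WittGroup ℚ ⧸ filt (p - 1) := scaledLine p u.val

variable {p}

theorem isSmooth_of_lt {a : ℤ} (ha : a ≠ 0) (h : |a| < p) : IsSmooth (p - 1) a :=
  .of_abs_le ha (by have := hp.out.one_lt; omega)

/-- Write ab = r + pl. The relation for ⟨pcr⟩ + ⟨p²cl⟩ has sum pcab, and its two remaining classes
are, up to squares, ⟨cl⟩ and ⟨c·r·l·ab⟩. Since |l| < p, both lie in the previous step of the
filtration. -/
theorem scaledLine_mul_emod {a b c : ℤ} (ha : a ≠ 0) (ha' : |a| < p) (hb : 0 < b) (hb' : b < p)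
    (hc : IsSmooth (p - 1) c) : scaledLine p (c * (a * b)) = scaledLine p (c * (a * b % p)) := by
  have hp2 := hp.out.two_le
  have hsa := isSmooth_of_lt ha ha'
  have hsb : IsSmooth (p - 1) b := isSmooth_of_lt hb.ne' (by rwa [abs_of_pos hb])
  have hr0 : a * b % p ≠ 0 := by
    intro h
    have h2 := (hsa.mul hsb).2 p hp.out (Int.dvd_of_emod_eq_zero h)
    omega
  set r := a * b % p with hr
  have hr1 : 0 ≤ r := Int.emod_nonneg _ (by omega)
  have hr2 : r < p := Int.emod_lt_of_pos _ (by omega)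
  have hdiv : a * b = r + p * (a * b / p) := (Int.emod_add_mul_ediv _ _).symm
  set l := a * b / p with hl
  rcases eq_or_ne l 0 with h0 | h0
  · rw [hdiv, h0, mul_zero, add_zero]
  have hl' : |l| < p := by
    rw [abs_lt] at ha' ⊢
    constructor <;> nlinarith
  have hsr : IsSmooth (p - 1) r := isSmooth_of_lt hr0 (by rwa [abs_of_nonneg hr1])
  have hsl := isSmooth_of_lt h0 hl'
  have hp0 : (p : ℚ) ≠ 0 := natCast_prime_ne_zero
  have q : ∀ z : ℤ, z ≠ 0 → (z : ℚ) ≠ 0 := fun z hz => by exact_mod_cast hz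
  have hdivQ : (a : ℚ) * b = r + p * l := by exact_mod_cast hdiv
  have hA : (p * (c * r : ℤ) : ℚ) ≠ 0 := mul_ne_zero hp0 (q _ (hc.mul hsr).1)
  have hB : ((c * l : ℤ) * (p : ℚ) ^ 2) ≠ 0 := mul_ne_zero (q _ (hc.mul hsl).1) (pow_ne_zero _ hp0)
  have hAB : (p * (c * r : ℤ) : ℚ) + ((c * l : ℤ) * (p : ℚ) ^ 2) = p * (c * (a * b) : ℤ) := by
    push_cast
    linear_combination (-(p : ℚ) * c) * hdivQ
  have key := line_add hA hB (by
    rw [hAB]; exact mul_ne_zero hp0 (q _ (hc.mul (hsa.mul hsb)).1))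
  rw [hAB, line_mul_sq (q _ (hc.mul hsl).1) hp0] at key
  have e : (p * (c * r : ℤ) : ℚ) * ((c * l : ℤ) * (p : ℚ) ^ 2) * (p * (c * (a * b) : ℤ)) =
      ((c * (r * l * (a * b)) : ℤ) : ℚ) * (c * p ^ 2 : ℚ) ^ 2 := by
    push_cast; ring
  have hs5 := hc.mul ((hsr.mul hsl).mul (hsa.mul hsb))
  rw [e, line_mul_sq (q _ hs5.1) (mul_ne_zero (q _ hc.1) (pow_ne_zero _ hp0))] at key
  unfold scaledLine
  simp only [QuotientAddGroup.mk'_apply]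
  rw [eq_comm, QuotientAddGroup.eq]
  have h1 := line_mem_filt (hc.mul hsl)
  have h2 := line_mem_filt hs5
  have : -line (p * (c * r : ℤ) : ℚ) + line (p * (c * (a * b) : ℤ) : ℚ) =
      line ((c * l : ℤ) : ℚ) - line ((c * (r * l * (a * b)) : ℤ) : ℚ) := by
    rw [neg_add_eq_iff_eq_add, ← add_sub_assoc, key]
    abel
  rw [this]
  exact sub_mem h1 h2

/-- Reducing mod p one factor at a time: the factor a is moved into the multiplier while m is
reduced. This is why the induction hypothesis ranges over all smooth c. -/
theorem scaledLine_emod_of_mul {a m : ℤ} (ha : a ≠ 0) (ha' : |a| < p) (hm : IsSmooth (p - 1) m)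
    (ih : ∀ c, IsSmooth (p - 1) c → scaledLine p (c * m) = scaledLine p (c * (m % p)))
    {c : ℤ} (hc : IsSmooth (p - 1) c) :
    scaledLine p (c * (a * m)) = scaledLine p (c * (a * m % p)) := by
  have hp2 := hp.out.two_le
  have h0 : m % p ≠ 0 := fun h => by
    have := hm.2 p hp.out (Int.dvd_of_emod_eq_zero h); omega
  have h1 : 0 ≤ m % p := Int.emod_nonneg _ (by omega)
  have h2 : m % p < p := Int.emod_lt_of_pos _ (by omega)
  rw [← mul_assoc, ih _ (hc.mul (isSmooth_of_lt ha ha')), mul_assoc,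
    scaledLine_mul_emod ha ha' (by omega) h2 hc, Int.mul_emod a (m % p), Int.emod_emod_of_dvd _ dvd_rfl,
    ← Int.mul_emod]

theorem scaledLine_natCast (n : ℕ) : IsSmooth (p - 1) n → ∀ c, IsSmooth (p - 1) c →
    scaledLine p (c * n) = scaledLine p (c * ((n : ℤ) % p)) := by
  have hp2 := hp.out.two_le
  induction n using induction_on_primes with
  | zero => intro h; exact absurd rfl h.1
  | one =>
    intro _ c _
    rw [Nat.cast_one, Int.emod_eq_of_lt (by omega) (by omega)]
  | prime_mul q a hq ih =>
    intro h c hc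
    push_cast at h ⊢
    have ha : IsSmooth (p - 1) a := ⟨right_ne_zero_of_mul h.1, fun q' hq' hd =>
      h.2 q' hq' (hd.mul_left _)⟩
    have hqp := h.2 q hq (dvd_mul_right _ _)
    refine scaledLine_emod_of_mul (by exact_mod_cast hq.ne_zero) ?_ ha (ih ha) hc
    rw [Nat.abs_cast]
    omega

theorem scaledLine_eq_residueLine {m : ℤ} (hm : IsSmooth (p - 1) m) :
    scaledLine p m = residueLine p m := by
  have hp2 := hp.out.two_le
  have hone : IsSmooth (p - 1) 1 := isSmooth_of_lt one_ne_zero (by simp; omega)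
  have key : scaledLine p (1 * m) = scaledLine p (1 * (m % p)) := by
    obtain ⟨n, rfl | rfl⟩ := m.eq_nat_or_neg
    · exact scaledLine_natCast n hm 1 hone
    · have hn : IsSmooth (p - 1) n := by simpa using hm.neg
      rw [neg_eq_neg_one_mul]
      exact scaledLine_emod_of_mul (by simp) (by simp; omega) hn (scaledLine_natCast n hn) hone
  rw [one_mul, one_mul] at key
  rw [key, residueLine, ZMod.val_intCast]

theorem intCast_val (u : ZMod p) : ((u.val : ℤ) : ZMod p) = u := by simp

theorem isSmooth_val {u : ZMod p} (hu : u ≠ 0) : IsSmooth (p - 1) (u.val : ℤ) :=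
  isSmooth_of_lt (by exact_mod_cast (ZMod.val_ne_zero u).2 hu) (by
    rw [Nat.abs_cast]; exact_mod_cast u.val_lt)

/-- The relations among one-dimensional forms over `ZMod p` lift to the rationals modulo smaller
primes. With `IsWittFun.sum_eq_zero` this extends u ↦ ⟨pu⟩ to all Witt relations over `ZMod p`. -/
theorem isWittFun_residueLine : IsWittFun (residueLine p) := by
  have hp0 : (p : ℚ) ≠ 0 := natCast_prime_ne_zero
  have q : ∀ z : ℤ, z ≠ 0 → (z : ℚ) ≠ 0 := fun z hz => by exact_mod_cast hz
  have hcast : ∀ {m : ℤ} {u : ZMod p}, IsSmooth (p - 1) m → (m : ZMod p) = u →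
      residueLine p u = scaledLine p m := fun hm h => by rw [scaledLine_eq_residueLine hm, h]
  refine ⟨fun a c ha hc => ?_, fun a ha => ?_, fun a b ha hb hab => ?_⟩
  · have hsa := isSmooth_val ha
    have hsc := isSmooth_val hc
    rw [hcast (hsa.mul (hsc.mul hsc)) (by push_cast; simp [pow_two]), residueLine, scaledLine, scaledLine]
    congr 1
    rw [← line_mul_sq (mul_ne_zero hp0 (q _ hsa.1)) (q _ hsc.1)]
    congr 1
    push_cast
    ring
  · have hsa := isSmooth_val ha
    rw [hcast hsa.neg (by simp), residueLine, scaledLine, scaledLine, ← map_neg,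
      ← line_neg (mul_ne_zero hp0 (q _ hsa.1))]
    congr 2
    push_cast
    ring
  · have hsa := isSmooth_val ha
    have hav : (a.val : ℤ) < p := by exact_mod_cast a.val_lt
    have hbv : (b.val : ℤ) < p := by exact_mod_cast b.val_lt
    have ha0 : (0 : ℤ) < a.val := by have := hsa.1; omega
    have hb0 : (0 : ℤ) < b.val := by have := (isSmooth_val hb).1; omega
    -- The lift of b is its least residue or that residue minus p, whichever keeps the sum with the
    -- lift of a below p in absolute value and hence smooth.
    obtain ⟨m, hm, hmb, hlt⟩ : ∃ m : ℤ, IsSmooth (p - 1) m ∧ (m : ZMod p) = b ∧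
        |(a.val : ℤ) + m| < p := by
      by_cases h : (a.val : ℤ) + b.val < p
      · exact ⟨b.val, isSmooth_val hb, intCast_val b, by rw [abs_lt]; constructor <;> omega⟩
      · refine ⟨b.val - p, isSmooth_of_lt (by omega) (by rw [abs_lt]; constructor <;> omega),
          by simp, by rw [abs_lt]; constructor <;> omega⟩
    have hsum : (((a.val : ℤ) + m : ℤ) : ZMod p) = a + b := by
      push_cast; rw [hmb]; simp
    have hs : IsSmooth (p - 1) ((a.val : ℤ) + m) := isSmooth_of_lt (fun h => hab (by
      rw [← hsum, h, Int.cast_zero])) hlt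
    rw [hcast hs hsum, hcast hm hmb, hcast hsa (intCast_val a),
      hcast ((hsa.mul hm).mul hs) (by push_cast [hmb]; simp)]
    simp only [scaledLine, ← map_add]
    congr 1
    rw [line_add (mul_ne_zero hp0 (q _ hsa.1)) (mul_ne_zero hp0 (q _ hm.1)) (by
      rw [← mul_add]; exact mul_ne_zero hp0 (by exact_mod_cast hs.1))]
    congr 1
    · congr 1; push_cast; ring
    · rw [← line_mul_sq (mul_ne_zero hp0 (q _ ((hsa.mul hm).mul hs).1)) hp0]
      congr 1; push_cast; ring

/-- Squares do not matter, so only the parity of the exponent of p survives. -/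
theorem exists_lists_of_mem_filt {w : WittGroup ℚ} (hw : w ∈ filt p) :
    ∃ l l' : List ℤ, (∀ a ∈ l, IsSmooth (p - 1) a) ∧ (∀ a ∈ l', IsSmooth (p - 1) a) ∧
      w = (l.map fun a : ℤ => line (a : ℚ)).sum + (l'.map fun a : ℤ => line (p * a : ℚ)).sum := by
  have hp0 : (p : ℚ) ≠ 0 := natCast_prime_ne_zero
  have q : ∀ z : ℤ, z ≠ 0 → (z : ℚ) ≠ 0 := fun z hz => by exact_mod_cast hz
  induction hw using AddSubgroup.closure_induction with
  | mem w hw =>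
    obtain ⟨m, hm, rfl⟩ := hw
    obtain ⟨m', hm', hd⟩ := (Int.finiteMultiplicity_iff.2
      ⟨by simpa using hp.out.ne_one, hm.1⟩ :
        FiniteMultiplicity (p : ℤ) m).exists_eq_pow_mul_and_not_dvd
    have hs : IsSmooth (p - 1) m' := ⟨right_ne_zero_of_mul (hm' ▸ hm.1), fun r hr hrd => by
      have h1 := hm.2 r hr (hm' ▸ hrd.mul_left _)
      have h2 : r ≠ p := by rintro rfl; exact hd hrd
      omega⟩
    generalize multiplicity (p : ℤ) m = e at hm'
    rcases Nat.even_or_odd' e with ⟨f, rfl | rfl⟩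
    · refine ⟨[m'], [], by simpa using hs, by simp, ?_⟩
      simp only [List.map_cons, List.map_nil, List.sum_cons, List.sum_nil, add_zero]
      rw [← line_mul_sq (q _ hs.1) (pow_ne_zero f hp0), hm']
      congr 1
      push_cast
      ring
    · refine ⟨[], [m'], by simp, by simpa using hs, ?_⟩
      simp only [List.map_cons, List.map_nil, List.sum_cons, List.sum_nil, add_zero, zero_add]
      rw [← line_mul_sq (mul_ne_zero hp0 (q _ hs.1)) (pow_ne_zero f hp0), hm']
      congr 1
      push_cast
      ring
  | zero => exact ⟨[], [], by simp, by simp, by simp⟩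
  | add v w _ _ hv hw =>
    obtain ⟨l, l', h1, h2, rfl⟩ := hv
    obtain ⟨k, k', h3, h4, rfl⟩ := hw
    refine ⟨l ++ k, l' ++ k', ?_, ?_, ?_⟩
    · simp only [List.mem_append]; rintro a (h | h); exacts [h1 a h, h3 a h]
    · simp only [List.mem_append]; rintro a (h | h); exacts [h2 a h, h4 a h]
    · simp only [List.map_append, List.sum_append]; abel
  | neg w _ hw =>
    obtain ⟨l, l', h1, h2, rfl⟩ := hw
    have hneg : ∀ (l : List ℤ) (c : ℚ), c ≠ 0 → (∀ a ∈ l, IsSmooth (p - 1) a) →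
        ((l.map Neg.neg).map fun a : ℤ => line (c * a : ℚ)).sum =
          -(l.map fun a : ℤ => line (c * a : ℚ)).sum := by
      intro l c hc hl
      induction l with
      | nil => simp
      | cons a t ih =>
        simp only [List.mem_cons, forall_eq_or_imp] at hl
        simp only [List.map_cons, List.sum_cons, ih hl.2, neg_add]
        rw [← line_neg (mul_ne_zero hc (q _ hl.1.1))]
        push_cast
        rw [mul_neg]
    refine ⟨l.map Neg.neg, l'.map Neg.neg, ?_, ?_, ?_⟩
    · simp only [List.mem_map]; rintro _ ⟨a, h, rfl⟩; exact (h1 a h).neg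
    · simp only [List.mem_map]; rintro _ ⟨a, h, rfl⟩; exact (h2 a h).neg
    · have := hneg l 1 one_ne_zero h1
      simp only [one_mul] at this
      rw [this, hneg l' p hp0 h2, neg_add]

end Prime

/-! ### Descent through the filtration. -/

section Descent

variable {V : Type} [AddCommGroup V] [Module ℚ V] [FiniteDimensional ℚ V]
  {M : Type*} [AddCommGroup M] [Module.Finite ℤ M]

/-- Subtracting the terms prime to p, as a diagonal lattice of discriminant prime to p, leaves a sum
of classes ⟨pa⟩ that is still the class of a lattice without p-torsion. Its second residue vanishes,
and `residueLine` carries this vanishing back to the graded piece. -/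
theorem cls_mem_filt_pred {B : BilinForm ℚ V} (hB : IsInner B) {j : M →ₗ[ℤ] V} {d : ℤ}
    (h : IsLattice B j d) {p : ℕ} [hp : Fact p.Prime] (hd : IsSmooth (p - 1) d)
    (hm : cls B hB ∈ filt p) : cls B hB ∈ filt (p - 1) := by
  have hp2 := hp.out.two_le
  obtain ⟨l, l', hl, hl', hw⟩ := exists_lists_of_mem_filt hm
  have hlg : ∀ i, IsSmooth (p - 1) (l.get i) := fun i => hl _ (l.get_mem i)
  have h0 : ∀ i, ((-l.get i : ℤ) : ℚ) ≠ 0 := fun i => by exact_mod_cast (hlg i).neg.1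
  have hlat := h.prod (isLattice_std fun i => -l.get i)
  have hcls : cls _ (hB.prod (isInner_diagForm h0)) =
      (l'.map fun a : ℤ => line (p * a : ℚ)).sum := by
    rw [cls_prod hB (isInner_diagForm h0), cls_diagForm _ h0, hw, sum_map_eq_sum_get l]
    have : ∀ i, line ((-l.get i : ℤ) : ℚ) = -line ((l.get i : ℤ) : ℚ) := fun i => by
      rw [Int.cast_neg, line_neg (by exact_mod_cast (hlg i).1)]
    simp only [this, Finset.sum_neg_distrib]
    abel
  have hres := residue_eq_zero (p := p) (hB.prod (isInner_diagForm h0)) hlat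
    (by
      push_cast
      refine mul_ne_zero (hd.cast_ne_zero (by omega)) (Finset.prod_ne_zero_iff.2 fun i _ => ?_)
      exact neg_ne_zero.2 ((hlg i).cast_ne_zero (by omega))) l'
    (fun a ha => (hl' a ha).cast_ne_zero (by omega)) hcls
  have h1 := isWittFun_residueLine.sum_eq_zero _ (l'.map fun a : ℤ => (a : ZMod p)) rfl
    (by
      simp only [List.mem_map]
      rintro _ ⟨a, ha, rfl⟩
      exact (hl' a ha).cast_ne_zero (by omega))
    (by rw [List.map_map]; exact hres)
  rw [List.map_map, Function.comp_def,
    List.map_congr_left fun a ha => (scaledLine_eq_residueLine (hl' a ha)).symm] at h1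
  have h2 : (l'.map fun a : ℤ => line (p * a : ℚ)).sum ∈ filt (p - 1) := by
    rw [← QuotientAddGroup.eq_zero_iff, ← QuotientAddGroup.mk'_apply, map_list_sum, List.map_map]
    exact h1
  rw [hw]
  refine add_mem (list_sum_mem ?_) h2
  simp only [List.mem_map]
  rintro _ ⟨a, ha, rfl⟩
  exact line_mem_filt (hl a ha)

theorem exists_cls_eq_diag {B : BilinForm ℚ V} (hB : IsInner B) :
    ∃ (v : Basis (Fin (finrank ℚ V)) ℚ V) (_ : ∀ i, B (v i) (v i) ≠ 0),
      cls B hB = ∑ i, line (B (v i) (v i)) := by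
  obtain ⟨v, hv⟩ := LinearMap.BilinForm.exists_orthogonal_basis (B := B) ⟨hB.symm⟩
  have hsum : ∀ x y : Fin (finrank ℚ V) → ℚ, B (v.equivFun.symm x) (v.equivFun.symm y) =
      ∑ i, B (v i) (v i) * (x i * y i) := by
    intro x y
    simp only [Basis.equivFun_symm_apply, map_sum, LinearMap.sum_apply, map_smul,
      LinearMap.smul_apply]
    refine Finset.sum_congr rfl fun i _ => ?_
    rw [Finset.sum_eq_single i]
    · simp; ring
    · intro k _ hk
      have : B (v k) (v i) = 0 := hv hk
      simp [this]
    · simp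
  have h0 : ∀ i, B (v i) (v i) ≠ 0 := by
    intro i hi
    refine v.ne_zero i (hB.nondeg _ fun y => ?_)
    obtain ⟨y, rfl⟩ := v.equivFun.symm.surjective y
    have := hsum (Pi.single i 1) y
    simpa [hi, Pi.single_apply] using this
  refine ⟨v, h0, ?_⟩
  rw [← cls_diagForm _ h0]
  symm
  refine cls_eq_of_map v.equivFun.symm.toLinearMap ?_ (by simp)
  intro x y
  rw [diagForm_apply]
  exact hsum x y

theorem exists_line_mem_filt (q : ℚ) : ∃ n, line q ∈ filt n := by
  rcases eq_or_ne q 0 with rfl | hq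
  · exact ⟨0, by simp [line]⟩
  have h0 : q.num * q.den ≠ 0 := mul_ne_zero (Rat.num_ne_zero.2 hq) (by simp)
  refine ⟨(q.num * q.den).natAbs, ?_⟩
  have : line q = line ((q.num * q.den : ℤ) : ℚ) := by
    rw [← line_mul_sq hq (c := (q.den : ℚ)) (by simp)]
    congr 1
    push_cast
    rw [pow_two, ← mul_assoc, Rat.mul_den_eq_num]
  rw [this]
  exact line_mem_filt (.of_abs_le h0 (by simp))

theorem exists_cls_mem_filt {B : BilinForm ℚ V} (hB : IsInner B) : ∃ n, cls B hB ∈ filt n := by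
  obtain ⟨v, hv, h⟩ := exists_cls_eq_diag hB
  choose n hn using fun i => exists_line_mem_filt (B (v i) (v i))
  refine ⟨∑ i, n i, ?_⟩
  rw [h]
  exact sum_mem fun i hi => filt_mono (Finset.single_le_sum (fun _ _ => Nat.zero_le _) hi) (hn i)

/-- The Witt class of a lattice is generated by the primes dividing its discriminant. -/
theorem cls_mem_filt {B : BilinForm ℚ V} (hB : IsInner B) {j : M →ₗ[ℤ] V} {d : ℤ}
    (h : IsLattice B j d) {n : ℕ} (hd : IsSmooth n d) : cls B hB ∈ filt n := by
  obtain ⟨m, hm⟩ := exists_cls_mem_filt hB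
  rcases le_total m n with hmn | hnm
  · exact filt_mono hmn hm
  induction m, hnm using Nat.le_induction with
  | base => exact hm
  | succ m hnm ih =>
    refine ih ?_
    by_cases hp : (m + 1).Prime
    · have : Fact (m + 1).Prime := ⟨hp⟩
      exact cls_mem_filt_pred hB h (p := m + 1) (hd.mono hnm) hm
    -- When m + 1 is composite, being (m + 1)-smooth is the same as being m-smooth, so the
    -- filtration does not jump.
    · refine AddSubgroup.closure_mono ?_ hm
      rintro w ⟨a, ha, rfl⟩
      refine ⟨a, ⟨ha.1, fun q hq hd => ?_⟩, rfl⟩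
      have := ha.2 q hq hd
      rcases this.lt_or_eq with h | h
      · omega
      · exact absurd (h ▸ hq) hp

end Descent

/-! ### Witt classes involving only the prime 2. -/

theorem IsSmooth.eq_one_or {m : ℤ} (h : IsSmooth 1 m) : m = 1 ∨ m = -1 := by
  rw [← Int.natAbs_eq_natAbs_iff, Int.natAbs_one]
  by_contra hne
  obtain ⟨q, hq, hd⟩ := Nat.exists_prime_and_dvd hne
  have := h.2 q hq (Int.natCast_dvd.2 hd)
  exact absurd hq.one_lt (by omega)

theorem exists_eq_zsmul_of_smooth {c : ℚ} (hc : c ≠ 0) (l : List ℤ) (hl : ∀ a ∈ l, IsSmooth 1 a) :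
    ∃ n : ℤ, (l.map fun a : ℤ => line (c * a : ℚ)).sum = n • line c := by
  induction l with
  | nil => exact ⟨0, by simp⟩
  | cons a t ih =>
    simp only [List.mem_cons, forall_eq_or_imp] at hl
    obtain ⟨n, hn⟩ := ih hl.2
    simp only [List.map_cons, List.sum_cons, hn]
    rcases hl.1.eq_one_or with rfl | rfl
    · exact ⟨1 + n, by rw [add_smul, one_smul]; simp⟩
    · exact ⟨-1 + n, by rw [add_smul, neg_smul, one_smul]; simp [line_neg hc]⟩

theorem exists_eq_zsmul_of_mem_filt_one {w : WittGroup ℚ} (hw : w ∈ filt 1) :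
    ∃ n : ℤ, w = n • line 1 := by
  suffices h : filt 1 ≤ AddSubgroup.zmultiples (line (1 : ℚ)) by
    obtain ⟨n, hn⟩ := AddSubgroup.mem_zmultiples_iff.1 (h hw)
    exact ⟨n, hn.symm⟩
  rw [filt, AddSubgroup.closure_le]
  rintro _ ⟨m, hm, rfl⟩
  rcases hm.eq_one_or with rfl | rfl
  · simp
  · simp [line_neg]

theorem two_zsmul_line_two : (2 : ℤ) • line (2 : ℚ) = (2 : ℤ) • line 1 := by
  have := line_add (one_ne_zero (α := ℚ)) one_ne_zero (by norm_num)
  norm_num at this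
  rw [two_zsmul, two_zsmul, this]

/-- Since 2⟨2⟩ = 2⟨1⟩, only the parity of the coefficient of ⟨2⟩ matters. -/
theorem exists_eq_of_mem_filt_two {w : WittGroup ℚ} (hw : w ∈ filt 2) :
    ∃ n : ℤ, w = n • line 1 ∨ w = n • line 1 + line 2 := by
  obtain ⟨l, l', hl, hl', rfl⟩ := exists_lists_of_mem_filt (p := 2) hw
  obtain ⟨n, hn⟩ := exists_eq_zsmul_of_smooth one_ne_zero l hl
  obtain ⟨m, hm⟩ := exists_eq_zsmul_of_smooth two_ne_zero l' hl'
  simp only [one_mul] at hn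
  rw [hn, Nat.cast_ofNat, hm]
  rcases Int.even_or_odd' m with ⟨c, rfl | rfl⟩
  · refine ⟨n + 2 * c, Or.inl ?_⟩
    rw [add_smul, mul_comm 2 c, mul_smul, two_zsmul_line_two, mul_smul]
  · refine ⟨n + 2 * c, Or.inr ?_⟩
    rw [add_smul, add_smul, one_smul, mul_comm 2 c, mul_smul, two_zsmul_line_two, mul_smul,
      add_assoc]

end WittGrp

/-! ### Signatures, isotropic vectors and characteristic vectors -/

namespace WittGrp

open Module

section Signature

variable {V V' : Type} [AddCommGroup V] [Module ℚ V] [AddCommGroup V'] [Module ℚ V']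

/-- The form has signature `s`. -/
def HasSign (B : BilinForm ℚ V) (s : ℤ) : Prop :=
  ∃ P N : Submodule ℚ V, (∀ x ∈ P, x ≠ 0 → 0 < B x x) ∧ (∀ x ∈ N, x ≠ 0 → B x x < 0) ∧
    finrank ℚ V ≤ finrank ℚ P + finrank ℚ N ∧ s = finrank ℚ P - finrank ℚ N

theorem HasSign.neg {B : BilinForm ℚ V} {s : ℤ} (h : HasSign B s) : HasSign (-B) (-s) := by
  obtain ⟨P, N, hP, hN, hd, rfl⟩ := h
  exact ⟨N, P, fun x hx h0 => by simpa using hN x hx h0, fun x hx h0 => by simpa using hP x hx h0,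
    by omega, by omega⟩

theorem HasSign.smul {B : BilinForm ℚ V} {s : ℤ} (h : HasSign B s) {c : ℚ} (hc : 0 < c) :
    HasSign (c • B) s := by
  obtain ⟨P, N, hP, hN, hd⟩ := h
  exact ⟨P, N, fun x hx h0 => by simpa [hc] using hP x hx h0,
    fun x hx h0 => by simpa using mul_neg_of_pos_of_neg hc (hN x hx h0), hd⟩

variable [FiniteDimensional ℚ V] [FiniteDimensional ℚ V']

theorem finrank_submodule_prod (P : Submodule ℚ V) (P' : Submodule ℚ V') :
    finrank ℚ (P.prod P') = finrank ℚ P + finrank ℚ P' := by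
  have h : P.prod P' = LinearMap.range (P.subtype.prodMap P'.subtype) := by
    rw [LinearMap.range_prodMap, P.range_subtype, P'.range_subtype]
  rw [h, LinearMap.finrank_range_of_inj (P.injective_subtype.prodMap P'.injective_subtype),
    finrank_prod]

theorem HasSign.prod {B : BilinForm ℚ V} {C : BilinForm ℚ V'} {s t : ℤ} (h : HasSign B s)
    (h' : HasSign C t) : HasSign (prodForm B C) (s + t) := by
  obtain ⟨P, N, hP, hN, hd, rfl⟩ := h
  obtain ⟨P', N', hP', hN', hd', rfl⟩ := h'
  refine ⟨P.prod P', N.prod N', ?_, ?_, ?_, ?_⟩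
  · rintro ⟨x, y⟩ ⟨hx, hy⟩ h0
    simp only [prodForm_apply]
    rcases eq_or_ne x 0 with rfl | hx0
    · simpa using hP' y hy fun hy0 => h0 (Prod.ext rfl hy0)
    rcases eq_or_ne y 0 with rfl | hy0
    · simpa using hP x hx hx0
    · exact add_pos (hP x hx hx0) (hP' y hy hy0)
  · rintro ⟨x, y⟩ ⟨hx, hy⟩ h0
    simp only [prodForm_apply]
    rcases eq_or_ne x 0 with rfl | hx0
    · simpa using hN' y hy fun hy0 => h0 (Prod.ext rfl hy0)
    rcases eq_or_ne y 0 with rfl | hy0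
    · simpa using hN x hx hx0
    · exact add_neg (hN x hx hx0) (hN' y hy hy0)
  · rw [finrank_submodule_prod, finrank_submodule_prod, finrank_prod]; omega
  · rw [finrank_submodule_prod, finrank_submodule_prod]; push_cast; ring

/-- A Lagrangian meets each definite subspace trivially, so neither of them exceeds half the
dimension. -/
theorem Metabolic.sign_eq_zero {B : BilinForm ℚ V} (h : Metabolic B) {s : ℤ} (hs : HasSign B s) :
    s = 0 := by
  obtain ⟨T, hT, hd⟩ := h
  obtain ⟨P, N, hP, hN, hd', rfl⟩ := hs
  have h1 : Disjoint T P := by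
    rw [Submodule.disjoint_def]
    intro x hx hx'
    by_contra h0
    exact (hP x hx' h0).ne' (hT x hx x hx)
  have h2 : Disjoint T N := by
    rw [Submodule.disjoint_def]
    intro x hx hx'
    by_contra h0
    exact (hN x hx' h0).ne (hT x hx x hx)
  have h3 := Submodule.finrank_add_finrank_le_of_disjoint h1
  have h4 := Submodule.finrank_add_finrank_le_of_disjoint h2
  omega

/-- A Witt class of signature `s`. -/
def ClassSign (w : WittGroup ℚ) (s : ℤ) : Prop :=
  ∃ X : InnerSpace ℚ, cls X.B X.inner = w ∧ HasSign X.B s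

theorem HasSign.classSign {B : BilinForm ℚ V} {s : ℤ} (h : HasSign B s) (hB : IsInner B) :
    ClassSign (cls B hB) s := ⟨⟨V, B, hB⟩, rfl, h⟩

theorem ClassSign.add {w w' : WittGroup ℚ} {s s' : ℤ} (h : ClassSign w s) (h' : ClassSign w' s') :
    ClassSign (w + w') (s + s') := by
  obtain ⟨X, rfl, hX⟩ := h
  obtain ⟨Y, rfl, hY⟩ := h'
  exact (hX.prod hY).classSign (X.inner.prod Y.inner)

theorem ClassSign.unique {w : WittGroup ℚ} {s s' : ℤ} (h : ClassSign w s) (h' : ClassSign w s') :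
    s = s' := by
  obtain ⟨X, rfl, hX⟩ := h
  obtain ⟨Y, hXY, hY⟩ := h'
  have := (cls_eq_iff.1 hXY.symm).sign_eq_zero (hX.prod hY.neg)
  omega

theorem classSign_line {a : ℚ} (ha : 0 < a) : ClassSign (line a) 1 := by
  rw [line_eq ha.ne']
  refine HasSign.classSign ⟨⊤, ⊥, fun x _ h0 => ?_, fun x hx h0 => absurd hx h0, by simp, by simp⟩ _
  simp only [lineForm_apply]
  exact mul_pos ha (mul_self_pos.2 h0)

/-- The definite unimodular diagonal form of signature `n` and rank `|n|`. -/
noncomputable def signForm (n : ℤ) : BilinForm ℚ (Fin n.natAbs → ℚ) :=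
  diagForm fun _ => (n.sign : ℚ)

theorem isInner_signForm (n : ℤ) : IsInner (signForm n) := isInner_diagForm fun i => by
  have hi := i.2
  have : n ≠ 0 := by rintro rfl; simp at hi
  simpa using this

theorem cls_signForm (n : ℤ) : cls (signForm n) (isInner_signForm n) = n • line 1 := by
  rcases eq_or_ne n 0 with rfl | hn
  · rw [zero_smul, cls_eq_zero_iff]
    exact ⟨⊤, fun x _ y _ => by simp [signForm], by simp⟩
  · have := cls_diagForm (fun _ : Fin n.natAbs => (n.sign : ℚ)) fun _ => by simpa using hn
    refine this.trans ?_
    rw [Finset.sum_const, Finset.card_univ, Fintype.card_fin]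
    rcases lt_or_gt_of_ne hn with h | h
    · rw [Int.sign_eq_neg_one_of_neg h, Int.cast_neg, Int.cast_one, line_neg one_ne_zero,
        ← natCast_zsmul, Int.natCast_natAbs, abs_of_neg h]
      simp
    · rw [Int.sign_eq_one_of_pos h, Int.cast_one, ← natCast_zsmul, Int.natCast_natAbs,
        abs_of_pos h]

theorem hasSign_signForm (n : ℤ) : HasSign (signForm n) n := by
  have hsum : ∀ x : Fin n.natAbs → ℚ, x ≠ 0 → 0 < ∑ i, x i * x i := by
    intro x hx
    obtain ⟨i, hi⟩ := Function.ne_iff.1 hx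
    exact Finset.sum_pos' (fun i _ => mul_self_nonneg _) ⟨i, Finset.mem_univ _, mul_self_pos.2 hi⟩
  rcases lt_or_ge n 0 with h | h
  · refine ⟨⊥, ⊤, fun x hx h0 => absurd hx h0, fun x _ h0 => ?_, by simp, by
      simp [abs_of_neg h]⟩
    simpa [signForm, Int.sign_eq_neg_one_of_neg h] using hsum x h0
  · refine ⟨⊤, ⊥, fun x _ h0 => ?_, fun x hx h0 => absurd hx h0, by simp, by
      simp [abs_of_nonneg h]⟩
    have hn : 0 < n := by
      rcases h.lt_or_eq with h | h
      · exact h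
      · subst h
        exact absurd (funext fun i => i.elim0) h0
    simpa [signForm, Int.sign_eq_one_of_pos hn] using hsum x h0

theorem classSign_zsmul (n : ℤ) : ClassSign (n • line 1) n := by
  rw [← cls_signForm]
  exact (hasSign_signForm n).classSign _

/-- A form that is Witt equivalent to a form of smaller rank is isotropic. -/
theorem exists_isotropic_of_cls_eq {B : BilinForm ℚ V} {C : BilinForm ℚ V'} {hB : IsInner B}
    {hC : IsInner C} (h : cls B hB = cls C hC) (hd : finrank ℚ V' < finrank ℚ V) :
    ∃ x, x ≠ 0 ∧ B x x = 0 := by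
  obtain ⟨T, hT, hTd⟩ := cls_eq_iff.1 h
  rw [finrank_prod] at hTd
  have hlt : finrank ℚ V' < finrank ℚ T := by omega
  -- The Lagrangian is too large to inject into V', so it contains a nonzero vector (x, 0).
  have hker := LinearMap.ker_ne_bot_of_finrank_lt
    (f := LinearMap.snd ℚ V V' ∘ₗ T.subtype) hlt
  obtain ⟨⟨⟨x, y⟩, hxy⟩, hx, h0⟩ := Submodule.exists_mem_ne_zero_of_ne_bot hker
  have hy : y = 0 := hx
  subst hy
  refine ⟨x, ?_, ?_⟩
  · rintro rfl
    exact h0 rfl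
  · simpa using hT _ hxy _ hxy

theorem exists_isotropic_of_cls_eq_zsmul {B : BilinForm ℚ V} {hB : IsInner B} {n : ℤ}
    (h : cls B hB = n • line 1) (hd : n.natAbs < finrank ℚ V) : ∃ x, x ≠ 0 ∧ B x x = 0 :=
  exists_isotropic_of_cls_eq (h.trans (cls_signForm n).symm) (by simpa using hd)

theorem exists_isotropic_of_cls_eq_zsmul_add {B : BilinForm ℚ V} {hB : IsInner B} {n : ℤ} {a : ℚ}
    (ha : a ≠ 0) (h : cls B hB = n • line 1 + line a) (hd : n.natAbs + 1 < finrank ℚ V) :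
    ∃ x, x ≠ 0 ∧ B x x = 0 := by
  rw [← cls_signForm, line_eq ha, ← cls_prod] at h
  exact exists_isotropic_of_cls_eq h (by simpa [finrank_prod] using hd)

end Signature

/-! ### Characteristic vectors and van der Blij's lemma. -/

section Characteristic

variable {V : Type} [AddCommGroup V] [Module ℚ V] [FiniteDimensional ℚ V]
  {M : Type*} [AddCommGroup M] [Module.Finite ℤ M]

/-- The norm of a characteristic vector of a metabolic unimodular lattice is divisible by `8`. -/
theorem Metabolic.eight_dvd {B : BilinForm ℚ V} (hB : IsInner B) (hM : Metabolic B)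
    {j : M →ₗ[ℤ] V} (h : IsLattice B j 1) {w : M}
    (hw : ∀ x, ∃ z : ℤ, B (j w) (j x) = B (j x) (j x) + 2 * z) :
    ∃ z : ℤ, B (j w) (j w) = 8 * z := by
  obtain ⟨T, hT⟩ := hM
  -- On T, pairing with w is even because norms vanish there, so half of it is represented by a
  -- lattice vector y. Then w - 2y lies in T and is isotropic, and w·y ≡ y·y mod 2 turns 4(w·y) -
  -- 4(y·y) into a multiple of 8.
  obtain ⟨y, hy⟩ := h.exists_repr T ((1 / 2 : ℚ) • B (j w)) (by
    intro x hx
    obtain ⟨z, hz⟩ := hw x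
    refine ⟨z, ?_⟩
    rw [LinearMap.smul_apply, hz, hT.1 _ hx _ hx, smul_eq_mul]
    ring)
  have hmem : j w - (2 : ℚ) • j y ∈ T := by
    refine hT.mem hB fun t ht => ?_
    have := hy t ht
    simp only [LinearMap.smul_apply, smul_eq_mul] at this
    simp only [map_sub, map_smul, LinearMap.sub_apply, LinearMap.smul_apply, this, smul_eq_mul]
    push_cast
    ring
  have h0 := hT.1 _ hmem _ hmem
  obtain ⟨z, hz⟩ := hw y
  simp only [map_sub, map_smul, LinearMap.sub_apply, LinearMap.smul_apply, smul_eq_mul,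
    hB.symm (j y) (j w), hz] at h0
  exact ⟨z, by linear_combination h0⟩

/-- Van der Blij's lemma: the norm of a characteristic vector of a unimodular lattice is
congruent to the signature modulo `8`. -/
theorem characteristic_norm {B : BilinForm ℚ V} (hB : IsInner B)
    {j : M →ₗ[ℤ] V} (h : IsLattice B j 1) {w : M}
    (hw : ∀ x, ∃ z : ℤ, B (j w) (j x) = B (j x) (j x) + 2 * z) {n : ℤ}
    (hn : cls B hB = n • line 1) : ∃ z : ℤ, B (j w) (j w) = n + 8 * z := by
  have hM := cls_eq_iff.1 (hn.trans (cls_signForm n).symm)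
  have hneg : -signForm n = diagForm fun _ => ((-n.sign : ℤ) : ℚ) := by
    ext x y
    simp [signForm]
  have hlat := h.prod (isLattice_std fun _ : Fin n.natAbs => -n.sign)
  rw [← hneg] at hlat
  have hone : (1 * ∏ _i : Fin n.natAbs, -n.sign) * (1 * ∏ _i : Fin n.natAbs, -n.sign) = 1 := by
    rcases eq_or_ne n 0 with rfl | hn0
    · simp
    · rw [one_mul, ← Finset.prod_mul_distrib]
      refine Finset.prod_eq_one fun i _ => ?_
      rcases lt_or_gt_of_ne hn0 with h | h
      · rw [Int.sign_eq_neg_one_of_neg h]; rfl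
      · rw [Int.sign_eq_one_of_pos h]; rfl
  -- The discriminant factor is ±1; multiplying it by itself normalizes it to 1.
  have hlat' := hlat.mul (1 * ∏ _i : Fin n.natAbs, -n.sign)
  rw [hone] at hlat'
  -- The all-ones vector is characteristic for the diagonal form because x(x - 1) is even. The
  -- characteristic vector used below is (w, 1, ..., 1), of norm B(w, w) - n.
  have hsq : ∀ x : Fin n.natAbs → ℤ, ∃ z : ℤ, ∑ i, -n.sign * x i =
      ∑ i, -n.sign * (x i * x i) + 2 * z := by
    intro x
    choose c hc using fun i => Int.even_mul_succ_self (x i - 1)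
    refine ⟨∑ i, n.sign * c i, ?_⟩
    rw [Finset.mul_sum, ← Finset.sum_add_distrib]
    refine Finset.sum_congr rfl fun i _ => ?_
    have := hc i
    linear_combination n.sign * this
  obtain ⟨z, hz⟩ := hM.eight_dvd (hB.prod (isInner_signForm n).neg) hlat' (w := (w, fun _ => 1)) (by
    rintro ⟨x, y⟩
    obtain ⟨a, ha⟩ := hw x
    obtain ⟨b, hb⟩ := hsq y
    refine ⟨a + b, ?_⟩
    have hb' := congrArg (Int.cast : ℤ → ℚ) hb
    push_cast at hb'
    rw [hneg]
    simp only [prodForm_apply, LinearMap.prodMap_apply, diagForm_apply, stdLattice_apply, ha]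
    push_cast
    simp only [one_mul]
    linear_combination hb')
  refine ⟨z, ?_⟩
  rw [hneg] at hz
  simp only [prodForm_apply, LinearMap.prodMap_apply, diagForm_apply, stdLattice_apply] at hz
  have hcard : ∑ _i : Fin n.natAbs, ((-n.sign : ℤ) : ℚ) * (((1 : ℤ) : ℚ) * ((1 : ℤ) : ℚ)) = -n := by
    have : (n.natAbs : ℤ) * n.sign = n := by rw [mul_comm]; exact Int.sign_mul_natAbs n
    rw [Finset.sum_const, Finset.card_univ, Fintype.card_fin, nsmul_eq_mul]
    have h2 : ((n.natAbs : ℤ) : ℚ) * (n.sign : ℚ) = n := by rw [← Int.cast_mul, this]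
    rw [Int.cast_natCast] at h2
    simp only [Int.cast_one, mul_one, Int.cast_neg]
    linear_combination -h2
  rw [hcard] at hz
  linear_combination hz

end Characteristic

end WittGrp

/-! ### Even 2-elementary lattices -/

namespace TwoElementary

open Module

variable {M : Type u} [AddCommGroup M]

/-- An even lattice `L` with `2 L* ⊆ L`. -/
structure IsTwoElementary (B : BilinForm ℤ M) : Prop where
  symm : ∀ x y, B x y = B y x
  even : ∀ x, 2 ∣ B x x
  repr : ∀ f : M →ₗ[ℤ] ℤ, ∃ m, ∀ x, B m x = 2 * f x

/-- The sublattice `2 L* = {x ∈ L | (x, L) ⊆ 2ℤ}` of a 2-elementary lattice. -/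
def dbl (B : BilinForm ℤ M) : Submodule ℤ M where
  carrier := {m | ∀ x, 2 ∣ B m x}
  zero_mem' x := by simp
  add_mem' {a b} ha hb x := by
    rw [map_add, LinearMap.add_apply]; exact dvd_add (ha x) (hb x)
  smul_mem' c a ha x := by
    rw [map_smul, LinearMap.smul_apply]; exact (ha x).mul_left c

theorem mem_dbl {B : BilinForm ℤ M} {m : M} : m ∈ dbl B ↔ ∀ x, 2 ∣ B m x := Iff.rfl

theorem exists_odd {B : BilinForm ℤ M} {x : M} (hx : x ∉ dbl B) : ∃ y, B x y % 2 = 1 := by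
  rw [mem_dbl] at hx
  push Not at hx
  obtain ⟨y, hy⟩ := hx
  exact ⟨y, by omega⟩

theorem exists_eq_smul [Module.Free ℤ M] [Module.Finite ℤ M] {e : M} {g : ℤ}
    (h : ∀ f : M →ₗ[ℤ] ℤ, g ∣ f e) : ∃ e', e = g • e' := by
  let b := Free.chooseBasis ℤ M
  choose c hc using fun i => h (b.coord i)
  refine ⟨b.equivFun.symm c, b.equivFun.injective ?_⟩
  funext i
  rw [map_smul, LinearEquiv.apply_symm_apply]
  exact hc i

/-- The values of all functionals at e form an ideal of ℤ; its generator is the divisibility of e,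
attained by some f. -/
theorem exists_primitive [Module.Free ℤ M] [Module.Finite ℤ M] {e : M} (he : e ≠ 0) :
    ∃ (g : ℤ) (e' : M) (f : M →ₗ[ℤ] ℤ), e = g • e' ∧ f e' = 1 := by
  let I : Submodule ℤ ℤ := LinearMap.range (Dual.eval ℤ M e)
  obtain ⟨g, hg⟩ := (IsPrincipalIdealRing.principal I).principal
  have hdvd : ∀ f : M →ₗ[ℤ] ℤ, g ∣ f e := fun f => by
    have : f e ∈ I := ⟨f, rfl⟩
    rw [hg] at this
    exact Ideal.mem_span_singleton.1 this
  obtain ⟨f, hf⟩ : g ∈ I := by rw [hg]; exact Submodule.mem_span_singleton_self g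
  have hf : f e = g := hf
  have hg0 : g ≠ 0 := by
    rintro rfl
    exact he ((forall_dual_apply_eq_zero_iff ℤ e).1 fun f => zero_dvd_iff.1 (hdvd f))
  obtain ⟨e', hE⟩ := exists_eq_smul hdvd
  refine ⟨g, e', f, hE, ?_⟩
  have : f e = g * f e' := by conv_lhs => rw [hE, map_smul, smul_eq_mul]
  rw [hf] at this
  exact mul_left_cancel₀ hg0 (by rw [← this, mul_one])

namespace IsTwoElementary

variable {B : BilinForm ℤ M}

theorem dvd_right (h : IsTwoElementary B) {d : M} (hd : d ∈ dbl B) (x : M) : 2 ∣ B x d := by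
  rw [h.symm]; exact hd x

theorem exists_dbl_two (h : IsTwoElementary B) (f : M →ₗ[ℤ] ℤ) :
    ∃ m ∈ dbl B, ∀ x, B m x = 2 * f x := by
  obtain ⟨m, hm⟩ := h.repr f
  exact ⟨m, fun x => ⟨_, hm x⟩, hm⟩

variable [Module.Free ℤ M] [Module.Finite ℤ M]

/-- The isometry `L ≅ ⟨e, z⟩^⊥ ⊕ ⟨e, z⟩` for a hyperbolic pair `e, z`. -/
theorem splitsU_of_pair (hsymm : ∀ x y, B x y = B y x) {e z : M} (he : B e e = 0) (hz : B z z = 0)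
    (hez : B e z = 1) : OG10.SplitsU B := by
  have hze : B z e = 1 := by rw [hsymm, hez]
  let Γ : Submodule ℤ M := LinearMap.ker (B e) ⊓ LinearMap.ker (B z)
  have hmem : ∀ x : M, x - B z x • e - B e x • z ∈ Γ := by
    intro x
    constructor
    · simp [he, hez]
    · simp [hze, hz]
  have h1 : ∀ γ : Γ, B e γ.1 = 0 := fun γ => γ.2.1
  have h2 : ∀ γ : Γ, B z γ.1 = 0 := fun γ => γ.2.2
  let φ : M →ₗ[ℤ] Γ :=
    { toFun := fun x => ⟨x - B z x • e - B e x • z, hmem x⟩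
      map_add' := fun x y => Subtype.ext (by simp [add_smul]; abel)
      map_smul' := fun c x => Subtype.ext (by simp [mul_smul, smul_sub]) }
  refine ⟨Γ, inferInstance, inferInstance, inferInstance, B.restrict Γ,
    ⟨fun x y => hsymm _ _⟩, ⟨{
      toFun := fun x => (φ x, ![B z x, B e x])
      map_add' := fun x y => ?_
      map_smul' := fun c x => ?_
      invFun := fun p => p.1.1 + p.2 0 • e + p.2 1 • z
      left_inv := fun x => ?_
      right_inv := fun p => ?_
      map_app' := fun x y => ?_ }⟩⟩
  · rw [map_add]
    refine Prod.ext rfl ?_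
    funext i
    fin_cases i <;> simp
  · rw [map_smul]
    refine Prod.ext rfl ?_
    funext i
    fin_cases i <;> simp
  · simp [φ]
    abel
  · refine Prod.ext (Subtype.ext ?_) ?_
    · simp [φ, h1, h2, he, hz, hez, hze]
      abel
    · funext i
      fin_cases i <;> simp [h1, h2, he, hz, hez, hze]
  · have hU : ∀ a b : Fin 2 → ℤ, OG10.U a b = a 0 * b 1 + a 1 * b 0 := by
      intro a b
      simp [OG10.U, Matrix.toBilin'_apply, Fin.sum_univ_two]
    change B (φ x).1 (φ y).1 + OG10.U _ _ = _
    rw [hU]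
    simp [φ, he, hz, hez, hze, hsymm x e, hsymm x z]
    ring

/-- The primitive multiple of e pairs oddly with some y and pairs to 2 with some vector of 2L*, so a
combination pairs to 1 with it. Evenness then allows a multiple of e to kill the norm of the
partner. -/
theorem splitsU_of_isotropic (h : IsTwoElementary B) {e : M} (he : B e e = 0) (hd : e ∉ dbl B) :
    OG10.SplitsU B := by
  have he0 : e ≠ 0 := by rintro rfl; exact hd (dbl B).zero_mem
  obtain ⟨g, e', f, rfl, hf⟩ := exists_primitive he0
  have hg : g ≠ 0 := by rintro rfl; simp at he0
  obtain ⟨y, hy⟩ := exists_odd hd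
  have he' : B e' e' = 0 := by simpa [hg] using he
  have hy' : B e' y % 2 = 1 := by
    rw [map_smul, LinearMap.smul_apply, smul_eq_mul] at hy
    rcases Int.emod_two_eq_zero_or_one (B e' y) with h0 | h0
    · rw [Int.mul_emod, h0] at hy; simp at hy
    · exact h0
  obtain ⟨m, -, hm⟩ := h.exists_dbl_two f
  have hem : B e' m = 2 := by rw [h.symm, hm, hf, mul_one]
  set k := B e' y / 2 with hk
  set y1 := y - k • m with hy1
  have h1 : B e' y1 = 1 := by
    rw [hy1, map_sub, map_smul, hem, smul_eq_mul]; omega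
  obtain ⟨c, hc⟩ := h.even y1
  refine splitsU_of_pair h.symm he' (z := y1 - c • e') ?_ ?_
  · have h2 : B y1 e' = 1 := by rw [h.symm, h1]
    simp [hc, h1, h2, he']
    ring
  · simp [h1, he']

/-- An isotropic 2-elementary lattice splits `U` as soon as it has a vector `s ∉ 2L*` of norm
divisible by `4`. -/
theorem splitsU_of_isotropic_of_norm (h : IsTwoElementary B) {e : M} (he0 : e ≠ 0)
    (he : B e e = 0) {s : M} (hs : s ∉ dbl B) (hs4 : 4 ∣ B s s) : OG10.SplitsU B := by
  obtain ⟨g, e', f, rfl, hf⟩ := exists_primitive he0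
  have hg : g ≠ 0 := by rintro rfl; simp at he0
  replace he : B e' e' = 0 := by simpa [hg] using he
  by_cases hd : e' ∈ dbl B
  swap
  · exact h.splitsU_of_isotropic he hd
  obtain ⟨ρ, hρ, hρB⟩ := h.exists_dbl_two f
  have heρ : B e' ρ = 2 := by rw [h.symm, hρB, hf, mul_one]
  obtain ⟨t, ht⟩ := exists_odd hs
  obtain ⟨l, hl⟩ := hd t
  obtain ⟨l', hl'⟩ := hd s
  obtain ⟨c, hc⟩ := h.even t
  obtain ⟨c', hc'⟩ := h.even ρ
  obtain ⟨c'', hc''⟩ := hs4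
  obtain ⟨u, hu⟩ := hρ t
  obtain ⟨u', hu'⟩ := hρ s
  have hts : B t s = B s t := h.symm _ _
  have htρ : B t ρ = 2 * u := by rw [h.symm, hu]
  have hsρ : B s ρ = 2 * u' := by rw [h.symm, hu']
  obtain ⟨v, hv⟩ : ∃ v, B s t = 2 * v + 1 := ⟨B s t / 2, by omega⟩
  -- With such an x, of norm 4k, the vector x - ke' is isotropic and, like x, outside 2L*.
  obtain ⟨x, hxd, hex, h4⟩ : ∃ x, x ∉ dbl B ∧ B e' x = 2 ∧ 4 ∣ B x x := by
    rcases Int.even_or_odd' l' with ⟨w, rfl | rfl⟩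
    · -- adjust `t` by multiples of `s` and `ρ`
      -- γ is forced by the condition e'·x = 2. Then γ ≡ 1 - l mod 2, so the norm of x is 2c + 2β +
      -- 2(1 - l)c' mod 4, and β is chosen to cancel it. The product of x with s stays odd, which
      -- keeps x outside 2L*.
      set γ := 1 - l - (c + (1 - l) * c') * (2 * w) with hγ
      set β := c + (1 - l) * c' with hβ
      refine ⟨t + β • s + γ • ρ, fun hx => ?_, ?_, ?_⟩
      · obtain ⟨y, hy⟩ := h.dvd_right hx s
        simp only [map_add, map_smul, smul_eq_mul, hsρ, hv, hc''] at hy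
        have : 2 * (y - v - 2 * β * c'' - γ * u') = 1 := by linear_combination -hy
        omega
      · simp only [map_add, map_smul, smul_eq_mul, hl, hl', heρ, hγ, hβ]
        ring
      · have hnorm : B (t + β • s + γ • ρ) (t + β • s + γ • ρ) =
            2 * c + β ^ 2 * (4 * c'') + γ ^ 2 * (2 * c') + 2 * β * (2 * v + 1) + 4 * γ * u +
              4 * β * γ * u' := by
          simp [hts, htρ, hsρ, hc, hc', hc'', hu, hu', hv]
          ring
        obtain ⟨y, hy⟩ := Int.even_mul_succ_self l
        refine ⟨β ^ 2 * c'' + β * v + γ * u + β * γ * u' + c + c' * (1 - 2 * l + y -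
          2 * (1 - l) * β * w + 2 * β ^ 2 * w ^ 2), ?_⟩
        rw [hnorm]
        have e1 : 2 * β = 2 * c + 2 * (1 - l) * c' := by rw [hβ]; ring
        have e2 : γ ^ 2 = (1 - l) ^ 2 - 4 * (1 - l) * β * w + 4 * β ^ 2 * w ^ 2 := by
          rw [hγ]; ring
        rw [e2]
        linear_combination e1 + 2 * c' * hy
    · refine ⟨s + (-2 * w) • ρ, fun hx => ?_, ?_, ?_⟩
      · have := (dbl B).sub_mem hx ((dbl B).smul_mem (-2 * w) hρ)
        rw [add_sub_cancel_right] at this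
        exact hs this
      · simp only [map_add, map_smul, smul_eq_mul, hl', heρ]
        ring
      · refine ⟨c'' - 2 * w * u' + 2 * w ^ 2 * c', ?_⟩
        simp [hsρ, hc', hc'', hu']
        ring
  obtain ⟨k, hk⟩ := h4
  have hxe : B x e' = 2 := by rw [h.symm, hex]
  refine h.splitsU_of_isotropic (e := x - k • e') ?_ ?_
  · simp [hex, hxe, he, hk]
    ring
  · intro hmem
    exact hxd (by simpa using (dbl B).add_mem hmem ((dbl B).smul_mem k hd))

end IsTwoElementary
end TwoElementary

/-! ### The signature of a 2-elementary lattice -/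

namespace TwoElementary

open Module WittGrp

section BaseChange

variable {M : Type u} [AddCommGroup M]

/-- The inclusion `L → L ⊗ ℚ`. -/
def toRat (M : Type u) [AddCommGroup M] : M →ₗ[ℤ] ℚ ⊗[ℤ] M :=
  (TensorProduct.mk ℤ ℚ M 1).toAddMonoidHom.toIntLinearMap

@[simp] theorem toRat_apply (x : M) : toRat M x = 1 ⊗ₜ[ℤ] x := rfl

theorem baseChange_one_tmul (B : BilinForm ℤ M) (x y : M) :
    B.baseChange ℚ (1 ⊗ₜ[ℤ] x) (1 ⊗ₜ[ℤ] y) = (B x y : ℚ) := by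
  simp [LinearMap.BilinForm.baseChange_tmul]

theorem exists_tmul_eq_smul (v : ℚ ⊗[ℤ] M) :
    ∃ n : ℤ, n ≠ 0 ∧ ∃ x : M, (1 : ℚ) ⊗ₜ[ℤ] x = n • v := by
  induction v with
  | zero => exact ⟨1, one_ne_zero, 0, by simp⟩
  | tmul q x =>
    refine ⟨q.den, by simp, q.num • x, ?_⟩
    rw [TensorProduct.tmul_smul, TensorProduct.smul_tmul', TensorProduct.smul_tmul']
    congr 1
    simp only [zsmul_eq_mul, mul_one, Int.cast_natCast]
    rw [mul_comm, Rat.mul_den_eq_num]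
  | add v w hv hw =>
    obtain ⟨a, ha, x, hx⟩ := hv
    obtain ⟨b, hb, y, hy⟩ := hw
    refine ⟨a * b, mul_ne_zero ha hb, b • x + a • y, ?_⟩
    rw [TensorProduct.tmul_add, TensorProduct.tmul_smul, TensorProduct.tmul_smul, hx, hy, smul_add,
      smul_smul, smul_smul, mul_comm b a]

theorem isInner_baseChange {B : BilinForm ℤ M} (hsymm : ∀ x y, B x y = B y x)
    (hnd : ∀ x, (∀ y, B x y = 0) → x = 0) : IsInner (B.baseChange ℚ) where
  symm x y := (LinearMap.BilinForm.IsSymm.baseChange ℚ ⟨hsymm⟩).eq x y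
  nondeg x hx := by
    obtain ⟨n, hn, m, hm⟩ := exists_tmul_eq_smul x
    have hm0 : m = 0 := hnd m fun y => by
      have : ((B m y : ℤ) : ℚ) = 0 := by
        rw [← baseChange_one_tmul, hm, map_zsmul, LinearMap.smul_apply, hx, smul_zero]
      exact_mod_cast this
    rw [hm0, TensorProduct.tmul_zero, eq_comm, ← Int.cast_smul_eq_zsmul ℚ,
      smul_eq_zero] at hm
    exact hm.resolve_left (by exact_mod_cast hn)

/-- The lattice has signature `s`: every positive multiple of its rational form has a Witt class of
signature `s`. -/
def IsSignature {M : Type} [AddCommGroup M] [Module.Finite ℤ M] (B : BilinForm ℤ M) (s : ℤ) :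
    Prop :=
  ∀ c : ℚ, 0 < c → ∀ (hI : IsInner (c • B.baseChange ℚ)) (t : ℤ), ClassSign (cls _ hI) t → t = s

end BaseChange

section

variable {M : Type u} [AddCommGroup M] {B : BilinForm ℤ M}

/-- Two vectors with odd product span `L / 2L*`. -/
def Spans (B : BilinForm ℤ M) (x y : M) : Prop :=
  ∀ z, 2 ∣ B x z → 2 ∣ B y z → z ∈ dbl B

namespace IsTwoElementary

theorem norm_add (h : IsTwoElementary B) {d : M} (x : M) (hx : 2 ∣ B x d) :
    ∃ z, B (x + d) (x + d) = B x x + B d d + 4 * z := by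
  obtain ⟨c, hc⟩ := hx
  refine ⟨c, ?_⟩
  simp only [map_add, LinearMap.add_apply, h.symm d x, hc]
  ring

/-- If all vectors outside `2L*` have norm `2` modulo `4`, then `L / 2L*` is at most a plane. -/
theorem spans_of_norm (h : IsTwoElementary B) (hn : ∀ s, s ∉ dbl B → ¬ 4 ∣ B s s) {x y : M}
    (hxy : B x y % 2 = 1) : Spans B x y := by
  intro z hxz hyz
  by_contra hz
  have hx : x ∉ dbl B := fun hx => by have := hx y; omega
  have hxz' : x + z ∉ dbl B := fun hd => by
    have := hd y
    rw [map_add, LinearMap.add_apply, h.symm z y] at this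
    omega
  have h1 := hn _ hx
  have h2 := hn _ hz
  have h3 := hn _ hxz'
  have e1 := h.even x
  have e2 := h.even z
  have e3 : B (x + z) (x + z) = B x x + 2 * B x z + B z z := by
    simp only [map_add, LinearMap.add_apply, h.symm z x]
    ring
  omega

/-- Both x and x + d have norm 2 mod 4 and x·d is even, so the norm of d vanishes mod 4. This is δ =
0 in disguise. -/
theorem dbl_norm_of_norm (h : IsTwoElementary B) (hn : ∀ s, s ∉ dbl B → ¬ 4 ∣ B s s) {x : M}
    (hx : x ∉ dbl B) {d : M} (hd : d ∈ dbl B) : 4 ∣ B d d := by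
  obtain ⟨z, hz⟩ := h.norm_add x (h.dvd_right hd x)
  have h1 := hn _ hx
  have h2 := hn (x + d) fun hxd => hx (by simpa using (dbl B).sub_mem hxd hd)
  have e1 := h.even x
  have e2 := h.even d
  omega

theorem nondeg [Module.Free ℤ M] [Module.Finite ℤ M] (h : IsTwoElementary B) (x : M)
    (hx : ∀ y, B x y = 0) : x = 0 := by
  refine (forall_dual_apply_eq_zero_iff ℤ x).1 fun f => ?_
  obtain ⟨m, hm⟩ := h.repr f
  have := hm x
  rw [h.symm, hx] at this
  omega

theorem isInner [Module.Free ℤ M] [Module.Finite ℤ M] (h : IsTwoElementary B) :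
    IsInner (B.baseChange ℚ) := isInner_baseChange h.symm h.nondeg

theorem isLattice (h : IsTwoElementary B) :
    IsLattice (B.baseChange ℚ) (toRat M) 2 where
  integral x y := ⟨B x y, baseChange_one_tmul B x y⟩
  span := exists_tmul_eq_smul
  repr f := by
    obtain ⟨m, hm⟩ := h.repr f
    exact ⟨m, fun x => by
      rw [toRat_apply, toRat_apply, baseChange_one_tmul, hm]⟩

end IsTwoElementary

end

variable {M : Type} [AddCommGroup M] [Module.Free ℤ M] [Module.Finite ℤ M] {B : BilinForm ℤ M}

namespace IsTwoElementary

/-- The Witt class is k⟨1⟩ with k = s, or k⟨1⟩ + ⟨2⟩ with k = s - 1. The rank bound exceeds the rank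
of the standard representative in both cases. -/
theorem exists_isotropic (h : IsTwoElementary B) {s : ℤ} (hs : IsSignature B s)
    (h2 : (s - 1).natAbs + 1 < finrank ℤ M) :
    ∃ e, e ≠ 0 ∧ B e e = 0 := by
  have hrank : finrank ℚ (ℚ ⊗[ℤ] M) = finrank ℤ M := finrank_baseChange
  have hsig := hs 1 one_pos (by rw [one_smul]; exact h.isInner)
  simp only [one_smul] at hsig
  have hmem := cls_mem_filt h.isInner h.isLattice (n := 2) (.of_abs_le two_ne_zero (by simp))
  obtain ⟨v, hv, hvv⟩ : ∃ v, v ≠ 0 ∧ B.baseChange ℚ v v = 0 := by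
    obtain ⟨n, hn | hn⟩ := exists_eq_of_mem_filt_two hmem
    · have : n = s := hsig n (by rw [hn]; exact classSign_zsmul n)
      exact exists_isotropic_of_cls_eq_zsmul hn (by omega)
    · have : n + 1 = s := hsig _ (by
        rw [hn]; exact (classSign_zsmul n).add (classSign_line two_pos))
      exact exists_isotropic_of_cls_eq_zsmul_add two_ne_zero hn (by omega)
  obtain ⟨n, hn, e, he⟩ := exists_tmul_eq_smul v
  refine ⟨e, ?_, ?_⟩
  · rintro rfl
    rw [TensorProduct.tmul_zero, eq_comm, ← Int.cast_smul_eq_zsmul ℚ, smul_eq_zero] at he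
    exact he.elim (by exact_mod_cast hn) hv
  · have : ((B e e : ℤ) : ℚ) = 0 := by
      rw [← baseChange_one_tmul, he, map_zsmul, map_zsmul, LinearMap.smul_apply, hvv, smul_zero,
        smul_zero]
    exact_mod_cast this

/-- If `δ = 0` and `L / 2L*` is a plane, then `2L* + ℤx`, with the form divided by `2`, is
unimodular. -/
theorem isLattice_half (h : IsTwoElementary B) {x y : M} (hxy : B x y % 2 = 1)
    (hsp : Spans B x y) :
    IsLattice ((1 / 2 : ℚ) • B.baseChange ℚ)
      (toRat M ∘ₗ (dbl B ⊔ Submodule.span ℤ {x}).subtype) 1 := by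
  set N := dbl B ⊔ Submodule.span ℤ {x} with hN
  have hmemN : ∀ d ∈ dbl B, ∀ k : ℤ, d + k • x ∈ N := fun d hd k =>
    Submodule.add_mem_sup hd (Submodule.smul_mem _ _ (Submodule.mem_span_singleton_self x))
  have hform : ∀ a b : N, ((1 / 2 : ℚ) • B.baseChange ℚ)
      ((toRat M ∘ₗ N.subtype) a) ((toRat M ∘ₗ N.subtype) b) =
      1 / 2 * (B a.1 b.1 : ℚ) := by
    intro a b
    rw [← baseChange_one_tmul]
    rfl
  have hdbl : ∀ z : M, (2 : ℤ) • z ∈ dbl B := fun z w => by simp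
  refine ⟨?_, ?_, ?_⟩
  · rintro ⟨a, ha⟩ ⟨b, hb⟩
    have : 2 ∣ B a b := by
      obtain ⟨d, hd, _, he, rfl⟩ := Submodule.mem_sup.1 ha
      obtain ⟨k, rfl⟩ := Submodule.mem_span_singleton.1 he
      obtain ⟨d', hd', _, he', rfl⟩ := Submodule.mem_sup.1 hb
      obtain ⟨k', rfl⟩ := Submodule.mem_span_singleton.1 he'
      obtain ⟨a1, h1⟩ := hd d'
      obtain ⟨a2, h2⟩ := hd x
      obtain ⟨a3, h3⟩ := h.dvd_right hd' x
      obtain ⟨a4, h4⟩ := h.even x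
      refine ⟨a1 + k' * a2 + k * a3 + k * k' * a4, ?_⟩
      simp only [map_add, LinearMap.add_apply, map_smul, LinearMap.smul_apply, smul_eq_mul, h1, h2,
        h3, h4]
      ring
    obtain ⟨z, hz⟩ := this
    refine ⟨z, ?_⟩
    rw [hform, hz]
    push_cast
    ring
  · intro v
    obtain ⟨n, hn, z, hz⟩ := exists_tmul_eq_smul v
    refine ⟨2 * n, mul_ne_zero two_ne_zero hn, ⟨(2 : ℤ) • z, Submodule.mem_sup_left (hdbl z)⟩, ?_⟩
    rw [LinearMap.comp_apply, Submodule.subtype_apply, map_zsmul, toRat_apply, hz, mul_smul]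
  · intro f
    -- A functional on 2L* + ℤx is extended to L by precomposing with doubling. Its representative d
    -- is divisible by 2, because every φ is paired through some d' in 2L*, which gives φ(d) =
    -- 2f(d'). Half of d is the wanted vector.
    let g : M →ₗ[ℤ] ℤ :=
      f ∘ₗ ((2 : ℤ) • (LinearMap.id : M →ₗ[ℤ] M)).codRestrict N
        fun z => Submodule.mem_sup_left (hdbl z)
    obtain ⟨d, hd, hdg⟩ := h.exists_dbl_two g
    have hg : ∀ m : N, g m.1 = 2 * f m := by
      intro m
      rw [← smul_eq_mul, ← map_smul]
      rfl
    obtain ⟨l, rfl⟩ := exists_eq_smul (e := d) (g := 2) fun φ => by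
      obtain ⟨d', hd', hφ⟩ := h.exists_dbl_two φ
      have h1 := hφ d
      rw [h.symm, hdg, hg ⟨d', Submodule.mem_sup_left hd'⟩] at h1
      exact ⟨f ⟨d', Submodule.mem_sup_left hd'⟩, by omega⟩
    have hl : ∀ m : N, B l m.1 = 2 * f m := by
      intro m
      have h1 := hdg m.1
      rw [hg, map_smul, LinearMap.smul_apply, smul_eq_mul] at h1
      omega
    have hlx : 2 ∣ B x l := by
      rw [h.symm]
      exact ⟨_, hl ⟨x, by simpa using hmemN 0 (zero_mem _) 1⟩⟩
    -- The coefficient y·l is chosen so that the difference pairs evenly with y, as x·y is odd; it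
    -- pairs evenly with x already.
    have hmem : l - B y l • x ∈ dbl B := by
      refine hsp _ ?_ ?_
      · rw [map_sub, map_smul, smul_eq_mul]
        exact dvd_sub hlx ((h.even x).mul_left _)
      · rw [map_sub, map_smul, smul_eq_mul, h.symm y x]
        obtain ⟨c, hc⟩ : ∃ c, B x y = 2 * c + 1 := ⟨B x y / 2, by omega⟩
        exact ⟨-(B y l * c), by rw [hc]; ring⟩
    have hlN : l ∈ N := by simpa using hmemN _ hmem (B y l)
    refine ⟨⟨l, hlN⟩, fun m => ?_⟩
    rw [hform, hl]
    push_cast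
    ring

/-- The hypotheses make w characteristic for the unimodular lattice 2L* + ℤx with half the form. Van
der Blij's lemma gives half the norm of w congruent to s mod 8. -/
theorem signature_of_characteristic (h : IsTwoElementary B) {s : ℤ} (hs : IsSignature B s)
    {x y : M} (hxy : B x y % 2 = 1) (hsp : Spans B x y) {w : M} (hw : w ∈ dbl B)
    (hδ : ∀ d ∈ dbl B, 4 ∣ B w d ∧ 4 ∣ B d d) (hwx : 4 ∣ B w x - B x x) :
    ∃ z, B w w = 2 * s + 16 * z := by
  have hI : IsInner ((1 / 2 : ℚ) • B.baseChange ℚ) := h.isInner.smul (by norm_num)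
  have hlat := h.isLattice_half hxy hsp
  obtain ⟨n, hn⟩ := exists_eq_zsmul_of_mem_filt_one
    (cls_mem_filt hI hlat (n := 1) (.of_abs_le one_ne_zero (by simp)))
  have hns : n = s := hs _ (by norm_num) hI n (by rw [hn]; exact classSign_zsmul n)
  obtain ⟨z, hz⟩ := characteristic_norm hI hlat (w := ⟨w, Submodule.mem_sup_left hw⟩) (by
    rintro ⟨m, hm⟩
    obtain ⟨d, hd, _, he, rfl⟩ := Submodule.mem_sup.1 hm
    obtain ⟨k, rfl⟩ := Submodule.mem_span_singleton.1 he
    obtain ⟨⟨a, ha⟩, ⟨b, hb⟩⟩ := hδ d hd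
    obtain ⟨c, hc⟩ := hwx
    obtain ⟨e, he⟩ := hd x
    obtain ⟨e', he'⟩ := h.even x
    obtain ⟨q, hq⟩ := Int.even_mul_succ_self (k - 1)
    refine ⟨a - b + k * c - k * e - q * e', ?_⟩
    have hc' : B w x = B x x + 4 * c := by linear_combination hc
    simp only [LinearMap.smul_apply, LinearMap.comp_apply, Submodule.subtype_apply,
      toRat_apply, baseChange_one_tmul, smul_eq_mul]
    have key : B w (d + k • x) = B (d + k • x) (d + k • x) +
        4 * (a - b + k * c - k * e - q * e') := by
      simp only [map_add, map_smul, LinearMap.add_apply, LinearMap.smul_apply, smul_eq_mul, ha,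
        hb, hc', he, he', h.symm x d]
      linear_combination (-2 * e') * hq
    rw [key]
    push_cast
    ring) hn
  refine ⟨z, ?_⟩
  simp only [LinearMap.smul_apply, LinearMap.comp_apply, Submodule.subtype_apply,
    toRat_apply, baseChange_one_tmul, smul_eq_mul, hns] at hz
  have : ((B w w : ℤ) : ℚ) = ((2 * s + 16 * z : ℤ) : ℚ) := by
    push_cast
    linear_combination 2 * hz
  exact_mod_cast this

/-- Here the halved lattice is even, so w = 0 is characteristic. -/
theorem eight_dvd_signature (h : IsTwoElementary B) {s : ℤ} (hs : IsSignature B s)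
    {x y : M} (hxy : B x y % 2 = 1) (hsp : Spans B x y)
    (hδ : ∀ d ∈ dbl B, 4 ∣ B d d) (hx : 4 ∣ B x x) : 8 ∣ s := by
  obtain ⟨z, hz⟩ := h.signature_of_characteristic hs hxy hsp (zero_mem _)
    (fun d hd => ⟨by simp, hδ d hd⟩) (by simpa using hx)
  simp only [map_zero] at hz
  omega

/-- Here w = 2y is characteristic, and its norm is 4·2 = 8 mod 16. -/
theorem signature_emod_eight (h : IsTwoElementary B) {s : ℤ} (hs : IsSignature B s)
    {x y : M} (hxy : B x y % 2 = 1) (hsp : Spans B x y)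
    (hδ : ∀ d ∈ dbl B, 4 ∣ B d d) (hx : ¬ 4 ∣ B x x) (hy : ¬ 4 ∣ B y y) : s % 8 = 4 := by
  have e1 := h.even x
  have e2 := h.even y
  obtain ⟨z, hz⟩ := h.signature_of_characteristic hs hxy hsp (w := (2 : ℤ) • y)
    (fun z => by simp) (fun d hd => ⟨by
      rw [map_smul, LinearMap.smul_apply, smul_eq_mul]
      obtain ⟨c, hc⟩ := h.dvd_right hd y
      exact ⟨c, by rw [hc]; ring⟩, hδ d hd⟩) (by
      rw [map_smul, LinearMap.smul_apply, smul_eq_mul, h.symm y x]; omega)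
  simp only [map_smul, LinearMap.smul_apply, smul_eq_mul] at hz
  omega

end IsTwoElementary
end TwoElementary

/-! ### Splitting criterion for 2-elementary lattices -/

namespace TwoElementary

open Module WittGrp

section

variable {M : Type u} [AddCommGroup M] {B : BilinForm ℤ M}

/-- The index of `2L*` in `L`. -/
noncomputable def dblIndex (B : BilinForm ℤ M) : ℕ := (dbl B).toAddSubgroup.index

/-- The pairings with `x` and `y` modulo `2`. -/
def pairMod (B : BilinForm ℤ M) (x y : M) : M →+ ZMod 2 × ZMod 2 :=
  (((Int.castAddHom (ZMod 2)).comp (B x).toAddMonoidHom)).prod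
    ((Int.castAddHom (ZMod 2)).comp (B y).toAddMonoidHom)

theorem mem_ker_pairMod {x y z : M} : z ∈ (pairMod B x y).ker ↔ 2 ∣ B x z ∧ 2 ∣ B y z := by
  have e : ∀ a : ℤ, 2 ∣ a ↔ (a : ZMod 2) = 0 := fun a =>
    (ZMod.intCast_zmod_eq_zero_iff_dvd a 2).symm
  rw [AddMonoidHom.mem_ker, e, e]
  exact Prod.ext_iff

namespace IsTwoElementary

theorem index_ker_pairMod (h : IsTwoElementary B) {x y : M} (hxy : B x y % 2 = 1) :
    (pairMod B x y).ker.index = 4 := by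
  have hsurj : Function.Surjective (pairMod B x y) := by
    have e1 := (ZMod.intCast_zmod_eq_zero_iff_dvd _ 2).2 (h.even x)
    have e2 := (ZMod.intCast_zmod_eq_zero_iff_dvd _ 2).2 (h.even y)
    have e3 : ((B x y : ℤ) : ZMod 2) = 1 := by
      rw [← Int.cast_one, ZMod.intCast_eq_intCast_iff]; exact hxy
    rintro ⟨a, b⟩
    obtain ⟨a, rfl⟩ := ZMod.intCast_surjective a
    obtain ⟨b, rfl⟩ := ZMod.intCast_surjective b
    refine ⟨a • y + b • x, ?_⟩
    simp [pairMod, e1, e2, e3, h.symm y x]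
  rw [AddSubgroup.index_ker, AddMonoidHom.range_eq_top.2 hsurj]
  simp

theorem dbl_le_ker (h : IsTwoElementary B) (x y : M) :
    (dbl B).toAddSubgroup ≤ (pairMod B x y).ker := fun _ hz =>
  mem_ker_pairMod.2 ⟨h.dvd_right hz x, h.dvd_right hz y⟩

theorem four_dvd_dblIndex (h : IsTwoElementary B) {x y : M} (hxy : B x y % 2 = 1) :
    4 ∣ dblIndex B := by
  rw [← h.index_ker_pairMod hxy]
  exact AddSubgroup.index_dvd_of_le (h.dbl_le_ker x y)

/-- The vectors pairing evenly with x and y form a subgroup of index 4 that contains 2L*; spanning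
means that the two coincide. -/
theorem spans_iff (h : IsTwoElementary B) {x y : M} (hxy : B x y % 2 = 1) :
    Spans B x y ↔ dblIndex B = 4 := by
  have hle := h.dbl_le_ker x y
  constructor
  · intro hs
    have : (dbl B).toAddSubgroup = (pairMod B x y).ker :=
      le_antisymm hle fun z hz => by
        obtain ⟨h1, h2⟩ := mem_ker_pairMod.1 hz
        exact hs z h1 h2
    rw [dblIndex, this, h.index_ker_pairMod hxy]
  · intro h4 z h1 h2
    have := AddSubgroup.relIndex_mul_index hle
    rw [h.index_ker_pairMod hxy, ← dblIndex, h4] at this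
    have h1' := Nat.eq_of_mul_eq_mul_right (by norm_num) (this.trans (one_mul 4).symm)
    exact AddSubgroup.relIndex_eq_one.1 h1' (mem_ker_pairMod.2 ⟨h1, h2⟩)

end IsTwoElementary

theorem exists_pair_of_splitsU (h : OG10.SplitsU B) :
    ∃ e z, B e e = 0 ∧ B z z = 0 ∧ B e z = 1 ∧ B z e = 1 := by
  obtain ⟨Γ, _, _, _, C, _, ⟨φ⟩⟩ := h
  have hB : ∀ a b : Γ × (Fin 2 → ℤ), B (φ.symm a) (φ.symm b) = OG10.orthSum C OG10.U a b := by
    intro a b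
    exact φ.symm.map_app b a
  have hU : ∀ a b : Fin 2 → ℤ, OG10.orthSum C OG10.U (0, a) (0, b) = a 0 * b 1 + a 1 * b 0 := by
    intro a b
    simp [OG10.orthSum, OG10.U, Matrix.toBilin'_apply, Fin.sum_univ_two]
  refine ⟨φ.symm (0, ![1, 0]), φ.symm (0, ![0, 1]), ?_, ?_, ?_, ?_⟩ <;> rw [hB, hU] <;> simp

end

variable {M : Type} [AddCommGroup M] [Module.Free ℤ M] [Module.Finite ℤ M] {B : BilinForm ℤ M}

namespace IsTwoElementary

theorem add_two_le_of_splitsU (h : IsTwoElementary B) {s : ℤ} (hs : IsSignature B s) {a n : ℕ}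
    (ha : dblIndex B * 2 ^ a = 2 ^ n) (hU : OG10.SplitsU B) :
    a + 2 ≤ n ∧ (a + 2 = n → (∀ d ∈ dbl B, 4 ∣ B d d) → 8 ∣ s) := by
  obtain ⟨e, z, he, hz, hez, hze⟩ := exists_pair_of_splitsU hU
  have hodd : B e z % 2 = 1 := by rw [hez]; rfl
  have h4 := h.four_dvd_dblIndex hodd
  constructor
  · obtain ⟨c, hc⟩ := h4
    rw [hc] at ha
    have : 2 ^ (a + 2) ∣ 2 ^ n := ⟨c, by rw [← ha]; ring⟩
    exact (Nat.pow_dvd_pow_iff_le_right (by norm_num)).1 this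
  · rintro rfl hδ
    have : dblIndex B = 4 := by
      rw [pow_add, mul_comm] at ha
      exact Nat.eq_of_mul_eq_mul_left (by positivity) ha
    exact h.eight_dvd_signature hs hodd ((h.spans_iff hodd).2 this) hδ (by rw [he]; simp)

/-- The only obstruction to splitting `U`. -/
theorem splitsU_or (h : IsTwoElementary B) {s : ℤ} (hs : IsSignature B s)
    (hrank : (s - 1).natAbs + 1 < finrank ℤ M) {a n : ℕ}
    (ha : dblIndex B * 2 ^ a = 2 ^ n) (han : a + 2 ≤ n) :
    OG10.SplitsU B ∨ (a + 2 = n ∧ (∀ d ∈ dbl B, 4 ∣ B d d) ∧ s % 8 = 4) := by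
  obtain ⟨e, he0, he⟩ := h.exists_isotropic hs hrank
  -- The dichotomy behind the criterion: without such a t, L/2L* is a plane on which half the norm
  -- is odd at every nonzero class.
  by_cases hn : ∃ t, t ∉ dbl B ∧ 4 ∣ B t t
  · obtain ⟨t, ht, ht4⟩ := hn
    exact Or.inl (h.splitsU_of_isotropic_of_norm he0 he ht ht4)
  · right
    push Not at hn
    obtain ⟨x, hx⟩ : ∃ x, x ∉ dbl B := by
      by_contra! hall
      have : dblIndex B = 1 := AddSubgroup.index_eq_one.2 (eq_top_iff.2 fun x _ => hall x)
      rw [this, one_mul] at ha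
      have := Nat.pow_right_injective le_rfl ha
      omega
    obtain ⟨y, hxy⟩ := exists_odd hx
    have hy : y ∉ dbl B := fun hy => by have := h.dvd_right hy x; omega
    have hsp := h.spans_of_norm hn hxy
    have hδ : ∀ d ∈ dbl B, 4 ∣ B d d := fun d hd => h.dbl_norm_of_norm hn hx hd
    refine ⟨?_, hδ, h.signature_emod_eight hs hxy hsp hδ (hn x hx) (hn y hy)⟩
    rw [(h.spans_iff hxy).1 hsp] at ha
    exact Nat.pow_right_injective le_rfl (show 2 ^ (a + 2) = 2 ^ n by rw [← ha]; ring)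

end IsTwoElementary
end TwoElementary

/-! ### The discriminant group of a 2-elementary lattice -/

namespace TwoElementary

open Module WittGrp OG10

/-! ### Elementary abelian 2-groups and numbers of generators. -/

section Group

variable {A : Type u} [AddCommGroup A]

/-- Generating as a group and spanning over `ZMod 2` are the same, so the minimal number of
generators is the dimension. -/
theorem elementary_group [Module.Finite ℤ A] (h2 : ∀ x : A, 2 • x = 0) :
    Nonempty (A ≃+ (Fin (sInf {n | ∃ s : Finset A, s.card = n ∧
      AddSubgroup.closure (s : Set A) = ⊤}) → ZMod 2)) := by
  classical
  let _ : Module (ZMod 2) A := AddCommGroup.zmodModule h2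
  have : Module.Finite (ZMod 2) A := Module.Finite.of_restrictScalars_finite ℤ (ZMod 2) A
  let b := finBasis (ZMod 2) A
  have hspan : ∀ s : Finset A, AddSubgroup.closure (s : Set A) = ⊤ →
      finrank (ZMod 2) A ≤ s.card := by
    intro s hs
    have htop : Submodule.span (ZMod 2) (s : Set A) = ⊤ := by
      rw [eq_top_iff]
      intro x _
      have hx : x ∈ AddSubgroup.closure (s : Set A) := hs ▸ AddSubgroup.mem_top x
      exact (AddSubgroup.closure_le (Submodule.span (ZMod 2) (s : Set A)).toAddSubgroup).2
        Submodule.subset_span hx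
    have := finrank_span_finset_le_card (R := ZMod 2) s
    rwa [Set.finrank, htop, finrank_top] at this
  have hb : ∃ s : Finset A, s.card = finrank (ZMod 2) A ∧
      AddSubgroup.closure (s : Set A) = ⊤ := by
    refine ⟨Finset.univ.image b, ?_, ?_⟩
    · rw [Finset.card_image_of_injective _ b.injective, Finset.card_univ, Fintype.card_fin]
    · have hz : Submodule.span ℤ (Set.range b) = ⊤ := by
        rw [eq_top_iff]
        intro x _
        rw [← b.sum_repr x]
        refine sum_mem fun i _ => ?_
        obtain ⟨c, hc⟩ := ZMod.intCast_surjective (b.repr x i)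
        rw [← hc, Int.cast_smul_eq_zsmul]
        exact Submodule.smul_mem _ _ (Submodule.subset_span ⟨i, rfl⟩)
      rw [Finset.coe_image, Finset.coe_univ, Set.image_univ]
      rw [← Submodule.span_int_eq_addSubgroupClosure, hz]
      rfl
  have heq : sInf {n | ∃ s : Finset A, s.card = n ∧ AddSubgroup.closure (s : Set A) = ⊤} =
      finrank (ZMod 2) A := by
    apply le_antisymm
    · exact Nat.sInf_le hb
    · obtain ⟨s, hs, hs'⟩ := Nat.sInf_mem (s := {n | ∃ s : Finset A, s.card = n ∧
        AddSubgroup.closure (s : Set A) = ⊤}) ⟨_, hb⟩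
      rw [← hs]
      exact hspan s hs'
  rw [heq]
  exact ⟨b.equivFun.toAddEquiv⟩

theorem length_le_of_surjective {Q : Type v} [AddCommGroup Q] [Module.Free ℤ Q] [Module.Finite ℤ Q]
    (g : Q →+ A) (hg : Function.Surjective g) :
    sInf {n | ∃ s : Finset A, s.card = n ∧ AddSubgroup.closure (s : Set A) = ⊤} ≤
      finrank ℤ Q := by
  classical
  let b := finBasis ℤ Q
  have hs : AddSubgroup.closure ((Finset.univ.image fun i => g (b i) : Finset A) : Set A) = ⊤ := by
    rw [Finset.coe_image, Finset.coe_univ, Set.image_univ, Set.range_comp' g b,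
      ← AddMonoidHom.map_closure, ← Submodule.span_int_eq_addSubgroupClosure, b.span_eq]
    exact AddSubgroup.map_top_of_surjective g hg
  have hmem : (Finset.univ.image fun i => g (b i) : Finset A).card ∈
      {n | ∃ s : Finset A, s.card = n ∧ AddSubgroup.closure (s : Set A) = ⊤} := ⟨_, rfl, hs⟩
  exact (Nat.sInf_le hmem).trans (Finset.card_image_le.trans (by simp))

end Group

/-! ### L*/L through the halving map from 2L*. -/

section Lattice

variable {M : Type u} [AddCommGroup M] [Module.Free ℤ M] [Module.Finite ℤ M] {B : BilinForm ℤ M}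

theorem exists_extension_of_torsionFree {M : Type u} [AddCommGroup M] [Module.Finite ℤ M]
    (S : Submodule ℤ M) [IsTorsionFree ℤ (M ⧸ S)] (f : S →ₗ[ℤ] ℤ) :
    ∃ g : M →ₗ[ℤ] ℤ, ∀ x : S, g x = f x := by
  obtain ⟨s, hs⟩ := Module.projective_lifting_property S.mkQ LinearMap.id S.mkQ_surjective
  let π : M →ₗ[ℤ] S := (LinearMap.id - s ∘ₗ S.mkQ).codRestrict S fun x => by
    refine (Submodule.Quotient.eq S).1 ?_
    exact (LinearMap.congr_fun hs (S.mkQ x)).symm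
  refine ⟨f ∘ₗ π, fun x => ?_⟩
  have : π x = x := Subtype.ext (by
    have h0 : S.mkQ x.1 = 0 := (Submodule.Quotient.mk_eq_zero S).2 x.2
    simp only [π, LinearMap.codRestrict_apply, LinearMap.sub_apply, LinearMap.id_apply,
      LinearMap.comp_apply, h0, map_zero, sub_zero])
  rw [LinearMap.comp_apply, this]

namespace IsTwoElementary

theorem half_mem_dual {M : Type u} [AddCommGroup M] {B : BilinForm ℤ M} {m : M}
    (hm : m ∈ dbl B) : (1 / 2 : ℚ) ⊗ₜ[ℤ] m ∈ dual B := by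
  intro x
  obtain ⟨c, hc⟩ := hm x
  refine ⟨c, ?_⟩
  rw [LinearMap.BilinForm.baseChange_tmul, hc, zsmul_eq_mul]
  push_cast
  ring

theorem tmul_left_injective {M : Type u} [AddCommGroup M] {B : BilinForm ℤ M}
    (hB : ∀ x, (∀ y, B x y = 0) → x = 0) {x y : M}
    (hxy : (1 : ℚ) ⊗ₜ[ℤ] x = 1 ⊗ₜ[ℤ] y) : x = y := by
  rw [← sub_eq_zero]
  refine hB _ fun z => ?_
  have h1 := baseChange_one_tmul B x z
  rw [hxy, baseChange_one_tmul] at h1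
  rw [map_sub, LinearMap.sub_apply, sub_eq_zero]
  exact_mod_cast h1.symm

/-- The map `2L* → L*/L`, `m ↦ m/2`. -/
def half (B : BilinForm ℤ M) : dbl B →+ DiscGroup B :=
  (QuotientAddGroup.mk' _).comp
    { toFun := fun m => (⟨(1 / 2 : ℚ) ⊗ₜ[ℤ] m.1, half_mem_dual m.2⟩ : dual B)
      map_zero' := Subtype.ext (by simp)
      map_add' := fun x y => Subtype.ext (by simp [TensorProduct.tmul_add]) }

theorem exists_half_eq (h : IsTwoElementary B) {x : ℚ ⊗[ℤ] M} (hx : x ∈ dual B) :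
    ∃ m ∈ dbl B, (1 / 2 : ℚ) ⊗ₜ[ℤ] m = x := by
  choose f hf using hx
  let F : M →ₗ[ℤ] ℤ :=
    { toFun := f
      map_add' := fun a b => by
        have : ((f (a + b) : ℤ) : ℚ) = ((f a + f b : ℤ) : ℚ) := by
          push_cast
          rw [← hf, ← hf, ← hf, TensorProduct.tmul_add, map_add]
        exact_mod_cast this
      map_smul' := fun c a => by
        have : ((f (c • a) : ℤ) : ℚ) = ((c * f a : ℤ) : ℚ) := by
          push_cast
          rw [← hf, ← hf, TensorProduct.tmul_smul, map_zsmul, zsmul_eq_mul]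
        exact_mod_cast this }
  obtain ⟨m, hm, hmF⟩ := h.exists_dbl_two F
  refine ⟨m, hm, ?_⟩
  rw [← sub_eq_zero]
  refine h.isInner.nondeg _ fun y => ?_
  obtain ⟨n, hn, z, hz⟩ := exists_tmul_eq_smul y
  have h1 : B.baseChange ℚ ((1 / 2 : ℚ) ⊗ₜ[ℤ] m - x) (1 ⊗ₜ[ℤ] z) = 0 := by
    rw [map_sub, LinearMap.sub_apply, hf, LinearMap.BilinForm.baseChange_tmul, hmF]
    change ((2 * f z : ℤ) • (1 / 2 * 1 : ℚ)) - f z = 0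
    rw [zsmul_eq_mul]
    push_cast
    ring
  rw [hz, map_zsmul, zsmul_eq_mul] at h1
  exact (mul_eq_zero.1 h1).resolve_left (by exact_mod_cast hn)

theorem half_surjective (h : IsTwoElementary B) : Function.Surjective (half B) := by
  intro q
  obtain ⟨⟨x, hx⟩, rfl⟩ := QuotientAddGroup.mk_surjective q
  obtain ⟨m, hm, rfl⟩ := h.exists_half_eq hx
  exact ⟨⟨m, hm⟩, rfl⟩

theorem half_eq_zero_iff (h : IsTwoElementary B) (m : dbl B) :
    half B m = 0 ↔ ∃ l : M, m.1 = 2 • l := by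
  change (QuotientAddGroup.mk _ : DiscGroup B) = 0 ↔ _
  rw [QuotientAddGroup.eq_zero_iff]
  change (∃ l : M, (1 : ℚ) ⊗ₜ[ℤ] l = (1 / 2 : ℚ) ⊗ₜ[ℤ] m.1) ↔ _
  refine exists_congr fun l => ?_
  constructor
  · intro hl
    apply tmul_left_injective h.nondeg
    have := congrArg (fun v => (2 : ℚ) • v) hl
    simp only [TensorProduct.smul_tmul', smul_eq_mul] at this
    norm_num at this
    rw [← this, TensorProduct.tmul_smul, TensorProduct.smul_tmul']
    norm_num
  · intro hl
    rw [hl, TensorProduct.tmul_smul, TensorProduct.smul_tmul']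
    norm_num

theorem two_nsmul_discGroup (h : IsTwoElementary B) (x : DiscGroup B) : 2 • x = 0 := by
  obtain ⟨m, rfl⟩ := h.half_surjective x
  rw [← map_nsmul, h.half_eq_zero_iff]
  exact ⟨m.1, rfl⟩

theorem finite_discGroup (h : IsTwoElementary B) : Module.Finite ℤ (DiscGroup B) :=
  Module.Finite.of_surjective (half B).toIntLinearMap h.half_surjective

theorem nonempty_discGroup_equiv (h : IsTwoElementary B) :
    Nonempty (DiscGroup B ≃+ (Fin (discLength B) → ZMod 2)) :=
  have := h.finite_discGroup
  elementary_group h.two_nsmul_discGroup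

/-- Every dual vector is m/2 with m in 2L*, and its norm is a quarter of that of m. -/
theorem delta_eq_zero_iff (h : IsTwoElementary B) :
    delta B = 0 ↔ ∀ d ∈ dbl B, 4 ∣ B d d := by
  have key : ∀ d : M, B.baseChange ℚ ((1 / 2 : ℚ) ⊗ₜ[ℤ] d) ((1 / 2 : ℚ) ⊗ₜ[ℤ] d) = B d d / 4 := by
    intro d
    rw [LinearMap.BilinForm.baseChange_tmul, zsmul_eq_mul]
    ring
  have : delta B = 0 ↔ ∀ x ∈ dual B, ∃ n : ℤ, B.baseChange ℚ x x = (n : ℚ) := by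
    unfold delta
    split_ifs with hc
    · exact ⟨fun _ => hc, fun _ => rfl⟩
    · exact ⟨fun h => absurd h (by simp), fun h => absurd h hc⟩
  rw [this]
  constructor
  · intro hx d hd
    obtain ⟨n, hn⟩ := hx _ (half_mem_dual hd)
    rw [key] at hn
    refine ⟨n, ?_⟩
    have : (B d d : ℚ) = ((4 * n : ℤ) : ℚ) := by push_cast; linear_combination 4 * hn
    exact_mod_cast this
  · intro hd x hx
    obtain ⟨m, hm, rfl⟩ := h.exists_half_eq hx
    obtain ⟨n, hn⟩ := hd m hm
    refine ⟨n, ?_⟩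
    rw [key, hn]
    push_cast
    ring

theorem index_two_smul (M : Type u) [AddCommGroup M] [Module.Free ℤ M] [Module.Finite ℤ M] :
    ((nsmulAddMonoidHom 2 : M →+ M).range).index = 2 ^ finrank ℤ M := by
  let b := finBasis ℤ M
  let f : M →+ (Fin (finrank ℤ M) → ZMod 2) :=
    ((Int.castAddHom (ZMod 2)).compLeft _).comp b.equivFun.toLinearMap.toAddMonoidHom
  have hf : ∀ m i, f m i = ((b.repr m i : ℤ) : ZMod 2) := fun m i => rfl
  have hker : (nsmulAddMonoidHom 2 : M →+ M).range = f.ker := by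
    ext m
    rw [AddMonoidHom.mem_ker]
    constructor
    · rintro ⟨l, rfl⟩
      funext i
      rw [hf]
      simp only [nsmulAddMonoidHom_apply, map_nsmul, Finsupp.smul_apply, nsmul_eq_mul]
      push_cast
      rw [show (2 : ZMod 2) = 0 from rfl, zero_mul]
      rfl
    · intro h0
      have hd : ∀ i, ∃ c : ℤ, b.repr m i = 2 * c := fun i =>
        (ZMod.intCast_zmod_eq_zero_iff_dvd _ 2).1 ((hf m i).symm.trans (congrFun h0 i))
      choose c hc using hd
      refine ⟨b.equivFun.symm c, b.equivFun.injective ?_⟩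
      funext i
      rw [nsmulAddMonoidHom_apply, map_nsmul, LinearEquiv.apply_symm_apply, b.equivFun_apply, hc]
      simp
  have hsurj : Function.Surjective f := by
    intro v
    choose c hc using fun i => ZMod.intCast_surjective (v i)
    refine ⟨b.equivFun.symm c, funext fun i => ?_⟩
    rw [hf, ← b.equivFun_apply, LinearEquiv.apply_symm_apply, hc]
  rw [hker, AddSubgroup.index_ker, AddMonoidHom.range_eq_top.2 hsurj]
  simp

/-- In the chain 2L ⊆ 2L* ⊆ L the lower quotient is isomorphic to L*/L, of order 2^a, and the total
index is 2^n. -/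
theorem dblIndex_mul (h : IsTwoElementary B) :
    dblIndex B * 2 ^ discLength B = 2 ^ finrank ℤ M := by
  obtain ⟨e⟩ := h.nonempty_discGroup_equiv
  have hcard : Nat.card (DiscGroup B) = 2 ^ discLength B := by
    rw [Nat.card_congr e.toEquiv]
    simp
  have hle : (nsmulAddMonoidHom 2 : M →+ M).range ≤ (dbl B).toAddSubgroup := by
    rintro _ ⟨l, rfl⟩ x
    simp
  have hrel : (nsmulAddMonoidHom 2 : M →+ M).range.relIndex (dbl B).toAddSubgroup =
      2 ^ discLength B := by
    have hker : (nsmulAddMonoidHom 2 : M →+ M).range.addSubgroupOf (dbl B).toAddSubgroup =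
        (half B).ker := by
      ext m
      rw [AddSubgroup.mem_addSubgroupOf, AddMonoidHom.mem_ker]
      exact Iff.trans ⟨fun ⟨l, hl⟩ => ⟨l, hl.symm⟩, fun ⟨l, hl⟩ => ⟨l, hl.symm⟩⟩
        (h.half_eq_zero_iff m).symm
    rw [AddSubgroup.relIndex, hker]
    refine (AddSubgroup.index_ker (half B)).trans ?_
    rw [AddMonoidHom.range_eq_top.2 h.half_surjective, ← hcard]
    exact Nat.card_congr AddSubgroup.topEquiv.toEquiv
  rw [← index_two_smul M, ← AddSubgroup.relIndex_mul_index hle, hrel, dblIndex, mul_comm]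

end IsTwoElementary
end Lattice
end TwoElementary

/-! ### Definite sublattices -/

namespace TwoElementary

open Module WittGrp OG10

section Definite

variable {M : Type u} [AddCommGroup M] {B : BilinForm ℤ M} {A : Type v} [AddCommGroup A]

theorem baseChange_map_eq (j : A →ₗ[ℤ] M) {C : BilinForm ℤ A} (h : ∀ a b, B (j a) (j b) = C a b)
    (x y : ℚ ⊗[ℤ] A) :
    B.baseChange ℚ (j.baseChange ℚ x) (j.baseChange ℚ y) = C.baseChange ℚ x y := by
  induction x with
  | zero => simp
  | add x x' hx hx' => simp only [map_add, LinearMap.add_apply, hx, hx']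
  | tmul a m =>
    induction y with
    | zero => simp
    | add y y' hy hy' => simp only [map_add, hy, hy']
    | tmul b n =>
      simp only [LinearMap.baseChange_tmul, LinearMap.BilinForm.baseChange_tmul, h]

theorem baseChange_map_eq_zero {A' : Type v} [AddCommGroup A'] (j : A →ₗ[ℤ] M) (k : A' →ₗ[ℤ] M)
    (h : ∀ a b, B (j a) (k b) = 0) (x : ℚ ⊗[ℤ] A) (y : ℚ ⊗[ℤ] A') :
    B.baseChange ℚ (j.baseChange ℚ x) (k.baseChange ℚ y) = 0 := by
  induction x with
  | zero => simp
  | add x x' hx hx' => simp only [map_add, LinearMap.add_apply, hx, hx', add_zero]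
  | tmul a m =>
    induction y with
    | zero => simp
    | add y y' hy hy' => simp only [map_add, hy, hy', add_zero]
    | tmul b n =>
      simp only [LinearMap.baseChange_tmul, LinearMap.BilinForm.baseChange_tmul, h, zero_smul]

theorem exists_pos_submodule [Module.Free ℤ A] [Module.Finite ℤ A] (j : A →ₗ[ℤ] M)
    (hj : ∀ a, a ≠ 0 → 0 < B (j a) (j a)) :
    ∃ P : Submodule ℚ (ℚ ⊗[ℤ] M), (∀ x ∈ P, x ≠ 0 → 0 < B.baseChange ℚ x x) ∧
      finrank ℚ P = finrank ℤ A := by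
  have key : ∀ w : ℚ ⊗[ℤ] A, w ≠ 0 → 0 < B.baseChange ℚ (j.baseChange ℚ w) (j.baseChange ℚ w) := by
    intro w hw
    obtain ⟨n, hn, x, hx⟩ := exists_tmul_eq_smul w
    have hx0 : x ≠ 0 := by
      rintro rfl
      rw [TensorProduct.tmul_zero] at hx
      rw [← Int.cast_smul_eq_zsmul ℚ] at hx
      exact (smul_ne_zero (by exact_mod_cast hn) hw) hx.symm
    have h1 : (1 : ℚ) ⊗ₜ[ℤ] j x = n • j.baseChange ℚ w := by
      rw [← map_zsmul, ← hx, LinearMap.baseChange_tmul]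
    have h2 := baseChange_one_tmul B (j x) (j x)
    rw [h1, map_zsmul, map_zsmul, LinearMap.smul_apply, zsmul_eq_mul, zsmul_eq_mul,
      ← mul_assoc] at h2
    have h3 : (0 : ℚ) < B (j x) (j x) := by exact_mod_cast hj x hx0
    rw [← h2] at h3
    exact (pos_iff_pos_of_mul_pos h3).1 (mul_self_pos.2 (by exact_mod_cast hn))
  refine ⟨LinearMap.range (j.baseChange ℚ), ?_, ?_⟩
  · rintro _ ⟨w, rfl⟩ h0
    exact key w fun hw => h0 (by rw [hw, map_zero])
  · rw [LinearMap.finrank_range_of_inj, finrank_baseChange]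
    rw [← LinearMap.ker_eq_bot, LinearMap.ker_eq_bot']
    intro w hw
    by_contra h0
    have := key w h0
    rw [hw, map_zero] at this
    exact lt_irrefl _ this

theorem baseChange_neg_form (B : BilinForm ℤ M) (x y : ℚ ⊗[ℤ] M) :
    (-B).baseChange ℚ x y = -B.baseChange ℚ x y := by
  induction x with
  | zero => simp
  | add x x' hx hx' => simp only [map_add, LinearMap.add_apply, hx, hx', neg_add]
  | tmul a m =>
    induction y with
    | zero => simp
    | add y y' hy hy' => simp only [map_add, hy, hy', neg_add]
    | tmul b n =>
      simp only [LinearMap.BilinForm.baseChange_tmul, LinearMap.neg_apply, neg_smul]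

theorem hasSign_of_definite {M A A' : Type} [AddCommGroup M] [AddCommGroup A] [AddCommGroup A']
    {B : BilinForm ℤ M} [Module.Free ℤ A] [Module.Finite ℤ A]
    [Module.Free ℤ A'] [Module.Finite ℤ A'] [Module.Free ℤ M] (j : A →ₗ[ℤ] M) (k : A' →ₗ[ℤ] M)
    (hj : ∀ a, a ≠ 0 → 0 < B (j a) (j a)) (hk : ∀ a, a ≠ 0 → B (k a) (k a) < 0)
    (hd : finrank ℤ M ≤ finrank ℤ A + finrank ℤ A') :
    HasSign (B.baseChange ℚ) (finrank ℤ A - finrank ℤ A') := by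
  obtain ⟨P, hP, hPd⟩ := exists_pos_submodule j hj
  obtain ⟨N, hN, hNd⟩ := exists_pos_submodule (B := -B) k fun a ha => by
    simpa using hk a ha
  refine ⟨P, N, hP, fun x hx h0 => ?_, ?_, ?_⟩
  · have := hN x hx h0
    rw [baseChange_neg_form] at this
    linarith
  · rwa [finrank_baseChange, hPd, hNd]
  · rw [hPd, hNd]

/-- A positive and a negative definite sublattice meet only in zero. -/
theorem finrank_add_le_of_definite {A' : Type v} [AddCommGroup A'] [Module.Free ℤ A]
    [Module.Finite ℤ A] [Module.Free ℤ A'] [Module.Finite ℤ A'] [Module.Free ℤ M]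
    [Module.Finite ℤ M] (j : A →ₗ[ℤ] M) (k : A' →ₗ[ℤ] M)
    (hj : ∀ a, a ≠ 0 → 0 < B (j a) (j a)) (hk : ∀ a, a ≠ 0 → B (k a) (k a) < 0) :
    finrank ℤ A + finrank ℤ A' ≤ finrank ℤ M := by
  rw [← finrank_prod]
  refine LinearMap.finrank_le_finrank_of_injective (f := j.coprod k) ?_
  rw [← LinearMap.ker_eq_bot, LinearMap.ker_eq_bot']
  rintro ⟨a, b⟩ h
  rw [LinearMap.coprod_apply] at h
  have h1 : j a = -k b := eq_neg_of_add_eq_zero_left h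
  have h2 : B (j a) (j a) = B (k b) (k b) := by
    rw [h1]; simp
  have ha : a = 0 := by
    by_contra ha
    have hp := hj a ha
    rw [h2] at hp
    have hb : b ≠ 0 := by rintro rfl; simp at hp
    exact absurd hp (hk b hb).not_gt
  have hb : b = 0 := by
    by_contra hb
    have hp := hk b hb
    rw [← h2, ha] at hp
    simp at hp
  rw [ha, hb]
  rfl

end Definite

/-! ### Involutions acting by `-1` on the discriminant group of a 3-elementary lattice -/

section Involution

variable {M : Type} [AddCommGroup M] [Module.Free ℤ M] [Module.Finite ℤ M] {B : BilinForm ℤ M}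

/-- `d L* ⊆ L`. -/
def Represents {M : Type u} [AddCommGroup M] (B : BilinForm ℤ M) (d : ℤ) : Prop :=
  ∀ f : M →ₗ[ℤ] ℤ, ∃ m, ∀ x, B m x = d * f x

theorem Represents.nondeg {M : Type u} [AddCommGroup M] [Module.Free ℤ M] [Module.Finite ℤ M]
    {B : BilinForm ℤ M} (hsymm : ∀ x y, B x y = B y x) {d : ℤ} (hd : d ≠ 0) (h : Represents B d)
    (x : M) (hx : ∀ y, B x y = 0) : x = 0 := by
  refine (forall_dual_apply_eq_zero_iff ℤ x).1 fun f => ?_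
  obtain ⟨m, hm⟩ := h f
  have := hm x
  rw [hsymm, hx] at this
  exact (mul_eq_zero.1 this.symm).resolve_left hd

theorem mem_invariants {M : Type u} [AddCommGroup M] {B : BilinForm ℤ M}
    {ι : B.IsometryEquiv B} {x : M} : x ∈ invariants ι ↔ ι x = x := by
  change ι x - x = 0 ↔ _
  exact sub_eq_zero

theorem mem_coinvariants {M : Type u} [AddCommGroup M] {B : BilinForm ℤ M}
    {ι : B.IsometryEquiv B} {x : M} : x ∈ coinvariants ι ↔ ι x = -x := by
  change ι x + x = 0 ↔ _
  exact eq_neg_iff_add_eq_zero.symm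

theorem form_invariants_coinvariants {M : Type u} [AddCommGroup M] {B : BilinForm ℤ M}
    {ι : B.IsometryEquiv B} {x y : M} (hx : x ∈ invariants ι)
    (hy : y ∈ coinvariants ι) : B x y = 0 := by
  have h := ι.map_app y x
  rw [mem_invariants.1 hx, mem_coinvariants.1 hy, map_neg] at h
  omega

theorem finrank_invariants_add {ι : B.IsometryEquiv B} (hinv : ∀ x, ι (ι x) = x) :
    finrank ℤ (invariants ι) + finrank ℤ (coinvariants ι) = finrank ℤ M := by
  rw [← finrank_prod]
  let φ : M →ₗ[ℤ] M := ι.toLinearEquiv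
  have hφ : ∀ x, φ x = ι x := fun x => rfl
  apply le_antisymm
  · refine LinearMap.finrank_le_finrank_of_injective
      (f := (invariants ι).subtype.coprod (coinvariants ι).subtype) ?_
    rw [← LinearMap.ker_eq_bot, LinearMap.ker_eq_bot']
    rintro ⟨⟨x, hx⟩, ⟨y, hy⟩⟩ h
    have h : x + y = 0 := h
    have h' := congrArg φ h
    rw [map_add, hφ, hφ, mem_invariants.1 hx, mem_coinvariants.1 hy, map_zero] at h'
    have hx0 : (2 : ℤ) • x = 0 := by
      rw [show (2 : ℤ) • x = (x + y) + (x + -y) by module, h, h', add_zero]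
    have hx1 := (smul_eq_zero.1 hx0).resolve_left two_ne_zero
    subst hx1
    rw [zero_add] at h
    subst h
    rfl
  -- The reverse inequality comes from x ↦ (x + ιx, x - ιx), injective because M has no 2-torsion.
  · have h1 : ∀ x, ((LinearMap.id : M →ₗ[ℤ] M) + φ) x ∈ invariants ι := fun x => mem_invariants.2 (by
      change φ (x + φ x) = x + φ x
      rw [map_add, hφ (φ x), hφ x, hinv, add_comm])
    have h2 : ∀ x, ((LinearMap.id : M →ₗ[ℤ] M) - φ) x ∈ coinvariants ι := fun x => mem_coinvariants.2 (by
      change φ (x - φ x) = -(x - φ x)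
      rw [map_sub, hφ (φ x), hφ x, hinv, neg_sub])
    refine LinearMap.finrank_le_finrank_of_injective
      (f := (((LinearMap.id : M →ₗ[ℤ] M) + φ).codRestrict _ h1).prod (((LinearMap.id : M →ₗ[ℤ] M) - φ).codRestrict _ h2)) ?_
    rw [← LinearMap.ker_eq_bot, LinearMap.ker_eq_bot']
    intro x hx
    have hx1 : x + φ x = 0 := congrArg Subtype.val (congrArg Prod.fst hx)
    have hx2 : x - φ x = 0 := congrArg Subtype.val (congrArg Prod.snd hx)
    have hx0 : (2 : ℤ) • x = 0 := by
      rw [show (2 : ℤ) • x = (x + φ x) + (x - φ x) by module, hx1, hx2, add_zero]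
    exact (smul_eq_zero.1 hx0).resolve_left two_ne_zero

instance isTorsionFree_quotient_invariants (ι : B.IsometryEquiv B) :
    IsTorsionFree ℤ (M ⧸ invariants ι) :=
  Function.Injective.moduleIsTorsionFree _
    (LinearMap.ker_eq_bot.1 (Submodule.ker_liftQ_eq_bot' (invariants ι)
      ((ι.toLinearEquiv : M →ₗ[ℤ] M) - LinearMap.id) rfl)) fun c x => map_smul _ c x

/-- Extend f to M and represent the extension by m/3 in the dual. As ι is -1 on the discriminant
group, m/3 + ι(m)/3 is a lattice vector l. It is invariant, and both summands pair with an invariant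
x to f(x). -/
theorem exists_average (hsymm : ∀ x y, B x y = B y x) (hrep : Represents B 3)
    {ι : B.IsometryEquiv B} (hinv : ∀ x, ι (ι x) = x) (hdisc : discMap ι = -AddMonoidHom.id _)
    (f : invariants ι →ₗ[ℤ] ℤ) :
    ∃ (m : M) (l : invariants ι), m + ι m = 3 • l.1 ∧ ∀ x : invariants ι, B l.1 x = 2 * f x := by
  obtain ⟨F, hF⟩ := exists_extension_of_torsionFree (invariants ι) f
  obtain ⟨m, hm⟩ := hrep F
  have hy : (1 / 3 : ℚ) ⊗ₜ[ℤ] m ∈ dual B := by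
    intro x
    refine ⟨F x, ?_⟩
    rw [LinearMap.BilinForm.baseChange_tmul, hm, zsmul_eq_mul]
    push_cast
    ring
  let y : dual B := ⟨(1 / 3 : ℚ) ⊗ₜ[ℤ] m, hy⟩
  have h1 := DFunLike.congr_fun hdisc (QuotientAddGroup.mk y)
  rw [AddMonoidHom.neg_apply, AddMonoidHom.id_apply, eq_neg_iff_add_eq_zero] at h1
  obtain ⟨l, hl⟩ : ∃ l : M, (1 : ℚ) ⊗ₜ[ℤ] l = (1 / 3 : ℚ) ⊗ₜ[ℤ] (ι m) + (1 / 3 : ℚ) ⊗ₜ[ℤ] m :=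
    (QuotientAddGroup.eq_zero_iff (N := (inRat M).addSubgroupOf (dual B))
      (dualMap ι y + y)).1 h1
  have hnd := hrep.nondeg hsymm (by norm_num)
  have hml : m + ι m = 3 • l := by
    refine IsTwoElementary.tmul_left_injective hnd ?_
    rw [TensorProduct.tmul_smul, hl, ← TensorProduct.tmul_add, TensorProduct.smul_tmul', add_comm]
    norm_num
  have hlL : ι l = l := by
    have h3 : (3 : ℤ) • (ι l - l) = 0 := by
      have h4 : ι.toLinearEquiv (m + ι m) = ι.toLinearEquiv (3 • l) := congrArg _ hml
      rw [map_add, map_nsmul] at h4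
      have h4 : ι m + ι (ι m) = 3 • ι l := h4
      rw [hinv, add_comm, hml] at h4
      rw [smul_sub, sub_eq_zero]
      exact_mod_cast h4.symm
    exact sub_eq_zero.1 ((smul_eq_zero.1 h3).resolve_left (by norm_num))
  refine ⟨m, ⟨l, mem_invariants.2 hlL⟩, hml, fun x => ?_⟩
  have h5 : B (m + ι m) x = B (3 • l) x := by rw [hml]
  have h6 : B (ι m) x = B m x := by
    conv_lhs => rw [← mem_invariants.1 x.2]
    exact ι.map_app _ _
  rw [map_add, LinearMap.add_apply, h6, hm, hF, map_nsmul, LinearMap.smul_apply] at h5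
  change B l x = 2 * f x
  rw [nsmul_eq_mul] at h5
  push_cast at h5
  omega

theorem isTwoElementary_invariantLattice (hsymm : ∀ x y, B x y = B y x) (heven : ∀ x, 2 ∣ B x x)
    (hrep : Represents B 3) {ι : B.IsometryEquiv B} (hinv : ∀ x, ι (ι x) = x)
    (hdisc : discMap ι = -AddMonoidHom.id _) : IsTwoElementary (invariantLattice ι) where
  symm x y := hsymm x y
  even x := heven x
  repr f := by
    obtain ⟨m, l, -, hl⟩ := exists_average hsymm hrep hinv hdisc f
    exact ⟨l, hl⟩

/-- The map x ↦ (x + ιx)/2 from M to the discriminant group kills the invariant vectors, so it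
factors through a free quotient of rank r. It is onto because averages give 3d for every d in the
doubled dual, and 3 acts as 1 on a group of exponent 2. -/
theorem discLength_invariantLattice_le (hsymm : ∀ x y, B x y = B y x) (heven : ∀ x, 2 ∣ B x x)
    (hrep : Represents B 3) {ι : B.IsometryEquiv B} (hinv : ∀ x, ι (ι x) = x)
    (hdisc : discMap ι = -AddMonoidHom.id _) :
    discLength (invariantLattice ι) ≤ finrank ℤ (coinvariants ι) := by
  have hL := isTwoElementary_invariantLattice hsymm heven hrep hinv hdisc
  have hsum : ∀ x, x + ι x ∈ invariants ι := fun x => mem_invariants.2 (by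
    change ι.toLinearEquiv (x + ι x) = _
    rw [map_add]
    change ι x + ι (ι x) = _
    rw [hinv, add_comm])
  have hdbl : ∀ x, (⟨x + ι x, hsum x⟩ : invariants ι) ∈ dbl (invariantLattice ι) := by
    rintro x y
    refine ⟨B x y, ?_⟩
    have h6 : B (ι x) y = B x y := by
      conv_lhs => rw [← mem_invariants.1 y.2]
      exact ι.map_app _ _
    change B (x + ι x) y = _
    rw [map_add, LinearMap.add_apply, h6, two_mul]
  let g : M →+ DiscGroup (invariantLattice ι) := (IsTwoElementary.half (invariantLattice ι)).comp
    { toFun := fun x => (⟨⟨x + ι x, hsum x⟩, hdbl x⟩ : dbl (invariantLattice ι))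
      map_zero' := Subtype.ext (Subtype.ext (by
        change (0 : M) + ι.toLinearEquiv 0 = 0
        rw [map_zero, add_zero]))
      map_add' := fun x y => Subtype.ext (Subtype.ext (by
        change x + y + ι.toLinearEquiv (x + y) = x + ι.toLinearEquiv x + (y + ι.toLinearEquiv y)
        rw [map_add]
        abel)) }
  have hg0 : invariants ι ≤ LinearMap.ker g.toIntLinearMap := by
    intro x hx
    refine (hL.half_eq_zero_iff _).2 ⟨⟨x, hx⟩, Subtype.ext ?_⟩
    change x + ι x = 2 • x
    rw [mem_invariants.1 hx, two_nsmul]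
  have hgs : Function.Surjective g := by
    intro q
    obtain ⟨⟨d, hd⟩, rfl⟩ := hL.half_surjective q
    let f : invariants ι →ₗ[ℤ] ℤ :=
      { toFun := fun y => invariantLattice ι d y / 2
        map_add' := fun x y => by
          have := hd x
          have := hd y
          rw [map_add]
          omega
        map_smul' := fun c x => by
          rw [map_smul, smul_eq_mul, RingHom.id_apply, smul_eq_mul, Int.mul_ediv_assoc _ (hd x)] }
    obtain ⟨m, l, hml, hl⟩ := exists_average hsymm hrep hinv hdisc f
    have hld : l = d := by
      rw [← sub_eq_zero]
      refine hL.nondeg _ fun y => ?_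
      rw [map_sub, LinearMap.sub_apply, sub_eq_zero]
      exact (hl y).trans (Int.mul_ediv_cancel' (hd y))
    refine ⟨m, ?_⟩
    have h3 : (⟨⟨m + ι m, hsum m⟩, hdbl m⟩ : dbl (invariantLattice ι)) = 3 • ⟨d, hd⟩ :=
      Subtype.ext (Subtype.ext (hml.trans (by rw [hld]; rfl)))
    change IsTwoElementary.half (invariantLattice ι) ⟨⟨m + ι m, hsum m⟩, hdbl m⟩ = _
    rw [h3, map_nsmul, succ_nsmul, hL.two_nsmul_discGroup, zero_add]
  have hrk := Submodule.finrank_quotient_add_finrank (invariants ι)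
  have hrk' := finrank_invariants_add hinv
  have hq : finrank ℤ (M ⧸ invariants ι) = finrank ℤ (coinvariants ι) := by omega
  rw [← hq]
  refine length_le_of_surjective ((invariants ι).liftQ g.toIntLinearMap hg0).toAddMonoidHom ?_
  intro q
  obtain ⟨m, rfl⟩ := hgs q
  exact ⟨(invariants ι).mkQ m, rfl⟩

/-- Rationally the lattice is the orthogonal sum of the invariant and coinvariant parts, and the
latter contributes minus its rank. -/
theorem isSignature_invariantLattice (hsymm : ∀ x y, B x y = B y x)
    (hnd : ∀ x, (∀ y, B x y = 0) → x = 0) {s : ℤ} (hs : HasSign (B.baseChange ℚ) s)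
    {ι : B.IsometryEquiv B} (hinv : ∀ x, ι (ι x) = x)
    (hneg : NegativeDefinite (coinvariantLattice ι)) :
    IsSignature (invariantLattice ι) (s + finrank ℤ (coinvariants ι)) := by
  intro c hc hI t ht
  have hK : HasSign ((coinvariantLattice ι).baseChange ℚ) (-finrank ℤ (coinvariants ι)) := by
    have := hasSign_of_definite (B := coinvariantLattice ι) (A := (⊥ : Submodule ℤ ℤ))
      0 LinearMap.id (fun a ha => absurd (Subsingleton.elim a 0) ha) hneg (by simp)
    simpa using this
  have hKI : IsInner ((coinvariantLattice ι).baseChange ℚ) :=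
    isInner_baseChange (fun x y => hsymm x y) fun x hx => by
      by_contra h0
      exact (hneg x h0).ne (hx x)
  have hBI : IsInner (B.baseChange ℚ) := isInner_baseChange hsymm hnd
  have hdec : cls _ (hI.prod (hKI.smul hc.ne')) = cls _ (hBI.smul hc.ne') := by
    refine cls_eq_of_map (((invariants ι).subtype.baseChange ℚ).coprod
      ((coinvariants ι).subtype.baseChange ℚ)) ?_ ?_
    · rintro ⟨x, y⟩ ⟨x', y'⟩
      have h1 := baseChange_map_eq (B := B) (C := invariantLattice ι) (invariants ι).subtype
        (fun _ _ => rfl) x x'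
      have h2 := baseChange_map_eq (B := B) (C := coinvariantLattice ι) (coinvariants ι).subtype
        (fun _ _ => rfl) y y'
      have h3 := baseChange_map_eq_zero (B := B) (invariants ι).subtype (coinvariants ι).subtype
        (fun a b => form_invariants_coinvariants a.2 b.2) x y'
      have h4 := baseChange_map_eq_zero (B := B) (coinvariants ι).subtype (invariants ι).subtype
        (fun a b => (hsymm _ _).trans (form_invariants_coinvariants b.2 a.2)) y x'
      simp only [LinearMap.coprod_apply, LinearMap.smul_apply, map_add, LinearMap.add_apply,
        prodForm_apply, h1, h2, h3, h4, smul_eq_mul]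
      ring
    · rw [finrank_prod, finrank_baseChange, finrank_baseChange, finrank_baseChange,
        finrank_invariants_add hinv]
  rw [cls_prod hI (hKI.smul hc.ne')] at hdec
  have h1 := ht.add ((hK.smul hc).classSign (hKI.smul hc.ne'))
  rw [hdec] at h1
  have := h1.unique ((hs.smul hc).classSign (hBI.smul hc.ne'))
  omega

end Involution
end TwoElementary

/-! ### The lattice `U³ ⊕ E₈² ⊕ A₂` -/

namespace TwoElementary

open Module WittGrp OG10

/-- C plays the role of d times the inverse Gram matrix: its rows are d times the dual basis. -/
theorem represents_toBilin' {n : Type*} [Fintype n] [DecidableEq n] {A C : Matrix n n ℤ} {d : ℤ}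
    (h : C * A = d • (1 : Matrix n n ℤ)) : Represents (Matrix.toBilin' A) d := by
  intro f
  refine ⟨Matrix.vecMul (fun i => f (Pi.single i 1)) C, fun x => ?_⟩
  rw [Matrix.toBilin'_apply', Matrix.dotProduct_mulVec, Matrix.vecMul_vecMul, h,
    Matrix.vecMul_smul, Matrix.vecMul_one, smul_dotProduct, smul_eq_mul]
  congr 1
  rw [LinearMap.pi_apply_eq_sum_univ f x, dotProduct]
  refine Finset.sum_congr rfl fun i _ => ?_
  rw [smul_eq_mul, mul_comm]
  congr 2
  funext j
  simp [Pi.single_apply, eq_comm]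

section OrthSum

variable {M : Type u} {N : Type v} [AddCommGroup M] [AddCommGroup N] {B : BilinForm ℤ M}
  {C : BilinForm ℤ N}

theorem orthSum_apply (B : BilinForm ℤ M) (C : BilinForm ℤ N) (x y : M × N) :
    orthSum B C x y = B x.1 y.1 + C x.2 y.2 := rfl

theorem Represents.orthSum {d : ℤ} (hB : Represents B d) (hC : Represents C d) :
    Represents (orthSum B C) d := by
  intro f
  obtain ⟨m, hm⟩ := hB (f ∘ₗ LinearMap.inl ℤ M N)
  obtain ⟨n, hn⟩ := hC (f ∘ₗ LinearMap.inr ℤ M N)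
  refine ⟨(m, n), fun x => ?_⟩
  rw [orthSum_apply, hm, hn, ← mul_add, LinearMap.comp_apply, LinearMap.comp_apply, ← map_add]
  simp

theorem orthSum_symm (hB : ∀ x y, B x y = B y x) (hC : ∀ x y, C x y = C y x) (x y : M × N) :
    orthSum B C x y = orthSum B C y x := by
  rw [orthSum_apply, orthSum_apply, hB, hC]

theorem orthSum_even (hB : ∀ x, 2 ∣ B x x) (hC : ∀ x, 2 ∣ C x x) (x : M × N) :
    2 ∣ orthSum B C x x := dvd_add (hB _) (hC _)

end OrthSum

theorem U_apply (x y : Fin 2 → ℤ) : U x y = x 0 * y 1 + x 1 * y 0 := by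
  simp [U, Matrix.toBilin'_apply', Matrix.mulVec, dotProduct, Fin.sum_univ_succ]

theorem A2_apply (x y : Fin 2 → ℤ) :
    A2 x y = -2 * x 0 * y 0 + x 0 * y 1 + x 1 * y 0 - 2 * x 1 * y 1 := by
  simp [A2, CartanMatrix.A, Matrix.toBilin'_apply', Matrix.mulVec, dotProduct, Fin.sum_univ_succ]
  ring

theorem E8_symm (x y : Fin 8 → ℤ) : E8 x y = E8 y x := by
  have h : (-CartanMatrix.E₈).transpose = -CartanMatrix.E₈ := by decide +kernel
  rw [E8, Matrix.toBilin'_apply', Matrix.toBilin'_apply', Matrix.dotProduct_mulVec,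
    ← Matrix.mulVec_transpose, h, dotProduct_comm]

theorem E8_apply_self (x : Fin 8 → ℤ) :
    E8 x x = -2 * (x 0 ^ 2 + x 1 ^ 2 + x 2 ^ 2 + x 3 ^ 2 + x 4 ^ 2 + x 5 ^ 2 + x 6 ^ 2 + x 7 ^ 2 -
      x 0 * x 2 - x 1 * x 3 - x 2 * x 3 - x 3 * x 4 - x 4 * x 5 - x 5 * x 6 - x 6 * x 7) := by
  rw [E8, Matrix.toBilin'_apply']
  simp only [CartanMatrix.E₈, Matrix.mulVec, dotProduct, Fin.sum_univ_eight, Matrix.neg_apply,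
    Matrix.of_apply, Matrix.cons_val]
  ring

theorem represents_U : Represents U 3 :=
  represents_toBilin' (C := !![0, 3; 3, 0]) (by decide +kernel)

theorem represents_A2 : Represents A2 3 :=
  represents_toBilin' (C := !![-2, -1; -1, -2]) (by decide +kernel)

theorem represents_E8 : Represents E8 3 :=
  -- The displayed matrix is the inverse of the Cartan matrix; the sign is that of the negative
  -- definite form.
  represents_toBilin' (C := (-3 : ℤ) • !![
    4, 5, 7, 10, 8, 6, 4, 2;
    5, 8, 10, 15, 12, 9, 6, 3;
    7, 10, 14, 20, 16, 12, 8, 4;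
    10, 15, 20, 30, 24, 18, 12, 6;
    8, 12, 16, 24, 20, 15, 10, 5;
    6, 9, 12, 18, 15, 12, 8, 4;
    4, 6, 8, 12, 10, 8, 6, 3;
    2, 3, 4, 6, 5, 4, 3, 2]) (by decide +kernel)

theorem E8_neg (x : Fin 8 → ℤ) (hx : x ≠ 0) : E8 x x < 0 := by
  -- Squares are completed along the three arms of the Dynkin diagram, from the ends towards the
  -- branch node 3; the factor 60 clears denominators.
  have h60 : 60 * E8 x x = -(30 * (2 * x 0 - x 2) ^ 2 + 30 * (2 * x 1 - x 3) ^ 2 +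
      10 * (3 * x 2 - 2 * x 3) ^ 2 + 30 * (2 * x 7 - x 6) ^ 2 + 10 * (3 * x 6 - 2 * x 5) ^ 2 +
      5 * (4 * x 5 - 3 * x 4) ^ 2 + 3 * (5 * x 4 - 4 * x 3) ^ 2 + 2 * x 3 ^ 2) := by
    rw [E8_apply_self]
    ring
  by_contra! h
  have n1 := sq_nonneg (2 * x 0 - x 2)
  have n2 := sq_nonneg (2 * x 1 - x 3)
  have n3 := sq_nonneg (3 * x 2 - 2 * x 3)
  have n4 := sq_nonneg (2 * x 7 - x 6)
  have n5 := sq_nonneg (3 * x 6 - 2 * x 5)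
  have n6 := sq_nonneg (4 * x 5 - 3 * x 4)
  have n7 := sq_nonneg (5 * x 4 - 4 * x 3)
  have n8 := sq_nonneg (x 3)
  have z1 : 2 * x 0 - x 2 = 0 := pow_eq_zero_iff two_ne_zero |>.1 (by linarith)
  have z2 : 2 * x 1 - x 3 = 0 := pow_eq_zero_iff two_ne_zero |>.1 (by linarith)
  have z3 : 3 * x 2 - 2 * x 3 = 0 := pow_eq_zero_iff two_ne_zero |>.1 (by linarith)
  have z4 : 2 * x 7 - x 6 = 0 := pow_eq_zero_iff two_ne_zero |>.1 (by linarith)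
  have z5 : 3 * x 6 - 2 * x 5 = 0 := pow_eq_zero_iff two_ne_zero |>.1 (by linarith)
  have z6 : 4 * x 5 - 3 * x 4 = 0 := pow_eq_zero_iff two_ne_zero |>.1 (by linarith)
  have z7 : 5 * x 4 - 4 * x 3 = 0 := pow_eq_zero_iff two_ne_zero |>.1 (by linarith)
  have z8 : x 3 = 0 := pow_eq_zero_iff two_ne_zero |>.1 (by linarith)
  refine hx (funext fun i => ?_)
  fin_cases i <;> simp <;> omega

theorem A2_neg (x : Fin 2 → ℤ) (hx : x ≠ 0) : A2 x x < 0 := by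
  have h2 : 2 * A2 x x = -((2 * x 0 - x 1) ^ 2 + 3 * x 1 ^ 2) := by
    rw [A2_apply]
    ring
  by_contra! h
  have n1 := sq_nonneg (2 * x 0 - x 1)
  have n2 := sq_nonneg (x 1)
  have z1 : 2 * x 0 - x 1 = 0 := pow_eq_zero_iff two_ne_zero |>.1 (by linarith)
  have z2 : x 1 = 0 := pow_eq_zero_iff two_ne_zero |>.1 (by linarith)
  refine hx (funext fun i => ?_)
  fin_cases i <;> simp <;> omega

theorem Lam_symm : ∀ x y, Lam x y = Lam y x := by
  have hU : ∀ x y, U x y = U y x := fun x y => by rw [U_apply, U_apply]; ring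
  have hA : ∀ x y, A2 x y = A2 y x := fun x y => by rw [A2_apply, A2_apply]; ring
  exact orthSum_symm hU (orthSum_symm hU (orthSum_symm hU
    (orthSum_symm E8_symm (orthSum_symm E8_symm hA))))

theorem Lam_even : ∀ x, 2 ∣ Lam x x := by
  have hU : ∀ x, 2 ∣ U x x := fun x => ⟨x 0 * x 1, by rw [U_apply]; ring⟩
  have hA : ∀ x, 2 ∣ A2 x x := fun x =>
    ⟨-x 0 ^ 2 + x 0 * x 1 - x 1 ^ 2, by rw [A2_apply]; ring⟩
  have hE : ∀ x, 2 ∣ E8 x x := fun x => by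
    rw [E8_apply_self]
    exact (dvd_neg.2 dvd_rfl).mul_right _
  exact orthSum_even hU (orthSum_even hU (orthSum_even hU
    (orthSum_even hE (orthSum_even hE hA))))

theorem represents_Lam : Represents Lam 3 :=
  represents_U.orthSum (represents_U.orthSum (represents_U.orthSum
    (represents_E8.orthSum (represents_E8.orthSum represents_A2))))

theorem finrank_carrier : finrank ℤ Carrier = 24 := by
  simp

/-- The vector `a (1, ε)` of `U`. -/
def ray (ε : ℤ) : ℤ →ₗ[ℤ] (Fin 2 → ℤ) := LinearMap.toSpanSingleton ℤ _ ![1, ε]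

theorem U_ray (ε a : ℤ) : U (ray ε a) (ray ε a) = 2 * ε * a ^ 2 := by
  rw [U_apply]
  simp [ray]
  ring

/-- A positive definite sublattice of rank `3`. -/
def posPart : (ℤ × ℤ × ℤ) →ₗ[ℤ] Carrier :=
  (ray 1).prodMap ((ray 1).prodMap (LinearMap.inl ℤ _ _ ∘ₗ ray 1))

/-- A negative definite sublattice of rank `21`. -/
def negPart : (ℤ × ℤ × ℤ × (Fin 8 → ℤ) × (Fin 8 → ℤ) × (Fin 2 → ℤ)) →ₗ[ℤ] Carrier :=
  (ray (-1)).prodMap ((ray (-1)).prodMap ((ray (-1)).prodMap LinearMap.id))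

theorem posPart_pos (x : ℤ × ℤ × ℤ) (hx : x ≠ 0) : 0 < Lam (posPart x) (posPart x) := by
  obtain ⟨a, b, c⟩ := x
  have h : Lam (posPart (a, b, c)) (posPart (a, b, c)) = 2 * a ^ 2 + 2 * b ^ 2 + 2 * c ^ 2 := by
    simp only [Lam, orthSum_apply, posPart, LinearMap.prodMap_apply, LinearMap.comp_apply,
      LinearMap.inl_apply, map_zero, U_ray]
    ring
  rw [h]
  by_contra! h0
  have ha := sq_nonneg a
  have hb := sq_nonneg b
  have hc := sq_nonneg c
  have ha0 : a = 0 := pow_eq_zero_iff two_ne_zero |>.1 (by linarith)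
  have hb0 : b = 0 := pow_eq_zero_iff two_ne_zero |>.1 (by linarith)
  have hc0 : c = 0 := pow_eq_zero_iff two_ne_zero |>.1 (by linarith)
  exact hx (by rw [ha0, hb0, hc0]; rfl)

theorem nonpos_of_neg {M : Type u} [AddCommGroup M] {B : BilinForm ℤ M}
    (h : ∀ x, x ≠ 0 → B x x < 0) (x : M) : B x x ≤ 0 ∧ (B x x = 0 → x = 0) := by
  by_cases hx : x = 0
  · simp [hx]
  · exact ⟨(h x hx).le, fun h0 => absurd h0 (h x hx).ne⟩

theorem negPart_neg (x) (hx : x ≠ 0) : Lam (negPart x) (negPart x) < 0 := by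
  obtain ⟨a, b, c, u, v, w⟩ := x
  have h : Lam (negPart (a, b, c, u, v, w)) (negPart (a, b, c, u, v, w)) =
      -2 * a ^ 2 + -2 * b ^ 2 + -2 * c ^ 2 + E8 u u + E8 v v + A2 w w := by
    simp only [Lam, orthSum_apply, negPart, LinearMap.prodMap_apply, LinearMap.id_apply, U_ray]
    ring
  rw [h]
  by_contra! h0
  have ha := sq_nonneg a
  have hb := sq_nonneg b
  have hc := sq_nonneg c
  obtain ⟨hu, hu'⟩ := nonpos_of_neg E8_neg u
  obtain ⟨hv, hv'⟩ := nonpos_of_neg E8_neg v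
  obtain ⟨hw, hw'⟩ := nonpos_of_neg A2_neg w
  have ha0 : a = 0 := pow_eq_zero_iff two_ne_zero |>.1 (by linarith)
  have hb0 : b = 0 := pow_eq_zero_iff two_ne_zero |>.1 (by linarith)
  have hc0 : c = 0 := pow_eq_zero_iff two_ne_zero |>.1 (by linarith)
  exact hx (by rw [ha0, hb0, hc0, hu' (by linarith), hv' (by linarith), hw' (by linarith)]; rfl)

theorem hasSign_Lam : HasSign (Lam.baseChange ℚ) (-18) := by
  have := hasSign_of_definite posPart negPart posPart_pos negPart_neg (by simp)
  simpa using this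

/-- For a hyperbolic pair e, z in the invariant lattice, e - z has norm -2 and is orthogonal to the
coinvariants. Together they span a negative definite lattice of rank r + 1, next to a positive
definite one of rank 3 in rank 24. -/
theorem finrank_coinvariants_le {ι : Lam.IsometryEquiv Lam}
    (hneg : NegativeDefinite (coinvariantLattice ι)) (hU : SplitsU (invariantLattice ι)) :
    finrank ℤ (coinvariants ι) ≤ 20 := by
  obtain ⟨e, z, he, hz, hez, hze⟩ := exists_pair_of_splitsU hU
  have he : Lam e e = 0 := he
  have hz : Lam z z = 0 := hz
  have hez : Lam e z = 1 := hez
  have hze : Lam z e = 1 := hze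
  have h := finrank_add_le_of_definite (B := Lam) posPart
    ((coinvariants ι).subtype.coprod (LinearMap.toSpanSingleton ℤ Carrier (e.1 - z.1)))
    posPart_pos ?_
  · simp only [finrank_prod, finrank_fin_fun, finrank_self] at h
    omega
  · rintro ⟨k, c⟩ hkc
    have h1 : Lam k e = 0 := (Lam_symm _ _).trans (form_invariants_coinvariants e.2 k.2)
    have h2 : Lam k z = 0 := (Lam_symm _ _).trans (form_invariants_coinvariants z.2 k.2)
    have h3 : Lam e k = 0 := form_invariants_coinvariants e.2 k.2
    have h4 : Lam z k = 0 := form_invariants_coinvariants z.2 k.2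
    have h : Lam (k.1 + c • (e.1 - z.1)) (k.1 + c • (e.1 - z.1)) = Lam k k - 2 * c ^ 2 := by
      simp only [map_add, map_sub, map_smul, LinearMap.add_apply, LinearMap.sub_apply,
        LinearMap.smul_apply, smul_eq_mul, h1, h2, h3, h4, he, hz, hez, hze]
      ring
    change Lam (k.1 + c • (e.1 - z.1)) (k.1 + c • (e.1 - z.1)) < 0
    rw [h]
    by_contra! h0
    have hc := sq_nonneg c
    obtain ⟨hk, hk'⟩ := nonpos_of_neg hneg k
    have hk : Lam k k ≤ 0 := hk
    have hc0 : c = 0 := pow_eq_zero_iff two_ne_zero |>.1 (by linarith)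
    have hk0 : Lam k k = 0 := by linarith
    exact hkc (by rw [hc0, hk' hk0]; rfl)

end TwoElementary

/-! ### Assembly of the criterion. -/

theorem mainTheorem5
    (ι : OG10.Lam.IsometryEquiv OG10.Lam)
    (hinv : ∀ x, ι (ι x) = x)
    (hdisc : OG10.discMap ι = -AddMonoidHom.id _)
    (hneg : OG10.NegativeDefinite (OG10.coinvariantLattice ι))
    (r a δ : ℕ)
    (hr : r = Module.finrank ℤ (OG10.coinvariants ι))
    (ha : a = OG10.discLength (OG10.invariantLattice ι))
    (hδ : δ = OG10.delta (OG10.invariantLattice ι)) :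
    Nonempty (OG10.DiscGroup (OG10.invariantLattice ι) ≃+ (Fin a → ZMod 2)) ∧
    (OG10.SplitsU (OG10.invariantLattice ι) ↔
      (r ≤ 20 ∧ (a : ℤ) ≤ 22 - (r : ℤ)) ∧
      ((a : ℤ) = 22 - (r : ℤ) → δ = 0 → r ≡ 2 [MOD 8])) ∧
    (r < 12 → OG10.SplitsU (OG10.invariantLattice ι)) := by
  open TwoElementary in
  have hL := isTwoElementary_invariantLattice Lam_symm Lam_even represents_Lam hinv hdisc
  have hs := isSignature_invariantLattice Lam_symm
    (represents_Lam.nondeg Lam_symm (by norm_num)) hasSign_Lam hinv hneg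
  have hle := discLength_invariantLattice_le Lam_symm Lam_even represents_Lam hinv hdisc
  have hrk := finrank_invariants_add hinv
  have hidx := hL.dblIndex_mul
  have hδ' := hL.delta_eq_zero_iff
  rw [finrank_carrier] at hrk
  rw [← hr] at hs hle hrk
  rw [← ha] at hle hidx
  rw [← hδ] at hδ'
  have hback : r ≤ 20 → a + 2 ≤ Module.finrank ℤ (OG10.invariants ι) →
      OG10.SplitsU (OG10.invariantLattice ι) ∨
      (a + 2 = Module.finrank ℤ (OG10.invariants ι) ∧ δ = 0 ∧ (-18 + r : ℤ) % 8 = 4) := by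
    intro hr20 han
    rw [hδ']
    -- With s = r - 18 and n = 24 - r, the isotropy condition reads |r - 19| + 1 < 24 - r, true for
    -- r ≤ 20.
    exact hL.splitsU_or hs (by omega) hidx han
  refine ⟨ha ▸ hL.nonempty_discGroup_equiv, ⟨fun hU => ?_, ?_⟩, fun hr12 => ?_⟩
  · obtain ⟨h1, h2⟩ := hL.add_two_le_of_splitsU hs hidx hU
    have hr20 := finrank_coinvariants_le hneg hU
    rw [← hr] at hr20
    refine ⟨⟨hr20, by omega⟩, fun h3 h4 => ?_⟩
    have := h2 (by omega) (hδ'.1 h4)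
    unfold Nat.ModEq
    omega
  · rintro ⟨⟨hr20, har⟩, hobs⟩
    refine (hback hr20 (by omega)).resolve_right ?_
    rintro ⟨h1, h2, h3⟩
    -- The obstruction s ≡ 4 mod 8 is r ≡ 6 mod 8, incompatible with r ≡ 2.
    have := hobs (by omega) h2
    unfold Nat.ModEq at this
    omega
  -- Since a ≤ r, the obstruction's equality a = 22 - r forces r = 11, where s = -7 is not 4 mod 8.
  · refine (hback (by omega) (by omega)).resolve_right ?_
    rintro ⟨h1, h2, h3⟩
    omega
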